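/- Let $0<a_0<\tfrac12$ and let $f:\mathbb R\to(0,\infty)$ be the profile of the Delaunay unduloid of neck radius $a_0$ and mean curvature $2$ (sum of the principal curvatures): $f$ is positive, smooth, even, periodic with least period $T>0$, and $$-\frac{f''}{(1+(f')^2)^{3/2}}+\frac1{f\sqrt{1+(f')^2}}=2,\qquad f(0)=1-a_0,\quad f'(0)=0 .$$ Let $\Sigma=\{y(\omega)=(f(y_3)\cos\theta,f(y_3)\sin\theta,y_3)\}$, $\omega=(\omega_1,\omega_2)=(\theta,y_3)$, with unit normal $\nu(y)=\frac1{\sqrt{1+f'(y_3)^2}}\big(\tfrac{y_1}{f(y_3)},\tfrac{y_2}{f(y_3)},-f'(y_3)\big)$, and let $\Sigma^n=\{y\in\Sigma:-\tfrac T2\le y_3<-\tfrac T2+nT\}$. Let $R=\frac{nT}{2\pi}$ and $X(y)=\big(y_1,(R+y_2)\cos\tfrac{y_3}R,(R+y_2)\sin\tfrac{y_3}R\big)$. For $h:\Sigma\to\mathbb R$ put $y_h=y+h(y)\nu(y)$ and let $\tilde H_{\tilde\Sigma^n_h}(y)$ be the mean curvature of $\tilde\Sigma^n_h=\{X(y_h):y\in\Sigma^n\}$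 at $X(y_h)$. A surface parametrized by $S(\omega)$ with unit normal $N=\frac{D_{\omega_1}S\times D_{\omega_2}S}{|D_{\omega_1}S\times D_{\omega_2}S|}$ has $Y=D_\omega S$, metric $g=Y^TY$, second fundamental form $A=-g^{-1}Y^TD_\omega N$ and mean curvature $-\operatorname{trace}A$. Let $$J_{\Sigma^n}[h]=\frac1{\sqrt{\det g}}\,\partial_i\big(g^{ij}\sqrt{\det g}\,\partial_jh\big)+|A|^2h ,\qquad |A|^2=\operatorname{trace}(A^2),$$ with $g$, $A$ those of $\Sigma$ in the coordinates $\omega$. A function $u$ on $\Sigma$ is called symmetric if $$u(y_1,y_2,y_3)=u(-y_1,y_2,y_3)=u(y_1,y_2,-y_3)=u(y_1,y_2,y_3+T).$$ Then there are $\delta>0$, $N\ge1$, functions $a=a_n:\Sigma\to\mathbb R$ and $\ell=\ell_n(y,p)$ for $n\ge N$, and a function $q=q(y,p)$, where $y\in\Sigma$ and $p$ stands for the values $(h,D_\omega h,D^2_\omega h)\in\mathbb R\times\mathbb R^2\times\mathbb R^3$ of a function and of its first and second derivatives, none of them depending on $h$ or $\alpha$ below, such that: 1. $a_n$ is smooth,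 symmetric, and bounded together with each of its derivatives in $\omega$, uniformly in $n\ge N$. 2. $\ell_n$ and $q$ are smooth in $(\omega,p)$ on $\{|h|<\delta\}$, and on each set $\{|h|<\delta,\ |p|\le M\}$ they are bounded together with each of their derivatives, uniformly in $n\ge N$. 3. For all $y\in\Sigma$ and $n\ge N$: $\ell_n(y,0)=0$ and $D_p\ell_n(y,0)\ne0$; $q(y,0)=0$, $D_pq(y,0)=0$ and $D_p^2q(y,0)\neq0$. 4. For every $\alpha\in(0,1)$ and every symmetric $h:\Sigma\to\mathbb R$ of class $C^{2,\alpha}$ with $|h|<\delta$ on $\Sigma$, and every $n\ge N$, $\omega\mapsto X(y_h(\omega))$ is an immersion and, for all $y\in\Sigma^n$, with $f,f',f''$ taken at $y_3$, $$\begin{aligned}\tilde H_{\tilde\Sigma^n_h}(y)={}&2+\frac{y_2}{R\,f}\left(\frac{(2-(f')^2)\,f\,f''}{(1+(f')^2)^{5/2}}+\frac{1+3(f')^2}{(1+(f')^2)^{3/2}}\right)+n^{-2}a_n(y)-J_{\Sigma^n}[h](y)\\&+n^{-1}\,\ell_n[h,Dh,D^2h](y)+q[h,Dh,D^2h](y),\end{aligned}$$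 where $\ell_n[h,Dh,D^2h](y)=\ell_n(y,(h,D_\omega h,D_\omega^2h)(y))$, and likewise for $q$. The functions $y\mapsto\ell_n[h,Dh,D^2h](y)$ and $y\mapsto q[h,Dh,D^2h](y)$ are symmetric, and if $h$ is also even in $y_2$, then $q[h,Dh,D^2h]$ is even in $y_2$. -/

import Mathlib

open scoped Matrix ContDiff

noncomputable section

namespace Unduloid

/-- Points and vectors of `ℝ³`. Lengths and angles are always taken with the dot product `⬝ᵥ`. -/
abbrev R3 := Fin 3 → ℝ

/-- Parameters `w = (θ, y₃)`. -/
abbrev Param := Fin 2 → ℝ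

/-- The profile `f` of the unduloid of neck radius `a` and mean curvature `2`: the positive smooth
even periodic solution of the Cauchy problem, together with its (least positive) period `T`. -/
structure IsProfile (a T : ℝ) (f : ℝ → ℝ) : Prop where
  smooth : ContDiff ℝ ∞ f
  pos : ∀ t, 0 < f t
  even : ∀ t, f (-t) = f t
  period_pos : 0 < T
  periodic : Function.Periodic f T
  period_least : ∀ S, 0 < S → Function.Periodic f S → T ≤ S
  ode : ∀ t, -(deriv (deriv f) t / (1 + deriv f t ^ 2) ^ (3 / 2 : ℝ))
    + 1 / (f t * √(1 + deriv f t ^ 2)) = 2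
  init : f 0 = 1 - a
  init_deriv : deriv f 0 = 0

/-! ### Parametrized surfaces in `ℝ³` -/

/-- The partial derivative `D_{w_j}`. -/
def pd {E : Type*} [NormedAddCommGroup E] [NormedSpace ℝ E] (j : Fin 2) (u : Param → E)
    (w : Param) : E :=
  fderiv ℝ u w (Pi.single j 1)

/-- The `3 × 2` matrix `D_w S = [D_{w_1} S, D_{w_2} S]`. -/
def jacMat (S : Param → R3) (w : Param) : Matrix (Fin 3) (Fin 2) ℝ :=
  Matrix.of fun i j => pd j S w i

/-- The (not normalized) normal vector `Y₁ × Y₂`, where `Y_j = D_{w_j} S`. -/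
def crossVec (S : Param → R3) (w : Param) : R3 :=
  crossProduct (pd 0 S w) (pd 1 S w)

/-- The unit normal vector `(Y₁ × Y₂) / |Y₁ × Y₂|`. -/
def unitNormal (S : Param → R3) (w : Param) : R3 :=
  (√(crossVec S w ⬝ᵥ crossVec S w))⁻¹ • crossVec S w

/-- The metric `g = Yᵀ Y`. -/
def metric (S : Param → R3) (w : Param) : Matrix (Fin 2) (Fin 2) ℝ :=
  (jacMat S w)ᵀ * jacMat S w

/-- The second fundamental form `A = -(Yᵀ Y)⁻¹ Yᵀ D_w ν`. -/
def secondForm (S : Param → R3) (w : Param) : Matrix (Fin 2) (Fin 2) ℝ :=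
  -((metric S w)⁻¹ * (jacMat S w)ᵀ * jacMat (unitNormal S) w)

/-- The mean curvature `H = -trace A`, the sum of the principal curvatures; it is positive for a
round sphere with outward normal. -/
def meanCurvature (S : Param → R3) (w : Param) : ℝ :=
  -(secondForm S w).trace

/-- The Jacobi operator
`J[u] = (det g)^{-1/2} ∑_{i,j} ∂_i (g^{ij} (det g)^{1/2} ∂_j u) + |A|² u` of the surface `S`, with
`|A|² = trace (A A)` the sum of the squares of the principal curvatures. -/
def jacobiOp (S : Param → R3) (u : Param → ℝ) (w : Param) : ℝ :=
  (1 / √(metric S w).det) *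
      ∑ i, ∑ j, pd i (fun v => (metric S v)⁻¹ i j * √(metric S v).det * pd j u v) w
    + (secondForm S w * secondForm S w).trace * u w

/-! ### The unduloid and its perturbations

A function on the unduloid `Σ` is given as a function on `ℝ³` of which only the values on `Σ` are
ever used. -/

/-- The parametrization `y(θ, y₃) = (f(y₃) cos θ, f(y₃) sin θ, y₃)`. -/
def param (f : ℝ → ℝ) (w : Param) : R3 :=
  ![f (w 1) * Real.cos (w 0), f (w 1) * Real.sin (w 0), w 1]

/-- Parameters `(θ, y₃)` of the point `y`, with `θ` the polar angle of `(y₁, y₂)` in `(-π, π]`: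
`param f (coord y) = y` for every `y` of the unduloid. -/
def coord (y : R3) : Param :=
  ![Complex.arg ⟨y 0, y 1⟩, y 2]

/-- The unduloid `Σ`. -/
def surface (f : ℝ → ℝ) : Set R3 :=
  Set.range (param f)

/-- The block `Σ_k = {y ∈ Σ | -T/2 + kT ≤ y₃ < T/2 + kT}`. -/
def block (T : ℝ) (f : ℝ → ℝ) (k : ℕ) : Set R3 :=
  {y | y ∈ surface f ∧ -(T / 2) + k * T ≤ y 2 ∧ y 2 < T / 2 + k * T}

/-- The truncated unduloid `Σⁿ`, the union of the blocks `Σ_0, …, Σ_{n-1}`. -/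
def truncated (T : ℝ) (f : ℝ → ℝ) (n : ℕ) : Set R3 :=
  ⋃ k ∈ Finset.range n, block T f k

/-- The unit normal `ν(y)` of the unduloid at `y`. -/
def nu (f : ℝ → ℝ) (y : R3) : R3 :=
  (1 / √(1 + deriv f (y 2) ^ 2)) • ![(f (y 2))⁻¹ * y 0, (f (y 2))⁻¹ * y 1, -deriv f (y 2)]

/-- The normal perturbation `y_h = y + h(y) ν(y)`. -/
def perturbed (f : ℝ → ℝ) (h : R3 → ℝ) (y : R3) : R3 :=
  y + h y • nu f y

/-- The radius `R` with `2 π R = n T`. -/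
def radius (T : ℝ) (n : ℕ) : ℝ :=
  n * T / (2 * Real.pi)

/-- The map `X`, which coils the `y₃`-axis around the circle of radius `R`. -/
def coil (R : ℝ) (y : R3) : R3 :=
  ![y 0, (R + y 1) * Real.cos (y 2 / R), (R + y 1) * Real.sin (y 2 / R)]

/-- The parametrization `w ↦ X(y_h(w))` of the coiled perturbed unduloid. -/
def coiledParam (T : ℝ) (f : ℝ → ℝ) (n : ℕ) (h : R3 → ℝ) (w : Param) : R3 :=
  coil (radius T n) (perturbed f h (param f w))

/-- The mean curvature of the coiled perturbed unduloid at the point `X(y_h)`, as a function of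
`y`. -/
def coiledCurvature (T : ℝ) (f : ℝ → ℝ) (n : ℕ) (h : R3 → ℝ) (y : R3) : ℝ :=
  meanCurvature (coiledParam T f n h) (coord y)

/-- The Jacobi operator of the unduloid applied to `h`, as a function of `y`. -/
def jacobi (f : ℝ → ℝ) (h : R3 → ℝ) (y : R3) : ℝ :=
  jacobiOp (param f) (fun w => h (param f w)) (coord y)

/-- The symmetries: even in `y₁`, even in `y₃`, and `T`-periodic in `y₃`, on the unduloid. -/
def Symmetric (T : ℝ) (f : ℝ → ℝ) (u : R3 → ℝ) : Prop :=
  ∀ y ∈ surface f,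
    u y = u ![-y 0, y 1, y 2] ∧ u y = u ![y 0, y 1, -y 2] ∧ u y = u ![y 0, y 1, y 2 + T]

/-- Evenness in `y₂` on the unduloid. -/
def EvenY2 (f : ℝ → ℝ) (u : R3 → ℝ) : Prop :=
  ∀ y ∈ surface f, u y = u ![y 0, -y 1, y 2]

/-- `h` is of class `C^{2,α}` on the unduloid, in the coordinates `w`. -/
def IsC2Holder (α : ℝ) (f : ℝ → ℝ) (h : R3 → ℝ) : Prop :=
  ContDiff ℝ 2 (fun w => h (param f w)) ∧
    ∃ C : ℝ, ∀ w w' : Param,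
      ‖iteratedFDeriv ℝ 2 (fun v => h (param f v)) w
        - iteratedFDeriv ℝ 2 (fun v => h (param f v)) w'‖ ≤ C * ‖w - w'‖ ^ α

/-- Values of `(h, D_w h, D_w² h)`: the triple `(p, (p₁, p₂), (p₁₁, p₁₂, p₂₂))`. -/
abbrev Jet := ℝ × (ℝ × ℝ) × (ℝ × ℝ × ℝ)

/-- The triple `(h, D_w h, D_w² h)` at the point `y` of the unduloid. -/
def jet (f : ℝ → ℝ) (h : R3 → ℝ) (y : R3) : Jet :=
  let u : Param → ℝ := fun w => h (param f w)
  (u (coord y), (pd 0 u (coord y), pd 1 u (coord y)),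
    (pd 0 (pd 0 u) (coord y), pd 0 (pd 1 u) (coord y), pd 1 (pd 1 u) (coord y)))

/-- The coefficient
`(2 - f'²) f f'' / (1 + f'²)^{5/2} + (1 + 3 f'²) / (1 + f'²)^{3/2}` at `t`. -/
def firstCoeff (f : ℝ → ℝ) (t : ℝ) : ℝ :=
  (2 - deriv f t ^ 2) * f t * deriv (deriv f) t / (1 + deriv f t ^ 2) ^ (5 / 2 : ℝ)
    + (1 + 3 * deriv f t ^ 2) / (1 + deriv f t ^ 2) ^ (3 / 2 : ℝ)

end Unduloid

end

noncomputable section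

namespace Unduloid

/-! Put `e = 1/R`. The surface `X(y_h)` has cylindrical data `r = f + h·nrad`, `z = y₃ + h·nax`, and
a rotation of space depending on the point removes the coiling angle `z/R` from its first and second
derivatives. Mean curvature is invariant under rotations, so it equals an explicit function `H(e, w,
p)` (`jetCurv`) of `e`, the parameters `w = (θ, y₃)` and the 2-jet `p` of `h`. This function is
smooth, also at `e = 0` (the straight unduloid), and periodic in `w`. This is
`coiled_immersion_and_curvature`.

The theorem is then a Taylor expansion of `H` in `(e, p)` at `(0, 0)`: `H(e,p) = H(0,0) + [H(e,0) -
H(0,0)] + [H(0,p) - H(0,0)] + [mixed second difference]`. Here `H(0,0) = 2` by the profile equation.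
The first bracket is `e sin θ · firstCoeff` (`hasDerivAt_jetCurv_eps`) up to `O(e²)`, which gives
`a`. The second is `-J` (`hasDerivAt_jetCurv_jet`) plus a part of second order, which is `q`. The
last vanishes at `e = 0` and at `p = 0` and gives `ℓ`.

Uniformity in `n`: by Hadamard's lemma the powers of `e` divide out with quotients smooth in `(e, w,
p)`. Since `n e = 2π/T` is constant, `a` and `ℓ` are values of fixed smooth functions with `e ∈ [0,
1]`, and by periodicity only a compact set of `w` matters. Cutoffs in `e` and in the value of `h`
make `H` smooth everywhere; derivatives of `h` need no cutoff, because the immersion property does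
not depend on them (`cross_ne_zero_of_pos`).

Nondegeneracy is tested on special jets. For `q`, the coefficient of `h_θθ` on parallel surfaces
varies with the distance. For `ℓ`, coiling changes the ratio of the coefficients of `h_θθ` and
`h_{y₃y₃}` where `sin θ ≠ 0`, and the coefficient of `h_θ` where `sin θ = 0`. The symmetries come
from reflections of space; `θ ↦ -θ` is one only for `e = 0`, hence evenness in `y₂` is available for
`q`. -/

/-! ### Smooth parameter integrals and Hadamard's lemma -/

/-- Differentiation under the integral sign gives an integral of the same kind with values in `H
→L[ℝ] E`; therefore `E` is quantified after `m`, and induction on `m` applies. Properness of `H`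
supplies the dominating constant, by compactness of a closed ball times `[0, 1]`. -/
theorem contDiff_nat_intervalIntegral {H : Type} [NormedAddCommGroup H] [NormedSpace ℝ H]
    [ProperSpace H] (m : ℕ) :
    ∀ {E : Type} [NormedAddCommGroup E] [NormedSpace ℝ E] [CompleteSpace E] (g : H × ℝ → E),
      ContDiff ℝ ∞ g → ContDiff ℝ m (fun x => ∫ t in (0 : ℝ)..1, g (x, t)) := by
  have key : ∀ {E : Type} [NormedAddCommGroup E] [NormedSpace ℝ E] [CompleteSpace E]
      (g : H × ℝ → E), ContDiff ℝ ∞ g → ∀ x : H, HasFDerivAt (fun x => ∫ t in (0 : ℝ)..1, g (x, t))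
        (∫ t in (0 : ℝ)..1, (fderiv ℝ g (x, t)).comp (ContinuousLinearMap.inl ℝ H ℝ)) x := by
    intro E _ _ _ g hg x
    have hd : Continuous fun y : H × ℝ =>
        (fderiv ℝ g y).comp (ContinuousLinearMap.inl ℝ H ℝ) :=
      (hg.continuous_fderiv (by simp)).clm_comp continuous_const
    obtain ⟨B, hB⟩ := ((isCompact_closedBall x 1).prod
      (isCompact_Icc (a := (0 : ℝ)) (b := 1))).exists_bound_of_continuousOn hd.continuousOn
    refine intervalIntegral.hasFDerivAt_integral_of_dominated_of_fderiv_le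
      (F := fun x t => g (x, t))
      (F' := fun x t => (fderiv ℝ g (x, t)).comp (ContinuousLinearMap.inl ℝ H ℝ))
      (s := Metric.ball x 1) (bound := fun _ => B)
      (Metric.ball_mem_nhds x one_pos) ?_ ?_ ?_ ?_ ?_ ?_
    · exact Filter.Eventually.of_forall fun y =>
        (hg.continuous.comp (by fun_prop : Continuous fun t : ℝ => (y, t))).aestronglyMeasurable
    · exact (hg.continuous.comp
        (by fun_prop : Continuous fun t : ℝ => (x, t))).intervalIntegrable _ _
    · exact (hd.comp (by fun_prop : Continuous fun t : ℝ => (x, t))).aestronglyMeasurable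
    · refine Filter.Eventually.of_forall fun t ht y hy => hB (y, t) ⟨?_, ?_⟩
      · exact Metric.ball_subset_closedBall hy
      · rw [Set.uIoc_of_le zero_le_one] at ht
        exact ⟨ht.1.le, ht.2⟩
    · exact intervalIntegrable_const
    · refine Filter.Eventually.of_forall fun t _ y _ => ?_
      have h1 : HasFDerivAt g (fderiv ℝ g (y, t)) (y, t) :=
        (hg.differentiable (by simp) (y, t)).hasFDerivAt
      exact h1.comp y (hasFDerivAt_prodMk_left y t)
  induction m with
  | zero =>
    intro E _ _ _ g hg
    have : Differentiable ℝ (fun x => ∫ t in (0 : ℝ)..1, g (x, t)) :=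
      fun x => (key g hg x).differentiableAt
    exact contDiff_zero.2 this.continuous
  | succ m ih =>
    intro E _ _ _ g hg
    have h := contDiff_succ_iff_fderiv (𝕜 := ℝ) (n := (m : WithTop ℕ∞))
      (f := fun x => ∫ t in (0 : ℝ)..1, g (x, t))
    refine h.2 ⟨fun x => (key g hg x).differentiableAt, by simp, ?_⟩
    rw [funext fun x => (key g hg x).fderiv]
    exact ih (fun y => (fderiv ℝ g y).comp (ContinuousLinearMap.inl ℝ H ℝ))
      ((hg.fderiv_right (m := ∞) (by simp)).clm_comp contDiff_const)

theorem contDiff_intervalIntegral {H : Type} [NormedAddCommGroup H] [NormedSpace ℝ H]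
    [ProperSpace H] {E : Type} [NormedAddCommGroup E] [NormedSpace ℝ E] [CompleteSpace E]
    (g : H × ℝ → E) (hg : ContDiff ℝ ∞ g) :
    ContDiff ℝ ∞ (fun x => ∫ t in (0 : ℝ)..1, g (x, t)) :=
  contDiff_infty.2 fun m => contDiff_nat_intervalIntegral m g hg

/-- **Hadamard's lemma** with parameters. -/
theorem exists_contDiff_eq_add_mul {H : Type} [NormedAddCommGroup H] [NormedSpace ℝ H]
    [ProperSpace H] (G : ℝ × H → ℝ) (hG : ContDiff ℝ ∞ G) :
    ∃ K : ℝ × H → ℝ, ContDiff ℝ ∞ K ∧ ∀ e x, G (e, x) = G (0, x) + e * K (e, x) := by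
  refine ⟨fun y => ∫ t in (0 : ℝ)..1, fderiv ℝ G (t * y.1, y.2) (1, 0), ?_, ?_⟩
  · refine contDiff_intervalIntegral
      (fun z : (ℝ × H) × ℝ => fderiv ℝ G (z.2 * z.1.1, z.1.2) (1, 0)) ?_
    have h1 : ContDiff ℝ ∞ (fderiv ℝ G) := hG.fderiv_right (by simp)
    exact (h1.comp (by fun_prop : ContDiff ℝ ∞ fun z : (ℝ × H) × ℝ =>
      (z.2 * z.1.1, z.1.2))).clm_apply contDiff_const
  · intro e x
    have hd : ∀ t : ℝ, HasDerivAt (fun t : ℝ => G (t * e, x))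
        (e * fderiv ℝ G (t * e, x) (1, 0)) t := by
      intro t
      have h1 : HasFDerivAt G (fderiv ℝ G (t * e, x)) (t * e, x) :=
        (hG.differentiable (by simp) _).hasFDerivAt
      have h2 : HasDerivAt (fun t : ℝ => (t * e, x)) ((e, 0) : ℝ × H) t := by
        simpa using ((hasDerivAt_id t).mul_const e).prodMk (hasDerivAt_const t x)
      have h3 := h1.comp_hasDerivAt t h2
      have h4 : ((e, 0) : ℝ × H) = e • ((1, 0) : ℝ × H) := by simp
      rw [h4, map_smul, smul_eq_mul] at h3
      exact h3
    have hc : Continuous fun t : ℝ => e * fderiv ℝ G (t * e, x) (1, 0) := by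
      have h1 : Continuous (fderiv ℝ G) := hG.continuous_fderiv (by simp)
      exact continuous_const.mul ((h1.comp (by fun_prop :
        Continuous fun t : ℝ => (t * e, x))).clm_apply continuous_const)
    have := intervalIntegral.integral_eq_sub_of_hasDerivAt (a := 0) (b := 1)
      (fun t _ => hd t) (hc.intervalIntegrable _ _)
    rw [intervalIntegral.integral_const_mul] at this
    simp only [zero_mul, one_mul] at this
    simp only [this]
    ring

/-- Uniform bounds for the derivatives in `x` of a smooth function of `(e, x)`. -/
theorem exists_bound_iteratedFDeriv_slice {H : Type} [NormedAddCommGroup H] [NormedSpace ℝ H]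
    (K : ℝ × H → ℝ) (hK : ContDiff ℝ ∞ K) (k : ℕ) {s : Set H} (hs : IsCompact s) :
    ∃ C : ℝ, ∀ e ∈ Set.Icc (0 : ℝ) 1, ∀ x ∈ s,
      ‖iteratedFDeriv ℝ k (fun x => K (e, x)) x‖ ≤ C := by
  have hc : Continuous (iteratedFDeriv ℝ k K) := hK.continuous_iteratedFDeriv (by
    exact_mod_cast le_top)
  obtain ⟨C, hC⟩ := ((isCompact_Icc (a := (0 : ℝ)) (b := 1)).prod hs).exists_bound_of_continuousOn
    hc.continuousOn
  refine ⟨C, fun e he x hx => ?_⟩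
  -- The slice is a translate of `K` composed with the inclusion of `H`, which has norm at most one;
  -- its derivatives are thus bounded by those of `K`.
  have h1 : (fun x => K (e, x)) =
      (fun y => K ((e, 0) + y)) ∘ (ContinuousLinearMap.inr ℝ ℝ H) := by
    ext y; simp
  have h2 : ContDiff ℝ ∞ (fun y => K ((e, 0) + y)) := hK.comp (contDiff_const.add contDiff_id)
  rw [h1, ContinuousLinearMap.iteratedFDeriv_comp_right _ h2 x (i := k)
    (by exact_mod_cast le_top), iteratedFDeriv_comp_add_left]
  refine (ContinuousMultilinearMap.norm_compContinuousLinearMap_le _ _).trans ?_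
  have h3 : ‖ContinuousLinearMap.inr ℝ ℝ H‖ ≤ 1 := by
    refine ContinuousLinearMap.opNorm_le_bound _ zero_le_one fun y => ?_
    simp
  have h4 : ∏ _i : Fin k, ‖ContinuousLinearMap.inr ℝ ℝ H‖ ≤ 1 :=
    Finset.prod_le_one (fun _ _ => norm_nonneg _) fun _ _ => h3
  have h5 : ‖iteratedFDeriv ℝ k K ((e, 0) + ContinuousLinearMap.inr ℝ ℝ H x)‖ ≤ C := by
    have := hC (e, x) ⟨he, hx⟩
    simpa using this
  calc _ ≤ C * 1 := mul_le_mul h5 h4 (Finset.prod_nonneg fun _ _ => norm_nonneg _)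
        ((norm_nonneg _).trans h5)
    _ = C := mul_one C

/-! ### Partial derivatives -/

section pd

variable {E : Type*} [NormedAddCommGroup E] [NormedSpace ℝ E]

theorem ContDiff.pd {m n : WithTop ℕ∞} {u : Param → E} (hu : ContDiff ℝ n u) (hmn : m + 1 ≤ n)
    (j : Fin 2) : ContDiff ℝ m (pd j u) :=
  (hu.fderiv_right hmn).clm_apply contDiff_const

theorem pd_comm {u : Param → E} (hu : ContDiff ℝ 2 u) (i j : Fin 2) (w : Param) :
    pd i (pd j u) w = pd j (pd i u) w := by
  have h1 : ContDiff ℝ 1 (fderiv ℝ u) := hu.fderiv_right (by norm_num)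
  have h2 : ∀ i j, pd i (pd j u) w = fderiv ℝ (fderiv ℝ u) w (Pi.single i 1) (Pi.single j 1) := by
    intro i j
    have h3 : pd j u = fun v => fderiv ℝ u v (Pi.single j 1) := rfl
    rw [h3, pd, fderiv_clm_apply (h1.differentiable (by simp) w) (differentiableAt_const _)]
    simp
  rw [h2, h2]
  exact (hu.contDiffAt.isSymmSndFDerivAt (by simp)).eq _ _

theorem pd_apply {S : Param → R3} {w : Param} (hS : DifferentiableAt ℝ S w) (j : Fin 2)
    (i : Fin 3) : pd j S w i = pd j (fun v => S v i) w := by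
  have h := hasFDerivAt_pi'.1 hS.hasFDerivAt i
  rw [pd, pd, h.fderiv]
  rfl

theorem pd_add {u v : Param → E} {w : Param} (hu : DifferentiableAt ℝ u w)
    (hv : DifferentiableAt ℝ v w) (j : Fin 2) :
    pd j (fun x => u x + v x) w = pd j u w + pd j v w := by
  rw [pd, fderiv_fun_add hu hv]; rfl

theorem pd_sub {u v : Param → E} {w : Param} (hu : DifferentiableAt ℝ u w)
    (hv : DifferentiableAt ℝ v w) (j : Fin 2) :
    pd j (fun x => u x - v x) w = pd j u w - pd j v w := by
  rw [pd, fderiv_fun_sub hu hv]; rfl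

theorem pd_const (a : E) (w : Param) (j : Fin 2) : pd j (fun _ => a) w = 0 := by
  simp [pd]

theorem pd_mul {u v : Param → ℝ} {w : Param} (hu : DifferentiableAt ℝ u w)
    (hv : DifferentiableAt ℝ v w) (j : Fin 2) :
    pd j (fun x => u x * v x) w = pd j u w * v w + u w * pd j v w := by
  rw [pd, fderiv_fun_mul hu hv]
  simp [pd]
  ring

theorem pd_comp {φ : ℝ → ℝ} {φ' : ℝ} {u : Param → ℝ} {w : Param} (hφ : HasDerivAt φ φ' (u w))
    (hu : DifferentiableAt ℝ u w) (j : Fin 2) :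
    pd j (fun x => φ (u x)) w = φ' * pd j u w := by
  have h : HasFDerivAt (fun x => φ (u x)) (φ' • fderiv ℝ u w) w := hφ.comp_hasFDerivAt w hu.hasFDerivAt
  rw [pd, h.fderiv]; rfl

theorem pd_dotProduct {u v : Param → R3} {w : Param} (hu : DifferentiableAt ℝ u w)
    (hv : DifferentiableAt ℝ v w) (j : Fin 2) :
    pd j (fun x => u x ⬝ᵥ v x) w = pd j u w ⬝ᵥ v w + u w ⬝ᵥ pd j v w := by
  have hu' := fun i => differentiableAt_pi.1 hu i
  have hv' := fun i => differentiableAt_pi.1 hv i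
  have h : (fun x => u x ⬝ᵥ v x) =
      fun x => (u x 0 * v x 0 + u x 1 * v x 1) + u x 2 * v x 2 := by
    ext x; simp [Matrix.vec3_dotProduct]
  have hm := fun i => (hu' i).fun_mul (hv' i)
  rw [h, pd_add ((hm 0).fun_add (hm 1)) (hm 2), pd_add (hm 0) (hm 1), pd_mul (hu' 0) (hv' 0),
    pd_mul (hu' 1) (hv' 1), pd_mul (hu' 2) (hv' 2)]
  simp only [Matrix.vec3_dotProduct, pd_apply hu, pd_apply hv]
  ring

theorem pd_coord (i j : Fin 2) (w : Param) :
    pd j (fun v : Param => v i) w = (Pi.single j 1 : Param) i := by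
  have h : HasFDerivAt (fun v : Param => v i) (ContinuousLinearMap.proj i) w :=
    (ContinuousLinearMap.proj (R := ℝ) (φ := fun _ : Fin 2 => ℝ) i).hasFDerivAt
  rw [pd, h.fderiv]; rfl

end pd

/-! ### Mean curvature in terms of first and second derivatives -/

/-- The mean curvature of a surface with first and second derivatives `v₁, v₂, v₁₁, v₁₂, v₂₂`. -/
def hForm (v₁ v₂ v₁₁ v₁₂ v₂₂ : R3) : ℝ :=
  -((v₂ ⬝ᵥ v₂) * (v₁₁ ⬝ᵥ crossProduct v₁ v₂) - 2 * (v₁ ⬝ᵥ v₂) * (v₁₂ ⬝ᵥ crossProduct v₁ v₂)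
    + (v₁ ⬝ᵥ v₁) * (v₂₂ ⬝ᵥ crossProduct v₁ v₂))
    / √(crossProduct v₁ v₂ ⬝ᵥ crossProduct v₁ v₂) ^ 3

theorem dotProduct_self_pos {v : R3} (hv : v ≠ 0) : 0 < v ⬝ᵥ v := by
  have h0 : 0 ≤ v ⬝ᵥ v := by
    rw [Matrix.vec3_dotProduct]; nlinarith [sq_nonneg (v 0), sq_nonneg (v 1), sq_nonneg (v 2)]
  exact h0.lt_of_ne fun h => hv (dotProduct_self_eq_zero.1 h.symm)

theorem metric_apply (S : Param → R3) (w : Param) (i j : Fin 2) :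
    metric S w i j = pd i S w ⬝ᵥ pd j S w := rfl

theorem metric_det (S : Param → R3) (w : Param) :
    (metric S w).det = crossVec S w ⬝ᵥ crossVec S w := by
  rw [Matrix.det_fin_two]
  simp only [metric_apply, crossVec, cross_dot_cross]

theorem contDiff_crossVec {S : Param → R3} {m n : WithTop ℕ∞} (hS : ContDiff ℝ n S)
    (hmn : m + 1 ≤ n) : ContDiff ℝ m (crossVec S) := by
  have h : ∀ (j : Fin 2) (i : Fin 3), ContDiff ℝ m fun w => pd j S w i := fun j i =>
    contDiff_pi.1 (ContDiff.pd hS hmn j) i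
  unfold crossVec
  simp only [cross_apply]
  rw [contDiff_pi]
  intro i
  fin_cases i <;> simp <;> exact ((h _ _).mul (h _ _)).sub ((h _ _).mul (h _ _))

theorem differentiableAt_unitNormal {S : Param → R3} (hS : ContDiff ℝ 2 S) {w : Param}
    (hw : crossVec S w ≠ 0) : DifferentiableAt ℝ (unitNormal S) w := by
  have h1 : DifferentiableAt ℝ (crossVec S) w :=
    (contDiff_crossVec (m := 1) hS (by norm_num)).differentiable (by simp) w
  have h2 := fun i => differentiableAt_pi.1 h1 i
  have h3 : DifferentiableAt ℝ (fun w => crossVec S w ⬝ᵥ crossVec S w) w := by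
    simp only [Matrix.vec3_dotProduct]
    exact (((h2 0).mul (h2 0)).add ((h2 1).mul (h2 1))).add ((h2 2).mul (h2 2))
  have h4 := dotProduct_self_pos hw
  exact ((h3.sqrt h4.ne').inv (Real.sqrt_pos.2 h4).ne').smul h1

/-- Differentiate the identity `Y_i · N = 0`. This trades derivatives of the unit normal for second
derivatives of `S`. -/
theorem pd_dotProduct_unitNormal {S : Param → R3} (hS : ContDiff ℝ 2 S) {w : Param}
    (hw : crossVec S w ≠ 0) (i j : Fin 2) :
    pd i S w ⬝ᵥ pd j (unitNormal S) w = -(pd j (pd i S) w ⬝ᵥ unitNormal S w) := by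
  have h0 : (fun v => pd i S v ⬝ᵥ unitNormal S v) = fun _ => 0 := by
    ext v
    fin_cases i <;> simp [unitNormal, crossVec]
  have h1 : DifferentiableAt ℝ (pd i S) w :=
    (ContDiff.pd (m := 1) hS (by norm_num) i).differentiable (by simp) w
  have h2 := pd_dotProduct h1 (differentiableAt_unitNormal hS hw) j
  rw [h0, pd_const] at h2
  linarith

/-- The trace of `g⁻¹ Yᵀ DN` is expanded with the adjugate formula for the inverse of a 2 × 2
matrix, using `det g = |Y₁ × Y₂|²`. Afterwards the curvature is an algebraic function of the 2-jet
of `S`. -/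
theorem meanCurvature_eq_hForm {S : Param → R3} (hS : ContDiff ℝ 2 S) {w : Param}
    (hw : crossVec S w ≠ 0) :
    meanCurvature S w = hForm (pd 0 S w) (pd 1 S w) (pd 0 (pd 0 S) w) (pd 0 (pd 1 S) w)
      (pd 1 (pd 1 S) w) := by
  have hM : ∀ i j, ((jacMat S w)ᵀ * jacMat (unitNormal S) w) i j =
      -(pd j (pd i S) w ⬝ᵥ unitNormal S w) := fun i j =>
    pd_dotProduct_unitNormal hS hw i j
  have hdet := metric_det S w
  have hpos := dotProduct_self_pos hw
  have hsq : √(crossVec S w ⬝ᵥ crossVec S w) ^ 2 = crossVec S w ⬝ᵥ crossVec S w :=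
    Real.sq_sqrt hpos.le
  have hs := Real.sqrt_pos.2 hpos
  unfold meanCurvature secondForm
  rw [Matrix.mul_assoc, Matrix.trace_neg, Matrix.trace_fin_two, Matrix.inv_def,
    Matrix.adjugate_fin_two]
  simp only [Matrix.mul_apply (M := _ • _), Fin.sum_univ_two, hM, Matrix.smul_apply, hdet]
  simp only [Matrix.of_apply, Matrix.cons_val', Matrix.cons_val_zero, Matrix.cons_val_one,
    Matrix.cons_val_fin_one, metric_apply, smul_eq_mul, Ring.inverse_eq_inv',
    pd_comm hS 1 0 w, unitNormal, dotProduct_smul]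
  rw [dotProduct_comm (pd 1 S w) (pd 0 S w)]
  unfold hForm
  change _ = _ / √(crossVec S w ⬝ᵥ crossVec S w) ^ 3
  change _ = -((pd 1 S w ⬝ᵥ pd 1 S w) * (_ ⬝ᵥ crossVec S w) - 2 * _ * (_ ⬝ᵥ crossVec S w)
    + _ * (_ ⬝ᵥ crossVec S w)) / √(crossVec S w ⬝ᵥ crossVec S w) ^ 3
  have h3 : √(crossVec S w ⬝ᵥ crossVec S w) ^ 3 =
    (crossVec S w ⬝ᵥ crossVec S w) * √(crossVec S w ⬝ᵥ crossVec S w) := by rw [pow_succ, hsq]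
  rw [h3]
  have h4 := hpos.ne'
  have h5 := hs.ne'
  generalize √(crossVec S w ⬝ᵥ crossVec S w) = r at *
  generalize (crossVec S w ⬝ᵥ crossVec S w) = d at *
  field_simp
  ring

/-! ### Geometry of the profile curve -/

/-- The radial component `1 / √(1 + f'²)` of the unit normal of the profile curve. -/
def nrad (f : ℝ → ℝ) (t : ℝ) : ℝ := (√(1 + deriv f t ^ 2))⁻¹

/-- The axial component `-f' / √(1 + f'²)` of the unit normal of the profile curve. -/
def nax (f : ℝ → ℝ) (t : ℝ) : ℝ := -deriv f t * nrad f t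

/-- The curvature `-f'' / (1 + f'²)^{3/2}` of the profile curve. -/
def kap (f : ℝ → ℝ) (t : ℝ) : ℝ := -deriv (deriv f) t * nrad f t ^ 3

section profile

variable {f : ℝ → ℝ}

theorem nrad_pos (f : ℝ → ℝ) (t : ℝ) : 0 < nrad f t :=
  inv_pos.2 (Real.sqrt_pos.2 (by positivity))

theorem nrad_sq (f : ℝ → ℝ) (t : ℝ) : nrad f t ^ 2 * (1 + deriv f t ^ 2) = 1 := by
  have h : 0 < 1 + deriv f t ^ 2 := by positivity
  rw [nrad, inv_pow, Real.sq_sqrt h.le, inv_mul_cancel₀ h.ne']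

theorem nrad_le_one (f : ℝ → ℝ) (t : ℝ) : nrad f t ≤ 1 := by
  have h := nrad_sq f t
  have h0 := nrad_pos f t
  nlinarith [sq_nonneg (nrad f t * deriv f t)]

theorem ContDiff.deriv_infty (hf : ContDiff ℝ ∞ f) : ContDiff ℝ ∞ (deriv f) :=
  (contDiff_infty_iff_deriv.1 hf).2

theorem hasDerivAt_of_contDiff (hf : ContDiff ℝ ∞ f) (t : ℝ) : HasDerivAt f (deriv f t) t :=
  (hf.differentiable (by simp) t).hasDerivAt

theorem contDiff_nrad (hf : ContDiff ℝ ∞ f) : ContDiff ℝ ∞ (nrad f) := by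
  have h1 : ContDiff ℝ ∞ fun t => 1 + deriv f t ^ 2 :=
    contDiff_const.add ((ContDiff.deriv_infty hf).pow 2)
  have h2 : ∀ t, 0 < 1 + deriv f t ^ 2 := fun t => by positivity
  exact (h1.sqrt fun t => (h2 t).ne').inv fun t => (Real.sqrt_pos.2 (h2 t)).ne'

theorem contDiff_nax (hf : ContDiff ℝ ∞ f) : ContDiff ℝ ∞ (nax f) :=
  (ContDiff.deriv_infty hf).neg.mul (contDiff_nrad hf)

theorem contDiff_kap (hf : ContDiff ℝ ∞ f) : ContDiff ℝ ∞ (kap f) :=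
  (ContDiff.deriv_infty (ContDiff.deriv_infty hf)).neg.mul ((contDiff_nrad hf).pow 3)

/-- With `hasDerivAt_nax` this is Rodrigues' formula for the curve `t ↦ (f t, t)`: the derivative of
the normal `(nrad, nax)` is `kap` times the tangent `(f', 1)`. It follows by differentiating `nrad²
(1 + f'²) = 1`. -/
theorem hasDerivAt_nrad (hf : ContDiff ℝ ∞ f) (t : ℝ) :
    HasDerivAt (nrad f) (kap f t * deriv f t) t := by
  have h := hasDerivAt_of_contDiff (contDiff_nrad hf) t
  have h1 : HasDerivAt (fun t => nrad f t ^ 2 * (1 + deriv f t ^ 2)) _ t :=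
    (h.pow 2).mul (((hasDerivAt_of_contDiff (ContDiff.deriv_infty hf) t).pow 2).const_add 1)
  have h2 : (fun t => nrad f t ^ 2 * (1 + deriv f t ^ 2)) = fun _ => 1 := funext (nrad_sq f)
  rw [h2] at h1
  have h3 := h1.unique (hasDerivAt_const t 1)
  convert h using 1
  have h4 := nrad_sq f t
  have h5 := nrad_pos f t
  simp only [Nat.cast_ofNat, Nat.add_one_sub_one, pow_one, Pi.pow_apply] at h3
  unfold kap
  have h6 : deriv (nrad f) t * (1 + deriv f t ^ 2)
      = -(nrad f t * deriv f t * deriv (deriv f) t) := by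
    have : nrad f t * (deriv (nrad f) t * (1 + deriv f t ^ 2)
      + nrad f t * deriv f t * deriv (deriv f) t) = 0 := by linear_combination h3 / 2
    rcases mul_eq_zero.1 this with h | h
    · exact absurd h h5.ne'
    · linarith
  linear_combination (-nrad f t ^ 2) * h6 + deriv (nrad f) t * h4

theorem hasDerivAt_nax (hf : ContDiff ℝ ∞ f) (t : ℝ) : HasDerivAt (nax f) (kap f t) t := by
  have h := (hasDerivAt_of_contDiff (ContDiff.deriv_infty hf) t).neg.mul (hasDerivAt_nrad hf t)
  refine h.congr_deriv ?_
  have h4 := nrad_sq f t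
  simp only [Pi.neg_apply]
  unfold kap
  linear_combination (deriv (deriv f) t * nrad f t) * h4

end profile

/-! ### Rotations -/

/-- Rotation in the first two coordinates. -/
def rotXY (c s : ℝ) (v : R3) : R3 := ![c * v 0 - s * v 1, s * v 0 + c * v 1, v 2]

/-- Rotation in the last two coordinates. -/
def rotYZ (c s : ℝ) (v : R3) : R3 := ![v 0, c * v 1 - s * v 2, s * v 1 + c * v 2]

/-- `hForm` involves its arguments only through dot products and triple products, since `|v₁ × v₂|²`
is a Gram determinant. -/
theorem hForm_congr {ρ : R3 → R3} (hd : ∀ u v, ρ u ⬝ᵥ ρ v = u ⬝ᵥ v)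
    (ht : ∀ u v w, ρ u ⬝ᵥ crossProduct (ρ v) (ρ w) = u ⬝ᵥ crossProduct v w)
    (v₁ v₂ v₁₁ v₁₂ v₂₂ : R3) :
    hForm (ρ v₁) (ρ v₂) (ρ v₁₁) (ρ v₁₂) (ρ v₂₂) = hForm v₁ v₂ v₁₁ v₁₂ v₂₂ := by
  unfold hForm
  simp only [cross_dot_cross, hd, ht]

theorem rotXY_dot {c s : ℝ} (h : c ^ 2 + s ^ 2 = 1) (u v : R3) :
    rotXY c s u ⬝ᵥ rotXY c s v = u ⬝ᵥ v := by
  simp [rotXY, Matrix.vec3_dotProduct]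
  linear_combination (u 0 * v 0 + u 1 * v 1) * h

theorem rotYZ_dot {c s : ℝ} (h : c ^ 2 + s ^ 2 = 1) (u v : R3) :
    rotYZ c s u ⬝ᵥ rotYZ c s v = u ⬝ᵥ v := by
  simp [rotYZ, Matrix.vec3_dotProduct]
  linear_combination (u 1 * v 1 + u 2 * v 2) * h

theorem rotXY_triple {c s : ℝ} (h : c ^ 2 + s ^ 2 = 1) (u v w : R3) :
    rotXY c s u ⬝ᵥ crossProduct (rotXY c s v) (rotXY c s w) = u ⬝ᵥ crossProduct v w := by
  rw [Matrix.vec3_dotProduct, Matrix.vec3_dotProduct]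
  simp [rotXY, cross_apply]
  linear_combination (u 0 * (v 1 * w 2 - v 2 * w 1) + u 1 * (v 2 * w 0 - v 0 * w 2)
    + u 2 * (v 0 * w 1 - v 1 * w 0)) * h

theorem rotYZ_triple {c s : ℝ} (h : c ^ 2 + s ^ 2 = 1) (u v w : R3) :
    rotYZ c s u ⬝ᵥ crossProduct (rotYZ c s v) (rotYZ c s w) = u ⬝ᵥ crossProduct v w := by
  rw [Matrix.vec3_dotProduct, Matrix.vec3_dotProduct]
  simp [rotYZ, cross_apply]
  linear_combination (u 0 * (v 1 * w 2 - v 2 * w 1) + u 1 * (v 2 * w 0 - v 0 * w 2)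
    + u 2 * (v 0 * w 1 - v 1 * w 0)) * h

/-! ### Derivatives in polar form -/

theorem pd_mul_cos {r ψ : Param → ℝ} (hr : Differentiable ℝ r) (hψ : Differentiable ℝ ψ)
    (j : Fin 2) : pd j (fun w => r w * Real.cos (ψ w)) =
      fun w => pd j r w * Real.cos (ψ w) - r w * Real.sin (ψ w) * pd j ψ w := by
  ext w
  rw [pd_mul (hr w) (hψ w).cos, pd_comp (Real.hasDerivAt_cos _) (hψ w)]
  ring

theorem pd_mul_sin {r ψ : Param → ℝ} (hr : Differentiable ℝ r) (hψ : Differentiable ℝ ψ)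
    (j : Fin 2) : pd j (fun w => r w * Real.sin (ψ w)) =
      fun w => pd j r w * Real.sin (ψ w) + r w * Real.cos (ψ w) * pd j ψ w := by
  ext w
  rw [pd_mul (hr w) (hψ w).sin, pd_comp (Real.hasDerivAt_sin _) (hψ w)]
  ring

theorem pd_pd_mul_cos {r ψ : Param → ℝ} (hr : ContDiff ℝ 2 r) (hψ : ContDiff ℝ 2 ψ)
    (i j : Fin 2) (w : Param) : pd i (pd j (fun w => r w * Real.cos (ψ w))) w =
      pd i (pd j r) w * Real.cos (ψ w) - pd j r w * Real.sin (ψ w) * pd i ψ w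
        - pd i r w * Real.sin (ψ w) * pd j ψ w - r w * Real.cos (ψ w) * pd i ψ w * pd j ψ w
        - r w * Real.sin (ψ w) * pd i (pd j ψ) w := by
  have dr := hr.differentiable (by simp)
  have dψ := hψ.differentiable (by simp)
  have dr' : Differentiable ℝ (pd j r) :=
    (ContDiff.pd (m := 1) hr (by norm_num) j).differentiable (by simp)
  have dψ' : Differentiable ℝ (pd j ψ) :=
    (ContDiff.pd (m := 1) hψ (by norm_num) j).differentiable (by simp)
  rw [pd_mul_cos dr dψ, pd_sub ((dr' w).fun_mul (dψ w).cos)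
    (((dr w).fun_mul (dψ w).sin).fun_mul (dψ' w)), pd_mul_cos dr' dψ,
    pd_mul ((dr w).fun_mul (dψ w).sin) (dψ' w), pd_mul_sin dr dψ]
  ring

theorem pd_pd_mul_sin {r ψ : Param → ℝ} (hr : ContDiff ℝ 2 r) (hψ : ContDiff ℝ 2 ψ)
    (i j : Fin 2) (w : Param) : pd i (pd j (fun w => r w * Real.sin (ψ w))) w =
      pd i (pd j r) w * Real.sin (ψ w) + pd j r w * Real.cos (ψ w) * pd i ψ w
        + pd i r w * Real.cos (ψ w) * pd j ψ w - r w * Real.sin (ψ w) * pd i ψ w * pd j ψ w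
        + r w * Real.cos (ψ w) * pd i (pd j ψ) w := by
  have dr := hr.differentiable (by simp)
  have dψ := hψ.differentiable (by simp)
  have dr' : Differentiable ℝ (pd j r) :=
    (ContDiff.pd (m := 1) hr (by norm_num) j).differentiable (by simp)
  have dψ' : Differentiable ℝ (pd j ψ) :=
    (ContDiff.pd (m := 1) hψ (by norm_num) j).differentiable (by simp)
  rw [pd_mul_sin dr dψ, pd_add ((dr' w).fun_mul (dψ w).sin)
    (((dr w).fun_mul (dψ w).cos).fun_mul (dψ' w)), pd_mul_sin dr' dψ,
    pd_mul ((dr w).fun_mul (dψ w).cos) (dψ' w), pd_mul_cos dr dψ]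
  ring

/-- Derivatives of `φ(t) + u(θ, t) χ(t)`. -/
theorem pd_graph {u : Param → ℝ} {φ χ : ℝ → ℝ} (hu : Differentiable ℝ u)
    (hφ : Differentiable ℝ φ) (hχ : Differentiable ℝ χ) :
    pd 0 (fun w => φ (w 1) + u w * χ (w 1)) = (fun w => pd 0 u w * χ (w 1)) ∧
    pd 1 (fun w => φ (w 1) + u w * χ (w 1)) =
      (fun w => deriv φ (w 1) + (pd 1 u w * χ (w 1) + u w * deriv χ (w 1))) := by
  have h1 : Differentiable ℝ fun w : Param => w 1 := by fun_prop
  have h2 : Differentiable ℝ fun w : Param => φ (w 1) := hφ.comp h1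
  have h3 : Differentiable ℝ fun w : Param => χ (w 1) := hχ.comp h1
  constructor <;> ext w <;>
  · rw [pd_add (h2 w) ((hu w).fun_mul (h3 w)), pd_mul (hu w) (h3 w),
      pd_comp (hφ (w 1)).hasDerivAt (h1 w), pd_comp (hχ (w 1)).hasDerivAt (h1 w), pd_coord]
    simp

theorem pd_pd_graph {u : Param → ℝ} {φ χ : ℝ → ℝ} (hu : ContDiff ℝ 2 u)
    (hφ : ContDiff ℝ 2 φ) (hχ : ContDiff ℝ 2 χ) (w : Param) :
    pd 0 (pd 0 (fun w => φ (w 1) + u w * χ (w 1))) w = pd 0 (pd 0 u) w * χ (w 1) ∧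
    pd 0 (pd 1 (fun w => φ (w 1) + u w * χ (w 1))) w =
      pd 0 (pd 1 u) w * χ (w 1) + pd 0 u w * deriv χ (w 1) ∧
    pd 1 (pd 1 (fun w => φ (w 1) + u w * χ (w 1))) w =
      deriv (deriv φ) (w 1) + pd 1 (pd 1 u) w * χ (w 1) + 2 * pd 1 u w * deriv χ (w 1)
        + u w * deriv (deriv χ) (w 1) := by
  have du := hu.differentiable (by simp)
  have dφ := hφ.differentiable (by simp)
  have dχ := hχ.differentiable (by simp)
  have dφ' : Differentiable ℝ (deriv φ) := hφ.differentiable_deriv_two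
  have dχ' : Differentiable ℝ (deriv χ) := hχ.differentiable_deriv_two
  have du' : ∀ j, Differentiable ℝ (pd j u) := fun j =>
    (ContDiff.pd (m := 1) hu (by norm_num) j).differentiable (by simp)
  have h1 : Differentiable ℝ fun w : Param => w 1 := by fun_prop
  have h2 : Differentiable ℝ fun w : Param => deriv φ (w 1) := dφ'.comp h1
  have h3 : Differentiable ℝ fun w : Param => χ (w 1) := dχ.comp h1
  have h4 : Differentiable ℝ fun w : Param => deriv χ (w 1) := dχ'.comp h1
  obtain ⟨e0, e1⟩ := pd_graph du dφ dχ
  rw [e0, e1]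
  refine ⟨?_, ?_, ?_⟩
  · rw [pd_mul (du' 0 w) (h3 w), pd_comp (dχ (w 1)).hasDerivAt (h1 w), pd_coord]
    simp
  all_goals
    rw [pd_add (h2 w) (((du' 1 w).fun_mul (h3 w)).fun_add ((du w).fun_mul (h4 w))),
      pd_add ((du' 1 w).fun_mul (h3 w)) ((du w).fun_mul (h4 w)), pd_mul (du' 1 w) (h3 w),
      pd_mul (du w) (h4 w), pd_comp (dφ' (w 1)).hasDerivAt (h1 w),
      pd_comp (dχ (w 1)).hasDerivAt (h1 w), pd_comp (dχ' (w 1)).hasDerivAt (h1 w), pd_coord]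
    simp
  ring

/-! ### The mean curvature of a coiled surface as a function of the jet -/

/-- Mean curvature of the coiled surface with cylindrical coordinates `(r, θ, z)`, where `e = 1/R`
and `s, c` are the sine and cosine of `θ`, in terms of the derivatives of `r` and `z`. -/
def cylCurv (e s c r r₁ r₂ r₁₁ r₁₂ r₂₂ z₁ z₂ z₁₁ z₁₂ z₂₂ : ℝ) : ℝ :=
  hForm ![r₁, r, (1 + e * (r * s)) * z₁] ![r₂, 0, (1 + e * (r * s)) * z₂]
    ![r₁₁ - r - e * (1 + e * (r * s)) * (z₁ * z₁) * s,
      2 * r₁ - e * (1 + e * (r * s)) * (z₁ * z₁) * c,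
      (1 + e * (r * s)) * z₁₁ + 2 * e * ((r₁ * s + r * c) * z₁)]
    ![r₁₂ - e * (1 + e * (r * s)) * (z₁ * z₂) * s,
      r₂ - e * (1 + e * (r * s)) * (z₁ * z₂) * c,
      (1 + e * (r * s)) * z₁₂ + e * ((r₁ * s + r * c) * z₂ + r₂ * s * z₁)]
    ![r₂₂ - e * (1 + e * (r * s)) * (z₂ * z₂) * s,
      -(e * (1 + e * (r * s)) * (z₂ * z₂) * c),
      (1 + e * (r * s)) * z₂₂ + 2 * e * (r₂ * s * z₂)]

/-- Mean curvature of the coiled perturbed unduloid in terms of the jet of the perturbation. -/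
def jetCurv (f : ℝ → ℝ) (e : ℝ) (w : Param) (p : Jet) : ℝ :=
  cylCurv e (Real.sin (w 0)) (Real.cos (w 0))
    (f (w 1) + p.1 * nrad f (w 1))
    (p.2.1.1 * nrad f (w 1))
    (deriv f (w 1) + p.2.1.2 * nrad f (w 1) + p.1 * (kap f (w 1) * deriv f (w 1)))
    (p.2.2.1 * nrad f (w 1))
    (p.2.2.2.1 * nrad f (w 1) + p.2.1.1 * (kap f (w 1) * deriv f (w 1)))
    (deriv (deriv f) (w 1) + p.2.2.2.2 * nrad f (w 1)
      + 2 * p.2.1.2 * (kap f (w 1) * deriv f (w 1))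
      + p.1 * (deriv (kap f) (w 1) * deriv f (w 1) + kap f (w 1) * deriv (deriv f) (w 1)))
    (p.2.1.1 * nax f (w 1))
    (1 + p.2.1.2 * nax f (w 1) + p.1 * kap f (w 1))
    (p.2.2.1 * nax f (w 1))
    (p.2.2.2.1 * nax f (w 1) + p.2.1.1 * kap f (w 1))
    (p.2.2.2.2 * nax f (w 1) + 2 * p.2.1.2 * kap f (w 1) + p.1 * deriv (kap f) (w 1))

/-- The jet of a function of the parameters. -/
def jetAt (u : Param → ℝ) (w : Param) : Jet :=
  (u w, (pd 0 u w, pd 1 u w), (pd 0 (pd 0 u) w, pd 0 (pd 1 u) w, pd 1 (pd 1 u) w))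

/-- Conditions under which the first derivatives of the coiled surface are independent. -/
def Admissible (f : ℝ → ℝ) (e x : ℝ) (w : Param) : Prop :=
  0 < f (w 1) + x * nrad f (w 1) ∧ 0 < 1 + x * kap f (w 1) ∧
    0 < 1 + e * ((f (w 1) + x * nrad f (w 1)) * Real.sin (w 0))

/-- The component of the `y₃`-derivative along the tangent `(f', 1)` of the profile does not see
`p₂`, which multiplies the normal: `r₂ f' + z₂ = (1 + f'²)(1 + x·kap) > 0`. Vanishing of the first
and third components of the cross product would force `z₂ = 0` and `r₂ = 0`. Hence only the value
`x` of the perturbation is restricted, not its derivatives. -/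
theorem cross_ne_zero_of_pos {f : ℝ → ℝ} {e x : ℝ} {w : Param} (h : Admissible f e x w)
    (p₁ p₂ z₁ : ℝ) :
    0 < crossProduct ![p₁, f (w 1) + x * nrad f (w 1),
        (1 + e * ((f (w 1) + x * nrad f (w 1)) * Real.sin (w 0))) * z₁]
      ![deriv f (w 1) + p₂ * nrad f (w 1) + x * (kap f (w 1) * deriv f (w 1)), 0,
        (1 + e * ((f (w 1) + x * nrad f (w 1)) * Real.sin (w 0)))
          * (1 + p₂ * nax f (w 1) + x * kap f (w 1))] ⬝ᵥ
      crossProduct ![p₁, f (w 1) + x * nrad f (w 1),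
        (1 + e * ((f (w 1) + x * nrad f (w 1)) * Real.sin (w 0))) * z₁]
      ![deriv f (w 1) + p₂ * nrad f (w 1) + x * (kap f (w 1) * deriv f (w 1)), 0,
        (1 + e * ((f (w 1) + x * nrad f (w 1)) * Real.sin (w 0)))
          * (1 + p₂ * nax f (w 1) + x * kap f (w 1))] := by
  obtain ⟨h1, h2, h3⟩ := h
  have h4 : (deriv f (w 1) + p₂ * nrad f (w 1) + x * (kap f (w 1) * deriv f (w 1))) * deriv f (w 1)
      + (1 + p₂ * nax f (w 1) + x * kap f (w 1))
      = (1 + deriv f (w 1) ^ 2) * (1 + x * kap f (w 1)) := by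
    unfold nax; ring
  have h5 : 0 < (1 + deriv f (w 1) ^ 2) * (1 + x * kap f (w 1)) := by positivity
  rw [← h4] at h5
  generalize 1 + e * ((f (w 1) + x * nrad f (w 1)) * Real.sin (w 0)) = lam at *
  generalize f (w 1) + x * nrad f (w 1) = r at *
  generalize deriv f (w 1) + p₂ * nrad f (w 1) + x * (kap f (w 1) * deriv f (w 1)) = r₂ at *
  generalize 1 + p₂ * nax f (w 1) + x * kap f (w 1) = z₂ at *
  apply dotProduct_self_pos
  intro h0
  have h6 := congrFun h0 0
  have h7 := congrFun h0 2
  simp [cross_apply, h1.ne', h3.ne'] at h6 h7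
  simp [h6, h7] at h5

section surface

variable {f : ℝ → ℝ} {T : ℝ} {n : ℕ} {h : R3 → ℝ}

theorem coiledParam_eq (hf : ∀ t, f t ≠ 0) (w : Param) :
    coiledParam T f n h w =
      ![(f (w 1) + h (param f w) * nrad f (w 1)) * Real.cos (w 0),
        (radius T n + (f (w 1) + h (param f w) * nrad f (w 1)) * Real.sin (w 0)) *
          Real.cos ((radius T n)⁻¹ * (w 1 + h (param f w) * nax f (w 1))),
        (radius T n + (f (w 1) + h (param f w) * nrad f (w 1)) * Real.sin (w 0)) *
          Real.sin ((radius T n)⁻¹ * (w 1 + h (param f w) * nax f (w 1)))] := by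
  have e1 : perturbed f h (param f w) 0 =
      (f (w 1) + h (param f w) * nrad f (w 1)) * Real.cos (w 0) := by
    have := hf (w 1)
    simp [perturbed, nu, param, nrad]
    field_simp
  have e2 : perturbed f h (param f w) 1 =
      (f (w 1) + h (param f w) * nrad f (w 1)) * Real.sin (w 0) := by
    have := hf (w 1)
    simp [perturbed, nu, param, nrad]
    field_simp
  have e3 : perturbed f h (param f w) 2 = w 1 + h (param f w) * nax f (w 1) := by
    simp only [perturbed, nu, param, nrad, nax, Pi.add_apply, Pi.smul_apply, smul_eq_mul,
      Matrix.cons_val, one_div]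
    ring
  rw [coiledParam, coil, e1, e2, e3]
  simp only [div_eq_inv_mul]

theorem pd_vec {P Q Z : Param → ℝ} (hP : Differentiable ℝ P) (hQ : Differentiable ℝ Q)
    (hZ : Differentiable ℝ Z) (j : Fin 2) :
    pd j (fun w => (![P w, Q w, Z w] : R3)) = fun w => ![pd j P w, pd j Q w, pd j Z w] := by
  ext w i
  have hd : DifferentiableAt ℝ (fun w => (![P w, Q w, Z w] : R3)) w := by
    rw [differentiableAt_pi]
    intro i
    fin_cases i
    exacts [hP w, hQ w, hZ w]
  rw [pd_apply hd]
  fin_cases i <;> rfl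

theorem contDiff_vec {P Q Z : Param → ℝ} {m : WithTop ℕ∞} (hP : ContDiff ℝ m P)
    (hQ : ContDiff ℝ m Q) (hZ : ContDiff ℝ m Z) :
    ContDiff ℝ m (fun w => (![P w, Q w, Z w] : R3)) := by
  rw [contDiff_pi]
  intro i
  fin_cases i
  exacts [hP, hQ, hZ]

/-- Derivatives of a coiled surface given in cylindrical coordinates. -/
theorem pd_coil {r z : Param → ℝ} (hr : ContDiff ℝ 2 r) (hz : ContDiff ℝ 2 z) {R : ℝ}
    (hR : R ≠ 0) (w : Param) :
    let S : Param → R3 := fun w => ![r w * Real.cos (w 0),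
      (R + r w * Real.sin (w 0)) * Real.cos (R⁻¹ * z w),
      (R + r w * Real.sin (w 0)) * Real.sin (R⁻¹ * z w)]
    let rot : R3 → R3 := fun v => rotYZ (Real.cos (R⁻¹ * z w)) (Real.sin (R⁻¹ * z w))
      (rotXY (Real.cos (w 0)) (Real.sin (w 0)) v)
    let lam := 1 + R⁻¹ * (r w * Real.sin (w 0))
    ContDiff ℝ 2 S ∧
    pd 0 S w = rot ![pd 0 r w, r w, lam * pd 0 z w] ∧
    pd 1 S w = rot ![pd 1 r w, 0, lam * pd 1 z w] ∧
    pd 0 (pd 0 S) w = rot ![pd 0 (pd 0 r) w - r w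
        - R⁻¹ * lam * (pd 0 z w * pd 0 z w) * Real.sin (w 0),
      2 * pd 0 r w - R⁻¹ * lam * (pd 0 z w * pd 0 z w) * Real.cos (w 0),
      lam * pd 0 (pd 0 z) w
        + 2 * R⁻¹ * ((pd 0 r w * Real.sin (w 0) + r w * Real.cos (w 0)) * pd 0 z w)] ∧
    pd 0 (pd 1 S) w = rot ![pd 0 (pd 1 r) w
        - R⁻¹ * lam * (pd 0 z w * pd 1 z w) * Real.sin (w 0),
      pd 1 r w - R⁻¹ * lam * (pd 0 z w * pd 1 z w) * Real.cos (w 0),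
      lam * pd 0 (pd 1 z) w
        + R⁻¹ * ((pd 0 r w * Real.sin (w 0) + r w * Real.cos (w 0)) * pd 1 z w
          + pd 1 r w * Real.sin (w 0) * pd 0 z w)] ∧
    pd 1 (pd 1 S) w = rot ![pd 1 (pd 1 r) w
        - R⁻¹ * lam * (pd 1 z w * pd 1 z w) * Real.sin (w 0),
      -(R⁻¹ * lam * (pd 1 z w * pd 1 z w) * Real.cos (w 0)),
      lam * pd 1 (pd 1 z) w
        + 2 * R⁻¹ * (pd 1 r w * Real.sin (w 0) * pd 1 z w)] := by
  intro S rot lam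
  have hθ : ContDiff ℝ 2 (fun w : Param => w 0) := by fun_prop
  have hζ : ContDiff ℝ 2 (fun w : Param => R⁻¹ * z w) := contDiff_const.mul hz
  have hY : ContDiff ℝ 2 (fun w : Param => r w * Real.sin (w 0)) := hr.mul hθ.sin
  have hA : ContDiff ℝ 2 (fun w : Param => R + r w * Real.sin (w 0)) := contDiff_const.add hY
  have h0 : ContDiff ℝ 2 (fun w : Param => r w * Real.cos (w 0)) := hr.mul hθ.cos
  have h1 := hA.mul hζ.cos
  have h2 := hA.mul hζ.sin
  have diff : ∀ {u : Param → ℝ}, ContDiff ℝ 2 u → Differentiable ℝ u := fun hu =>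
    hu.differentiable (by simp)
  have diff' : ∀ {u : Param → ℝ}, ContDiff ℝ 2 u → ∀ j, Differentiable ℝ (pd j u) := fun hu j =>
    (ContDiff.pd (m := 1) hu (by norm_num) j).differentiable (by simp)
  have eS : ∀ j, pd j S = _ := fun j => pd_vec (diff h0) (diff h1) (diff h2) j
  have eS' : ∀ i j, pd i (pd j S) w = ![_, _, _] := fun i j => by
    rw [eS j, pd_vec (diff' h0 j) (diff' h1 j) (diff' h2 j)]
  have eA : ∀ j, pd j (fun w : Param => R + r w * Real.sin (w 0)) =
      pd j (fun w : Param => r w * Real.sin (w 0)) := fun j => by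
    ext v
    rw [pd_add (differentiableAt_const _) (diff hY v), pd_const, zero_add]
  have eζ : ∀ j, pd j (fun w : Param => R⁻¹ * z w) = fun w => R⁻¹ * pd j z w := fun j => by
    ext v
    rw [pd_mul (differentiableAt_const _) (diff hz v), pd_const]; simp
  have eζ' : ∀ i j v, pd i (fun w : Param => R⁻¹ * pd j z w) v = R⁻¹ * pd i (pd j z) v :=
    fun i j v => by
    rw [pd_mul (differentiableAt_const _) (diff' hz j v), pd_const]; simp
  have eθ : ∀ j, pd j (fun w : Param => w 0) = fun _ => (Pi.single j 1 : Param) 0 :=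
    fun j => funext fun v => pd_coord 0 j v
  have hl : R⁻¹ * (R + r w * Real.sin (w 0)) = lam := by
    simp only [lam]; field_simp
  have hl' : R + r w * Real.sin (w 0) = R * lam := by
    rw [← hl, ← mul_assoc, mul_inv_cancel₀ hR, one_mul]
  have hRR : R⁻¹ * R = 1 := inv_mul_cancel₀ hR
  refine ⟨contDiff_vec h0 h1 h2, ?_, ?_, ?_, ?_, ?_⟩
  iterate 2
    rw [eS, pd_mul_cos (diff hr) (diff hθ), pd_mul_cos (diff hA) (diff hζ),
      pd_mul_sin (diff hA) (diff hζ), eA, eζ, pd_mul_sin (diff hr) (diff hθ), eθ]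
    ext i
    fin_cases i <;> simp [rot, rotXY, rotYZ, ← hl] <;> ring
  -- The last two coordinates are polar twice over: radius `R + r sin θ` and angle `z/R`, where `r
  -- sin θ` is polar itself. The centripetal term of the coil splits into its radial and angular
  -- parts by `sin² θ + cos² θ = 1`; the remaining discrepancy is `R⁻¹ R = 1`.
  · rw [eS', pd_pd_mul_cos hr hθ, pd_pd_mul_cos hA hζ, pd_pd_mul_sin hA hζ]
    simp only [eA, eζ, eζ', pd_pd_mul_sin hr hθ]
    simp only [pd_mul_sin (diff hr) (diff hθ), eθ, pd_const, hl']
    ext i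
    fin_cases i <;> simp only [Fin.zero_eta, Fin.mk_one, Fin.reduceFinMk, rot,
      rotXY, rotYZ, Matrix.cons_val,
      Pi.single_eq_same, mul_one, mul_zero]
    · ring
    · linear_combination (-(lam * R⁻¹ * Real.cos (R⁻¹ * z w) * (pd 0 z w * pd 0 z w)) - lam * Real.sin (R⁻¹ * z w) * pd 0 (pd 0 z) w) * hRR
        + lam * R⁻¹ * Real.cos (R⁻¹ * z w) * (pd 0 z w * pd 0 z w) * Real.sin_sq_add_cos_sq (w 0)
    · linear_combination (-(lam * R⁻¹ * Real.sin (R⁻¹ * z w) * (pd 0 z w * pd 0 z w)) + lam * Real.cos (R⁻¹ * z w) * pd 0 (pd 0 z) w) * hRR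
        + lam * R⁻¹ * Real.sin (R⁻¹ * z w) * (pd 0 z w * pd 0 z w) * Real.sin_sq_add_cos_sq (w 0)
  · rw [eS', pd_pd_mul_cos hr hθ, pd_pd_mul_cos hA hζ, pd_pd_mul_sin hA hζ]
    simp only [eA, eζ, eζ', pd_pd_mul_sin hr hθ]
    simp only [pd_mul_sin (diff hr) (diff hθ), eθ, pd_const, hl']
    ext i
    fin_cases i <;> simp only [Fin.zero_eta, Fin.mk_one, Fin.reduceFinMk, rot,
      rotXY, rotYZ, Matrix.cons_val,
      Pi.single_eq_same, Pi.single_apply, zero_ne_one, if_false, mul_one, mul_zero]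
    · ring
    · linear_combination (-(lam * R⁻¹ * Real.cos (R⁻¹ * z w) * (pd 0 z w * pd 1 z w)) - lam * Real.sin (R⁻¹ * z w) * pd 0 (pd 1 z) w) * hRR
        + lam * R⁻¹ * Real.cos (R⁻¹ * z w) * (pd 0 z w * pd 1 z w) * Real.sin_sq_add_cos_sq (w 0)
    · linear_combination (-(lam * R⁻¹ * Real.sin (R⁻¹ * z w) * (pd 0 z w * pd 1 z w)) + lam * Real.cos (R⁻¹ * z w) * pd 0 (pd 1 z) w) * hRR
        + lam * R⁻¹ * Real.sin (R⁻¹ * z w) * (pd 0 z w * pd 1 z w) * Real.sin_sq_add_cos_sq (w 0)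
  · rw [eS', pd_pd_mul_cos hr hθ, pd_pd_mul_cos hA hζ, pd_pd_mul_sin hA hζ]
    simp only [eA, eζ, eζ', pd_pd_mul_sin hr hθ]
    simp only [pd_mul_sin (diff hr) (diff hθ), eθ, pd_const, hl']
    ext i
    fin_cases i <;> simp only [Fin.zero_eta, Fin.mk_one, Fin.reduceFinMk, rot,
      rotXY, rotYZ, Matrix.cons_val,
      Pi.single_apply, zero_ne_one, if_false, mul_zero]
    · ring
    · linear_combination (-(lam * R⁻¹ * Real.cos (R⁻¹ * z w) * (pd 1 z w * pd 1 z w)) - lam * Real.sin (R⁻¹ * z w) * pd 1 (pd 1 z) w) * hRR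
        + lam * R⁻¹ * Real.cos (R⁻¹ * z w) * (pd 1 z w * pd 1 z w) * Real.sin_sq_add_cos_sq (w 0)
    · linear_combination (-(lam * R⁻¹ * Real.sin (R⁻¹ * z w) * (pd 1 z w * pd 1 z w)) + lam * Real.cos (R⁻¹ * z w) * pd 1 (pd 1 z) w) * hRR
        + lam * R⁻¹ * Real.sin (R⁻¹ * z w) * (pd 1 z w * pd 1 z w) * Real.sin_sq_add_cos_sq (w 0)

end surface

section surface

variable {f : ℝ → ℝ} {T : ℝ} {n : ℕ} {h : R3 → ℝ}

theorem crossVec_ne_zero_of_rot {S : Param → R3} {w : Param} {ρ : R3 → R3}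
    (hd : ∀ u v, ρ u ⬝ᵥ ρ v = u ⬝ᵥ v) {v₁ v₂ : R3} (h₁ : pd 0 S w = ρ v₁) (h₂ : pd 1 S w = ρ v₂)
    (hv : 0 < crossProduct v₁ v₂ ⬝ᵥ crossProduct v₁ v₂) : crossVec S w ≠ 0 := by
  intro h0
  have h3 : crossVec S w ⬝ᵥ crossVec S w = crossProduct v₁ v₂ ⬝ᵥ crossProduct v₁ v₂ := by
    rw [crossVec, h₁, h₂, cross_dot_cross, cross_dot_cross]
    simp only [hd]
  rw [h0] at h3
  simp only [dotProduct_zero] at h3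
  exact hv.ne h3

/-- All derivatives from `pd_coil` carry the same rotation, which drops out by `hForm_congr`. What
remains contains `R` only through `1/R` and no longer contains the angle `z/R`, so it makes sense at
`1/R = 0` and is periodic in `y₃`. -/
theorem coiled_immersion_and_curvature (hf : ContDiff ℝ ∞ f) (hf0 : ∀ t, f t ≠ 0)
    (hR : radius T n ≠ 0) (hh : ContDiff ℝ 2 fun w => h (param f w)) {w : Param}
    (hw : Admissible f (radius T n)⁻¹ (h (param f w)) w) :
    crossVec (coiledParam T f n h) w ≠ 0 ∧ meanCurvature (coiledParam T f n h) w =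
      jetCurv f (radius T n)⁻¹ w (jetAt (fun w => h (param f w)) w) := by
  have hf2 : ContDiff ℝ 2 f := by exact_mod_cast contDiff_infty.1 hf 2
  have hb2 : ContDiff ℝ 2 (nrad f) := by exact_mod_cast contDiff_infty.1 (contDiff_nrad hf) 2
  have hc2 : ContDiff ℝ 2 (nax f) := by exact_mod_cast contDiff_infty.1 (contDiff_nax hf) 2
  have h1 : ContDiff ℝ 2 (fun w : Param => w 1) := by fun_prop
  have hr : ContDiff ℝ 2 fun w : Param => f (w 1) + h (param f w) * nrad f (w 1) :=
    (hf2.comp h1).add (hh.mul (hb2.comp h1))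
  have hz : ContDiff ℝ 2 fun w : Param => w 1 + h (param f w) * nax f (w 1) :=
    h1.add (hh.mul (hc2.comp h1))
  have db : deriv (nrad f) = fun t => kap f t * deriv f t :=
    funext fun t => (hasDerivAt_nrad hf t).deriv
  have dc : deriv (nax f) = kap f := funext fun t => (hasDerivAt_nax hf t).deriv
  have ddb : deriv (fun t => kap f t * deriv f t) = fun t =>
      deriv (kap f) t * deriv f t + kap f t * deriv (deriv f) t :=
    funext fun t => ((hasDerivAt_of_contDiff (contDiff_kap hf) t).mul
      (hasDerivAt_of_contDiff (ContDiff.deriv_infty hf) t)).deriv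
  have dh := hh.differentiable (by simp)
  obtain ⟨r1, r2⟩ := pd_graph dh (hf2.differentiable (by simp)) (hb2.differentiable (by simp))
  obtain ⟨r11, r12, r22⟩ := pd_pd_graph hh hf2 hb2 w
  obtain ⟨z1, z2⟩ := pd_graph (φ := fun t => t) dh differentiable_id
    (hc2.differentiable (by simp))
  obtain ⟨z11, z12, z22⟩ := pd_pd_graph (φ := fun t => t) hh contDiff_id hc2 w
  have hS : coiledParam T f n h = _ := funext fun w => coiledParam_eq (T := T) (n := n) hf0 w
  obtain ⟨hS2, e1, e2, e11, e12, e22⟩ := pd_coil hr hz hR w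
  rw [← hS] at hS2 e1 e2 e11 e12 e22
  rw [r1, z1] at e1
  rw [r2, z2] at e2
  have hd : ∀ u v : R3, _ := fun u v => (rotYZ_dot (Real.cos_sq_add_sin_sq
      ((radius T n)⁻¹ * (w 1 + h (param f w) * nax f (w 1)))) _ _).trans
    (rotXY_dot (Real.cos_sq_add_sin_sq (w 0)) u v)
  have ht : ∀ u v x : R3, _ := fun u v x => (rotYZ_triple (Real.cos_sq_add_sin_sq
      ((radius T n)⁻¹ * (w 1 + h (param f w) * nax f (w 1)))) _ _ _).trans
    (rotXY_triple (Real.cos_sq_add_sin_sq (w 0)) u v x)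
  have hpos := cross_ne_zero_of_pos hw (pd 0 (fun w => h (param f w)) w * nrad f (w 1))
    (pd 1 (fun w => h (param f w)) w) (pd 0 (fun w => h (param f w)) w * nax f (w 1))
  have hne : crossVec (coiledParam T f n h) w ≠ 0 := by
    refine crossVec_ne_zero_of_rot hd e1 e2 ?_
    simp only [db, dc, deriv_id'']
    simpa only [add_assoc] using hpos
  refine ⟨hne, ?_⟩
  rw [meanCurvature_eq_hForm hS2 hne, e1, e2, e11, e12, e22, hForm_congr (ρ := fun v =>
    rotYZ _ _ (rotXY _ _ v)) hd ht, r11, r12, r22, z11, z12, z22, r1, r2, z1, z2]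
  unfold jetCurv cylCurv jetAt
  simp only [db, dc, ddb, deriv_id'', deriv_const', zero_add, add_assoc]

end surface

/-! ### The Jacobi operator of the unduloid -/

/-- The Jacobi operator in terms of the jet. -/
def jacobiForm (f : ℝ → ℝ) (w : Param) (p : Jet) : ℝ :=
  p.2.2.1 / f (w 1) ^ 2 + nrad f (w 1) ^ 2 * p.2.2.2.2
    + deriv f (w 1) * (nrad f (w 1) + kap f (w 1) * f (w 1)) * nrad f (w 1) / f (w 1) * p.2.1.2
    + (kap f (w 1) ^ 2 + nrad f (w 1) ^ 2 / f (w 1) ^ 2) * p.1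

theorem pd_param {f : ℝ → ℝ} (hf : ContDiff ℝ ∞ f) :
    pd 0 (param f) = (fun w => ![-(f (w 1) * Real.sin (w 0)), f (w 1) * Real.cos (w 0), 0]) ∧
    pd 1 (param f) =
      (fun w => ![deriv f (w 1) * Real.cos (w 0), deriv f (w 1) * Real.sin (w 0), 1]) := by
  have h1 : Differentiable ℝ (fun w : Param => w 1) := by fun_prop
  have h0 : Differentiable ℝ (fun w : Param => w 0) := by fun_prop
  have hf1 : Differentiable ℝ (fun w : Param => f (w 1)) :=
    (hf.differentiable (by simp)).comp h1
  have e : param f = fun w => ![f (w 1) * Real.cos (w 0), f (w 1) * Real.sin (w 0), w 1] := rfl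
  have ef : ∀ j w, pd j (fun w : Param => f (w 1)) w = deriv f (w 1) * (Pi.single j 1 : Param) 1 :=
    fun j w => by rw [pd_comp (hasDerivAt_of_contDiff hf _) (h1 w), pd_coord]
  constructor
  all_goals
    rw [e, pd_vec (fun w => (hf1 w).fun_mul (h0 w).cos) (fun w => (hf1 w).fun_mul (h0 w).sin) h1,
      pd_mul_cos hf1 h0, pd_mul_sin hf1 h0]
    ext w i
    fin_cases i <;> simp [ef, pd_coord]

theorem unitNormal_param {f : ℝ → ℝ} (hf : ContDiff ℝ ∞ f) (hf0 : ∀ t, 0 < f t) :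
    unitNormal (param f) = fun w =>
      ![nrad f (w 1) * Real.cos (w 0), nrad f (w 1) * Real.sin (w 0), nax f (w 1)] := by
  obtain ⟨e0, e1⟩ := pd_param hf
  ext w i
  have hb := nrad_pos f (w 1)
  have hb2 := nrad_sq f (w 1)
  have hc : crossVec (param f) w =
      ![f (w 1) * Real.cos (w 0), f (w 1) * Real.sin (w 0), -(f (w 1) * deriv f (w 1))] := by
    rw [crossVec, e0, e1, cross_apply]
    ext i
    fin_cases i <;> simp
    linear_combination (-f (w 1) * deriv f (w 1)) * Real.sin_sq_add_cos_sq (w 0)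
  have hn : √(crossVec (param f) w ⬝ᵥ crossVec (param f) w) = f (w 1) / nrad f (w 1) := by
    rw [Real.sqrt_eq_iff_mul_self_eq_of_pos (div_pos (hf0 _) hb), hc, Matrix.vec3_dotProduct]
    simp only [Matrix.cons_val]
    field_simp
    linear_combination -(f (w 1) ^ 2 * nrad f (w 1) ^ 2) * Real.sin_sq_add_cos_sq (w 0)
      - f (w 1) ^ 2 * hb2
  have hfw := (hf0 (w 1)).ne'
  rw [unitNormal, hn, hc]
  fin_cases i <;> simp [nax] <;> field_simp

/-- The coordinates are lines of curvature: `g = diag(f², nrad⁻²)`, and `DN = DY · diag(nrad/f,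
kap)` gives `A` without inverting anything but `g`. -/
theorem jacobiOp_param {f : ℝ → ℝ} (hf : ContDiff ℝ ∞ f) (hf0 : ∀ t, 0 < f t) {u : Param → ℝ}
    (hu : ContDiff ℝ 2 u) (w : Param) :
    jacobiOp (param f) u w = jacobiForm f w (jetAt u w) := by
  obtain ⟨e0, e1⟩ := pd_param hf
  have hb := nrad_pos f
  have hb2 := nrad_sq f
  have hm : ∀ v, metric (param f) v = !![f (v 1) ^ 2, 0; 0, (nrad f (v 1) ^ 2)⁻¹] := by
    intro v
    have h3 := Real.sin_sq_add_cos_sq (v 0)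
    have h4 : (nrad f (v 1) ^ 2)⁻¹ = 1 + deriv f (v 1) ^ 2 := inv_eq_of_mul_eq_one_right (hb2 (v 1))
    rw [h4]
    ext i j
    rw [metric_apply]
    fin_cases i <;> fin_cases j <;> simp [e0, e1]
    · linear_combination f (v 1) ^ 2 * h3
    · ring
    · ring
    · linear_combination deriv f (v 1) ^ 2 * h3
  have hdet : ∀ v, √(metric (param f) v).det = f (v 1) / nrad f (v 1) := by
    intro v
    have := hb (v 1)
    rw [hm, Matrix.det_fin_two_of, Real.sqrt_eq_iff_mul_self_eq_of_pos (div_pos (hf0 _) this)]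
    field_simp
    ring
  have hinv : ∀ v, (metric (param f) v)⁻¹ =
      !![(f (v 1) ^ 2)⁻¹, 0; 0, nrad f (v 1) ^ 2] := by
    intro v
    have h1 := (hb (v 1)).ne'
    have h2 := (hf0 (v 1)).ne'
    apply Matrix.inv_eq_left_inv
    rw [hm]
    ext i j
    fin_cases i <;> fin_cases j <;> simp [h1, h2]
  have hA : secondForm (param f) w = !![-(nrad f (w 1) / f (w 1)), 0; 0, -kap f (w 1)] := by
    have h1 : Differentiable ℝ (fun w : Param => w 1) := by fun_prop
    have h0 : Differentiable ℝ (fun w : Param => w 0) := by fun_prop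
    have hb1 : Differentiable ℝ (fun w : Param => nrad f (w 1)) :=
      ((contDiff_nrad hf).differentiable (by simp)).comp h1
    have hc1 : Differentiable ℝ (fun w : Param => nax f (w 1)) :=
      ((contDiff_nax hf).differentiable (by simp)).comp h1
    have eb : ∀ j w, pd j (fun w : Param => nrad f (w 1)) w =
        kap f (w 1) * deriv f (w 1) * (Pi.single j 1 : Param) 1 :=
      fun j w => by rw [pd_comp (hasDerivAt_nrad hf _) (h1 w), pd_coord]
    have ec : ∀ j w, pd j (fun w : Param => nax f (w 1)) w =
        kap f (w 1) * (Pi.single j 1 : Param) 1 :=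
      fun j w => by rw [pd_comp (hasDerivAt_nax hf _) (h1 w), pd_coord]
    have hN : jacMat (unitNormal (param f)) w =
        jacMat (param f) w * !![nrad f (w 1) / f (w 1), 0; 0, kap f (w 1)] := by
      have hfw := (hf0 (w 1)).ne'
      ext i j
      rw [Matrix.mul_apply, Fin.sum_univ_two]
      simp only [jacMat, Matrix.of_apply, e0, e1]
      rw [unitNormal_param hf hf0, pd_vec (fun w => (hb1 w).fun_mul (h0 w).cos)
        (fun w => (hb1 w).fun_mul (h0 w).sin) hc1, pd_mul_cos hb1 h0, pd_mul_sin hb1 h0]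
      fin_cases j <;> fin_cases i <;> simp [eb, ec, pd_coord] <;> field_simp
    have hdu : IsUnit (metric (param f) w).det := by
      have h1 := (hb (w 1)).ne'
      have h2 := (hf0 (w 1)).ne'
      rw [hm, Matrix.det_fin_two_of, isUnit_iff_ne_zero]
      simp [h1, h2]
    rw [secondForm, hN, Matrix.mul_assoc, ← Matrix.mul_assoc _ (jacMat (param f) w)]
    change -((metric (param f) w)⁻¹ * (metric (param f) w * _)) = _
    rw [← Matrix.mul_assoc, Matrix.nonsing_inv_mul _ hdu, Matrix.one_mul]
    ext i j
    fin_cases i <;> fin_cases j <;> simp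
  have h1 : Differentiable ℝ (fun w : Param => w 1) := by fun_prop
  have du' : ∀ j, Differentiable ℝ (pd j u) := fun j =>
    (ContDiff.pd (m := 1) hu (by norm_num) j).differentiable (by simp)
  -- The derivative is left unevaluated: this coefficient depends on `y₃` alone and gets
  -- differentiated in `θ`, so it contributes zero.
  have g1 : ∀ t, HasDerivAt (fun t => (f t ^ 2)⁻¹ * (f t / nrad f t))
      (deriv (fun t => (f t ^ 2)⁻¹ * (f t / nrad f t)) t) t := by
    intro t
    have a1 := hasDerivAt_of_contDiff hf t
    have a2 := hasDerivAt_nrad hf t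
    exact (((a1.pow 2).inv (pow_ne_zero 2 (hf0 t).ne')).mul
      (a1.div a2 (hb t).ne')).differentiableAt.hasDerivAt
  have g2 : ∀ t, HasDerivAt (fun t => nrad f t ^ 2 * (f t / nrad f t))
      (deriv f t * nrad f t + f t * (kap f t * deriv f t)) t := by
    intro t
    have : (fun t => nrad f t ^ 2 * (f t / nrad f t)) = fun t => f t * nrad f t := by
      ext t
      have := (hb t).ne'
      field_simp
    rw [this]
    exact (hasDerivAt_of_contDiff hf t).mul (hasDerivAt_nrad hf t)
  unfold jacobiOp
  simp only [Fin.sum_univ_two, hinv, hdet, hA, Matrix.of_apply, Matrix.cons_val', Matrix.cons_val_zero,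
    Matrix.cons_val_one, Matrix.cons_val_fin_one, zero_mul, pd_const]
  have b1 : DifferentiableAt ℝ (fun v : Param => (f (v 1) ^ 2)⁻¹ * (f (v 1) / nrad f (v 1))) w :=
    DifferentiableAt.comp (g := fun t => (f t ^ 2)⁻¹ * (f t / nrad f t)) w
      (g1 (w 1)).differentiableAt (h1 w)
  have b2 : DifferentiableAt ℝ (fun v : Param => nrad f (v 1) ^ 2 * (f (v 1) / nrad f (v 1))) w :=
    DifferentiableAt.comp (g := fun t => nrad f t ^ 2 * (f t / nrad f t)) w
      (g2 (w 1)).differentiableAt (h1 w)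
  rw [pd_mul b1 (du' 0 w), pd_mul b2 (du' 1 w), pd_comp (g1 (w 1)) (h1 w),
    pd_comp (g2 (w 1)) (h1 w), pd_coord, pd_coord]
  have h5 := (hb (w 1)).ne'
  have h6 := (hf0 (w 1)).ne'
  simp [Matrix.trace_fin_two, jacobiForm, jetAt]
  field_simp
  ring

/-! ### Derivative of the mean curvature expression along a curve -/

theorem HasDerivAt.dotProduct₃ {u v : ℝ → R3} {u' v' : R3} {x : ℝ} (hu : HasDerivAt u u' x)
    (hv : HasDerivAt v v' x) :
    HasDerivAt (fun s => u s ⬝ᵥ v s) (u' ⬝ᵥ v x + u x ⬝ᵥ v') x := by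
  have hu' := hasDerivAt_pi.1 hu
  have hv' := hasDerivAt_pi.1 hv
  simp only [Matrix.vec3_dotProduct]
  refine ((((hu' 0).mul (hv' 0)).add ((hu' 1).mul (hv' 1))).add
    ((hu' 2).mul (hv' 2))).congr_deriv ?_
  ring

theorem HasDerivAt.crossProduct {u v : ℝ → R3} {u' v' : R3} {x : ℝ} (hu : HasDerivAt u u' x)
    (hv : HasDerivAt v v' x) :
    HasDerivAt (fun s => crossProduct (u s) (v s))
      (crossProduct u' (v x) + crossProduct (u x) v') x := by
  have hu' := hasDerivAt_pi.1 hu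
  have hv' := hasDerivAt_pi.1 hv
  rw [hasDerivAt_pi]
  simp only [cross_apply]
  intro i
  fin_cases i <;> simp
  · refine (((hu' 1).mul (hv' 2)).sub ((hu' 2).mul (hv' 1))).congr_deriv ?_
    ring
  · refine (((hu' 2).mul (hv' 0)).sub ((hu' 0).mul (hv' 2))).congr_deriv ?_
    ring
  · refine (((hu' 0).mul (hv' 1)).sub ((hu' 1).mul (hv' 0))).congr_deriv ?_
    ring

/-- Quotient rule at a point where the coordinates are orthogonal: `v₁ · v₂ = 0` removes the
undifferentiated mixed terms, and naming the area element `D` removes the square root. -/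
theorem hasDerivAt_hForm {v₁ v₂ v₁₁ v₁₂ v₂₂ : ℝ → R3} {d₁ d₂ d₁₁ d₁₂ d₂₂ : R3} {x D : ℝ}
    (h₁ : HasDerivAt v₁ d₁ x) (h₂ : HasDerivAt v₂ d₂ x) (h₁₁ : HasDerivAt v₁₁ d₁₁ x)
    (h₁₂ : HasDerivAt v₁₂ d₁₂ x) (h₂₂ : HasDerivAt v₂₂ d₂₂ x) (hD : 0 < D)
    (hC : crossProduct (v₁ x) (v₂ x) ⬝ᵥ crossProduct (v₁ x) (v₂ x) = D ^ 2)
    (h0 : v₁ x ⬝ᵥ v₂ x = 0) :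
    let C := crossProduct (v₁ x) (v₂ x)
    let C' := crossProduct d₁ (v₂ x) + crossProduct (v₁ x) d₂
    HasDerivAt (fun s => hForm (v₁ s) (v₂ s) (v₁₁ s) (v₁₂ s) (v₂₂ s))
      (-(2 * (d₂ ⬝ᵥ v₂ x) * (v₁₁ x ⬝ᵥ C) + (v₂ x ⬝ᵥ v₂ x) * (d₁₁ ⬝ᵥ C + v₁₁ x ⬝ᵥ C')
        - 2 * (d₁ ⬝ᵥ v₂ x + v₁ x ⬝ᵥ d₂) * (v₁₂ x ⬝ᵥ C)
        + 2 * (d₁ ⬝ᵥ v₁ x) * (v₂₂ x ⬝ᵥ C) + (v₁ x ⬝ᵥ v₁ x) * (d₂₂ ⬝ᵥ C + v₂₂ x ⬝ᵥ C')) / D ^ 3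
        + 3 * ((v₂ x ⬝ᵥ v₂ x) * (v₁₁ x ⬝ᵥ C) + (v₁ x ⬝ᵥ v₁ x) * (v₂₂ x ⬝ᵥ C)) * (C' ⬝ᵥ C)
          / D ^ 5) x := by
  intro C C'
  have hc : HasDerivAt (fun s => crossProduct (v₁ s) (v₂ s)) C' x := HasDerivAt.crossProduct h₁ h₂
  have hcc := HasDerivAt.dotProduct₃ hc hc
  have hs : √(crossProduct (v₁ x) (v₂ x) ⬝ᵥ crossProduct (v₁ x) (v₂ x)) = D := by
    rw [hC, Real.sqrt_sq hD.le]
  have hsq := hcc.sqrt (by rw [hC]; positivity)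
  have hden := hsq.pow 3
  have hnum := ((((HasDerivAt.dotProduct₃ h₂ h₂).mul (HasDerivAt.dotProduct₃ h₁₁ hc)).sub
    (((HasDerivAt.dotProduct₃ h₁ h₂).const_mul 2).mul (HasDerivAt.dotProduct₃ h₁₂ hc))).add
    ((HasDerivAt.dotProduct₃ h₁ h₁).mul (HasDerivAt.dotProduct₃ h₂₂ hc))).neg
  refine (hnum.div hden (by simp only [Pi.pow_apply, hs]; positivity)).congr_deriv ?_
  simp only [Pi.pow_apply, Pi.neg_apply, Pi.add_apply, Pi.sub_apply, Pi.mul_apply, hs, h0]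
  rw [dotProduct_comm (v₂ x) d₂, dotProduct_comm (v₁ x) d₁, dotProduct_comm (_root_.crossProduct (v₁ x) (v₂ x)) C']
  field_simp
  push_cast
  ring

/-- The derivative of `hForm` along polynomial curves, at parameter `0`. -/
theorem hasDerivAt_hForm_poly (a₁ a₂ a₁₁ a₁₂ a₂₂ d₁ d₂ d₁₁ d₁₂ d₂₂ q₂₂ : R3) {D : ℝ} (hD : 0 < D)
    (hC : crossProduct a₁ a₂ ⬝ᵥ crossProduct a₁ a₂ = D ^ 2) (h0 : a₁ ⬝ᵥ a₂ = 0) :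
    HasDerivAt (fun s : ℝ => hForm (a₁ + s • d₁) (a₂ + s • d₂) (a₁₁ + s • d₁₁) (a₁₂ + s • d₁₂)
        (a₂₂ + s • (d₂₂ + s • q₂₂)))
      (-(2 * (d₂ ⬝ᵥ a₂) * (a₁₁ ⬝ᵥ crossProduct a₁ a₂)
        + (a₂ ⬝ᵥ a₂) * (d₁₁ ⬝ᵥ crossProduct a₁ a₂
          + a₁₁ ⬝ᵥ (crossProduct d₁ a₂ + crossProduct a₁ d₂))
        - 2 * (d₁ ⬝ᵥ a₂ + a₁ ⬝ᵥ d₂) * (a₁₂ ⬝ᵥ crossProduct a₁ a₂)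
        + 2 * (d₁ ⬝ᵥ a₁) * (a₂₂ ⬝ᵥ crossProduct a₁ a₂)
        + (a₁ ⬝ᵥ a₁) * (d₂₂ ⬝ᵥ crossProduct a₁ a₂
          + a₂₂ ⬝ᵥ (crossProduct d₁ a₂ + crossProduct a₁ d₂))) / D ^ 3
        + 3 * ((a₂ ⬝ᵥ a₂) * (a₁₁ ⬝ᵥ crossProduct a₁ a₂)
          + (a₁ ⬝ᵥ a₁) * (a₂₂ ⬝ᵥ crossProduct a₁ a₂))
          * ((crossProduct d₁ a₂ + crossProduct a₁ d₂) ⬝ᵥ crossProduct a₁ a₂) / D ^ 5) 0 := by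
  have hlin : ∀ a d : R3, HasDerivAt (fun e : ℝ => a + e • d) d 0 := fun a d => by
    simpa using ((hasDerivAt_id (0 : ℝ)).smul_const d).const_add a
  have hquad : ∀ a d q : R3, HasDerivAt (fun e : ℝ => a + e • (d + e • q)) d 0 := fun a d q => by
    simpa using ((hasDerivAt_id (0 : ℝ)).smul
      (((hasDerivAt_id (0 : ℝ)).smul_const q).const_add d)).const_add a
  have h := hasDerivAt_hForm (hlin a₁ d₁) (hlin a₂ d₂) (hlin a₁₁ d₁₁) (hlin a₁₂ d₁₂)
    (hquad a₂₂ d₂₂ q₂₂) hD (by simpa using hC) (by simpa using h0)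
  simpa only [zero_smul, add_zero] using h

/-! ### Value and first derivatives of the curvature at the straight unduloid -/

theorem nax_eq (f : ℝ → ℝ) (t : ℝ) : nax f t = -deriv f t * nrad f t := rfl

theorem deriv_deriv_eq (f : ℝ → ℝ) (t : ℝ) : deriv (deriv f) t = -kap f t / nrad f t ^ 3 := by
  have := (nrad_pos f t).ne'
  unfold kap
  field_simp

theorem rpow_three_halves (f : ℝ → ℝ) (t : ℝ) :
    (1 + deriv f t ^ 2) ^ (3 / 2 : ℝ) = (nrad f t ^ 3)⁻¹ := by
  have h : (0 : ℝ) ≤ 1 + deriv f t ^ 2 := by positivity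
  rw [nrad, inv_pow, inv_inv]
  generalize 1 + deriv f t ^ 2 = x at h
  rw [Real.sqrt_eq_rpow, ← Real.rpow_natCast, ← Real.rpow_mul h]
  norm_num

theorem rpow_five_halves (f : ℝ → ℝ) (t : ℝ) :
    (1 + deriv f t ^ 2) ^ (5 / 2 : ℝ) = (nrad f t ^ 5)⁻¹ := by
  have h : (0 : ℝ) ≤ 1 + deriv f t ^ 2 := by positivity
  rw [nrad, inv_pow, inv_inv]
  generalize 1 + deriv f t ^ 2 = x at h
  rw [Real.sqrt_eq_rpow, ← Real.rpow_natCast, ← Real.rpow_mul h]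
  norm_num

/-- This is the profile equation: the two terms are the principal curvatures. -/
theorem IsProfile.kap_add {a T : ℝ} {f : ℝ → ℝ} (hf : IsProfile a T f) (t : ℝ) :
    kap f t + nrad f t / f t = 2 := by
  rw [← hf.ode t, rpow_three_halves]
  unfold kap nrad
  have := (hf.pos t).ne'
  field_simp

variable {f : ℝ → ℝ} {w : Param}

theorem jetCurv_zero_zero (hf0 : 0 < f (w 1)) :
    jetCurv f 0 w 0 = kap f (w 1) + nrad f (w 1) / f (w 1) := by
  have hb := nrad_pos f (w 1)
  have hb2 := nrad_sq f (w 1)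
  unfold jetCurv cylCurv hForm
  simp only [nax_eq, deriv_deriv_eq]
  generalize deriv f (w 1) = f1 at *
  generalize nrad f (w 1) = b at *
  generalize kap f (w 1) = k at *
  generalize f (w 1) = F at *
  simp [cross_apply]
  have hs : √(F * F + F * f1 * (F * f1)) = F / b := by
    rw [Real.sqrt_eq_iff_mul_self_eq_of_pos (by positivity)]
    field_simp
    linear_combination -hb2
  rw [hs]
  have hf1 : f1 ^ 2 = 1 / b ^ 2 - 1 := by field_simp; linear_combination hb2
  field_simp
  grind

theorem firstCoeff_eq (f : ℝ → ℝ) (t : ℝ) : firstCoeff f t =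
    (2 - deriv f t ^ 2) * f t * deriv (deriv f) t * nrad f t ^ 5
      + (1 + 3 * deriv f t ^ 2) * nrad f t ^ 3 := by
  rw [firstCoeff, rpow_three_halves, rpow_five_halves]
  simp only [div_eq_mul_inv, inv_inv]

theorem hasDerivAt_jetCurv_eps (hf0 : 0 < f (w 1)) :
    HasDerivAt (fun e => jetCurv f e w 0) (Real.sin (w 0) * firstCoeff f (w 1)) 0 := by
  have hb := nrad_pos f (w 1)
  have hb2 := nrad_sq f (w 1)
  -- For the zero jet all entries are affine in `e`, except the second `y₃`-derivative; the last
  -- vector is its coefficient of `e²`, which does not affect the derivative at `0`.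
  have h := hasDerivAt_hForm_poly ![0, f (w 1), 0] ![deriv f (w 1), 0, 1] ![-f (w 1), 0, 0]
    ![0, deriv f (w 1), 0] ![deriv (deriv f) (w 1), 0, 0]
    0 ![0, 0, f (w 1) * Real.sin (w 0)] 0 ![0, 0, f (w 1) * Real.cos (w 0)]
    ![-Real.sin (w 0), -Real.cos (w 0), 2 * deriv f (w 1) * Real.sin (w 0)]
    ![-(f (w 1) * Real.sin (w 0)) * Real.sin (w 0),
      -(f (w 1) * Real.sin (w 0)) * Real.cos (w 0), 0]
    (D := f (w 1) / nrad f (w 1)) (by positivity) (by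
      simp [cross_apply]
      field_simp
      linear_combination hb2) (by simp)
  convert h using 1
  · ext e
    unfold jetCurv cylCurv
    congr 1
    all_goals
      ext i
      fin_cases i <;> simp <;> ring
  · rw [firstCoeff_eq]
    generalize deriv f (w 1) = f1 at *
    generalize deriv (deriv f) (w 1) = f2 at *
    generalize nrad f (w 1) = b at *
    generalize f (w 1) = F at *
    generalize Real.sin (w 0) = s at *
    generalize Real.cos (w 0) = c at *
    simp [cross_apply]
    field_simp
    grind

/-- First variation of mean curvature under a normal perturbation. For `e = 0` all five vectors are
affine in the jet. The derivative of `kap` occurs only as a multiple of the tangent `(f', 1)`, hence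
cancels against the normal. -/
theorem hasDerivAt_jetCurv_jet (hf0 : 0 < f (w 1)) (p : Jet) :
    HasDerivAt (fun s : ℝ => jetCurv f 0 w (s • p)) (-jacobiForm f w p) 0 := by
  obtain ⟨x, ⟨x1, x2⟩, x11, x12, x22⟩ := p
  have hb := nrad_pos f (w 1)
  have hb2 := nrad_sq f (w 1)
  have h := hasDerivAt_hForm_poly ![0, f (w 1), 0] ![deriv f (w 1), 0, 1] ![-f (w 1), 0, 0]
    ![0, deriv f (w 1), 0] ![deriv (deriv f) (w 1), 0, 0]
    ![x1 * nrad f (w 1), x * nrad f (w 1), x1 * nax f (w 1)]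
    ![x2 * nrad f (w 1) + x * (kap f (w 1) * deriv f (w 1)), 0,
      x2 * nax f (w 1) + x * kap f (w 1)]
    ![x11 * nrad f (w 1) - x * nrad f (w 1), 2 * (x1 * nrad f (w 1)), x11 * nax f (w 1)]
    ![x12 * nrad f (w 1) + x1 * (kap f (w 1) * deriv f (w 1)),
      x2 * nrad f (w 1) + x * (kap f (w 1) * deriv f (w 1)), x12 * nax f (w 1) + x1 * kap f (w 1)]
    ![x22 * nrad f (w 1) + 2 * x2 * (kap f (w 1) * deriv f (w 1))
      + x * (deriv (kap f) (w 1) * deriv f (w 1) + kap f (w 1) * deriv (deriv f) (w 1)), 0,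
      x22 * nax f (w 1) + 2 * x2 * kap f (w 1) + x * deriv (kap f) (w 1)] 0
    (D := f (w 1) / nrad f (w 1)) (by positivity) (by
      simp [cross_apply]
      field_simp
      linear_combination hb2) (by simp)
  convert h using 1
  · ext e
    unfold jetCurv cylCurv
    congr 1
    all_goals
      ext i
      fin_cases i <;> simp <;> ring
  · unfold jacobiForm
    simp only [nax_eq, deriv_deriv_eq]
    generalize deriv f (w 1) = f1 at *
    generalize nrad f (w 1) = b at *
    generalize kap f (w 1) = k at *
    generalize deriv (kap f) (w 1) = k' at *
    generalize f (w 1) = F at *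
    simp [cross_apply]
    field_simp
    grind

variable {f : ℝ → ℝ} {w : Param}

/-! ### Nondegeneracy -/

/-- For constant `h = x` the surface is parallel to the unduloid, with the same normals and `g^{θθ}
= (f + x·nrad)⁻²`. Adding `h_θθ = X` moves the second `θ`-derivative by `X` along the normal and
lowers the curvature by `g^{θθ} X`. The dependence on `x` of this coefficient makes `D_p² q`
nonzero. -/
theorem jetCurv_parallel {x : ℝ} (hr : 0 < f (w 1) + x * nrad f (w 1))
    (hk : 0 < 1 + x * kap f (w 1)) (X : ℝ) :
    jetCurv f 0 w (x, (0, 0), (X, 0, 0)) =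
      jetCurv f 0 w (x, (0, 0), (0, 0, 0)) - X / (f (w 1) + x * nrad f (w 1)) ^ 2 := by
  have hb := nrad_pos f (w 1)
  have hb2 := nrad_sq f (w 1)
  unfold jetCurv cylCurv hForm
  simp only [nax_eq, deriv_deriv_eq]
  generalize deriv f (w 1) = f1 at *
  generalize f (w 1) + x * nrad f (w 1) = r at *
  generalize nrad f (w 1) = b at *
  generalize kap f (w 1) = k at *
  simp [cross_apply]
  have hs : √(r * (1 + x * k) * (r * (1 + x * k)) + r * (f1 + x * (k * f1))
      * (r * (f1 + x * (k * f1)))) = r * (1 + x * k) / b := by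
    rw [Real.sqrt_eq_iff_mul_self_eq_of_pos (by positivity)]
    field_simp
    grind
  rw [hs]
  clear hs
  generalize hK : 1 + x * k = K at *
  field_simp
  grind

/-- With zero value and gradient the curvature is affine in the second derivatives. Both displace
along the same vector, so the coefficients `α`, `β` are in the ratio of `g₂₂ = f'² + (1 + e f sin
θ)²` to `g₁₁ = f²`; only this ratio is needed to compare with `e = 0`. -/
theorem jetCurv_secondDeriv {e : ℝ} (hf0 : 0 < f (w 1))
    (hl : 0 < 1 + e * (f (w 1) * Real.sin (w 0))) :
    ∃ α β : ℝ, α * f (w 1) ^ 2 =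
        β * (deriv f (w 1) ^ 2 + (1 + e * (f (w 1) * Real.sin (w 0))) ^ 2) ∧ ∀ X Z : ℝ,
      jetCurv f e w (0, (0, 0), (X, 0, Z)) = jetCurv f e w 0 - X * α - Z * β := by
  have hb := nrad_pos f (w 1)
  have hb2 := nrad_sq f (w 1)
  have hD : 0 < √(deriv f (w 1) ^ 2 + (1 + e * (f (w 1) * Real.sin (w 0))) ^ 2) :=
    Real.sqrt_pos.2 (by positivity)
  refine ⟨(deriv f (w 1) ^ 2 + (1 + e * (f (w 1) * Real.sin (w 0))) ^ 2) *
    (f (w 1) * (1 + e * (f (w 1) * Real.sin (w 0))) / nrad f (w 1)) /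
    (f (w 1) * √(deriv f (w 1) ^ 2 + (1 + e * (f (w 1) * Real.sin (w 0))) ^ 2)) ^ 3,
    f (w 1) ^ 2 *
    (f (w 1) * (1 + e * (f (w 1) * Real.sin (w 0))) / nrad f (w 1)) /
    (f (w 1) * √(deriv f (w 1) ^ 2 + (1 + e * (f (w 1) * Real.sin (w 0))) ^ 2)) ^ 3, ?_, ?_⟩
  · field_simp
  · intro X Z
    unfold jetCurv cylCurv hForm
    simp only [nax_eq, deriv_deriv_eq, Prod.fst_zero, Prod.snd_zero, zero_mul, add_zero]
    generalize deriv f (w 1) = f1 at *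
    generalize nrad f (w 1) = b at *
    generalize kap f (w 1) = k at *
    generalize 1 + e * (f (w 1) * Real.sin (w 0)) = lam at *
    generalize f (w 1) = F at *
    have hs : √(F * lam * (F * lam) + F * f1 * (F * f1)) = F * √(f1 ^ 2 + lam ^ 2) := by
      rw [← Real.sqrt_sq hf0.le, ← Real.sqrt_mul (by positivity), Real.sqrt_sq hf0.le]
      congr 1
      ring
    simp [cross_apply]
    rw [hs]
    generalize √(f1 ^ 2 + lam ^ 2) = D at *
    field_simp
    grind

theorem jetCurv_secondDeriv_zero (hf0 : 0 < f (w 1)) (X Z : ℝ) :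
    jetCurv f 0 w (0, (0, 0), (X, 0, Z)) =
      jetCurv f 0 w 0 - X * (f (w 1) ^ 2)⁻¹ - Z * nrad f (w 1) ^ 2 := by
  have hb := nrad_pos f (w 1)
  have hb2 := nrad_sq f (w 1)
  unfold jetCurv cylCurv hForm
  simp only [nax_eq, deriv_deriv_eq]
  generalize deriv f (w 1) = f1 at *
  generalize nrad f (w 1) = b at *
  generalize kap f (w 1) = k at *
  generalize f (w 1) = F at *
  simp [cross_apply]
  have hs : √(F * F + F * f1 * (F * f1)) = F / b := by
    rw [Real.sqrt_eq_iff_mul_self_eq_of_pos (by positivity)]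
    field_simp
    linear_combination -hb2
  rw [hs]
  field_simp
  grind

/-- Where `sin θ = 0`, the coefficients in `jetCurv_secondDeriv` coincide with those for `e = 0`, so
the effect of coiling is detected on `h_θ` instead. The factor `x` is split off so that the
derivative at `0` is the value of the cofactor. -/
theorem jetCurv_firstDeriv_sub {e : ℝ} (hf0 : 0 < f (w 1)) (hs : Real.sin (w 0) = 0) (x : ℝ) :
    jetCurv f e w (0, (x, 0), (0, 0, 0)) - jetCurv f 0 w (0, (x, 0), (0, 0, 0)) =
      x * (-(e * Real.cos (w 0) * ((x ^ 2 * deriv f (w 1) ^ 2 * nrad f (w 1)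
        + 2 * f (w 1) ^ 2 * deriv f (w 1) ^ 2 * nrad f (w 1)) / nrad f (w 1) ^ 2
          + (x ^ 2 + f (w 1) ^ 2) / nrad f (w 1)))
        / √(f (w 1) ^ 2 / nrad f (w 1) ^ 2 + x ^ 2 / nrad f (w 1) ^ 2) ^ 3) := by
  have hb := nrad_pos f (w 1)
  have hb2 := nrad_sq f (w 1)
  unfold jetCurv cylCurv hForm
  simp only [nax_eq, deriv_deriv_eq, hs]
  generalize deriv f (w 1) = f1 at *
  generalize nrad f (w 1) = b at *
  generalize kap f (w 1) = k at *
  generalize f (w 1) = F at *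
  generalize Real.cos (w 0) = c at *
  simp [cross_apply]
  have hX : F * F + ((-(x * (f1 * b) * f1) - x * b) * (-(x * (f1 * b) * f1) - x * b)
      + F * f1 * (F * f1)) = F ^ 2 / b ^ 2 + x ^ 2 / b ^ 2 := by
    field_simp
    grind
  rw [hX]
  have hD : 0 < √(F ^ 2 / b ^ 2 + x ^ 2 / b ^ 2) := Real.sqrt_pos.2 (by positivity)
  clear hX
  generalize √(F ^ 2 / b ^ 2 + x ^ 2 / b ^ 2) = D at *
  field_simp
  grind

/-- If `sin θ = 0` the direction is `h_θ`; otherwise it is `h_θθ` or `h_{y₃y₃}`, whichever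
coefficient differs from its value at `e = 0`. The requirement `v.1 = 0` keeps the whole line
through `v` where the cutoff of `h` is inactive. -/
theorem exists_hasDerivAt_jetCurv_sub_ne_zero {e : ℝ} (hf0 : 0 < f (w 1)) (he : e ≠ 0)
    (hl : 0 < 1 + e * (f (w 1) * Real.sin (w 0))) :
    ∃ v : Jet, v.1 = 0 ∧ ∃ d : ℝ, d ≠ 0 ∧
      HasDerivAt (fun s : ℝ => jetCurv f e w (s • v) - jetCurv f 0 w (s • v)) d 0 := by
  have hb := nrad_pos f (w 1)
  have hb2 := nrad_sq f (w 1)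
  by_cases hs : Real.sin (w 0) = 0
  · have hc : Real.cos (w 0) ≠ 0 := fun h => by
      have := Real.sin_sq_add_cos_sq (w 0)
      simp [hs, h] at this
    have hv : ∀ s : ℝ, s • (((0 : ℝ), ((1 : ℝ), (0 : ℝ)), ((0 : ℝ), (0 : ℝ), (0 : ℝ))) : Jet) =
        (0, (s, 0), (0, 0, 0)) := fun s => by simp
    have hpos : 0 < f (w 1) ^ 2 / nrad f (w 1) ^ 2 + (0 : ℝ) ^ 2 / nrad f (w 1) ^ 2 := by
      positivity
    obtain ⟨g, hg, hg0, hgd⟩ : ∃ g : ℝ → ℝ, (∀ x, jetCurv f e w (0, (x, 0), (0, 0, 0))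
        - jetCurv f 0 w (0, (x, 0), (0, 0, 0)) = x * g x) ∧ g 0 ≠ 0 ∧ DifferentiableAt ℝ g 0 := by
      refine ⟨_, jetCurv_firstDeriv_sub hf0 hs, ?_, ?_⟩
      · have := Real.sqrt_pos.2 hpos
        refine div_ne_zero (neg_ne_zero.2 (mul_ne_zero (mul_ne_zero he hc) ?_)) (by positivity)
        positivity
      · have hi : DifferentiableAt ℝ
            (fun x : ℝ => f (w 1) ^ 2 / nrad f (w 1) ^ 2 + x ^ 2 / nrad f (w 1) ^ 2) 0 := by
          fun_prop
        exact DifferentiableAt.fun_div (by fun_prop) ((hi.sqrt hpos.ne').fun_pow 3)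
          (pow_pos (Real.sqrt_pos.2 hpos) 3).ne'
    refine ⟨(0, (1, 0), (0, 0, 0)), rfl, g 0, hg0, ?_⟩
    simp only [hv, hg]
    simpa using (hasDerivAt_id' (0 : ℝ)).fun_mul hgd.hasDerivAt
  · obtain ⟨α, β, hαβ, h⟩ := jetCurv_secondDeriv hf0 hl
    have hd : ∀ X Z : ℝ, HasDerivAt (fun s : ℝ =>
        jetCurv f e w (s • ((0, (0, 0), (X, 0, Z)) : Jet))
          - jetCurv f 0 w (s • ((0, (0, 0), (X, 0, Z)) : Jet)))
        (X * ((f (w 1) ^ 2)⁻¹ - α) + Z * (nrad f (w 1) ^ 2 - β)) 0 := by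
      intro X Z
      have hv : ∀ s : ℝ, s • (((0 : ℝ), ((0 : ℝ), (0 : ℝ)), (X, (0 : ℝ), Z)) : Jet) =
        (0, (0, 0), (s * X, 0, s * Z)) := fun s => by simp
      simp only [hv, h, jetCurv_secondDeriv_zero hf0]
      have := ((hasDerivAt_id (0 : ℝ)).mul_const
        (X * ((f (w 1) ^ 2)⁻¹ - α) + Z * (nrad f (w 1) ^ 2 - β))).const_add
        (jetCurv f e w 0 - jetCurv f 0 w 0)
      rw [one_mul] at this
      refine this.congr_of_eventuallyEq (Filter.Eventually.of_forall fun s => ?_)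
      simp only [id]
      ring
    by_cases hα : α = (f (w 1) ^ 2)⁻¹
    · refine ⟨_, rfl, _, ?_, hd 0 1⟩
      intro h0
      have hβ : β = nrad f (w 1) ^ 2 := by linarith
      rw [hα, hβ, inv_mul_cancel₀ (by positivity)] at hαβ
      -- If both coefficients agreed, then `nrad² (f'² + (1 + y)²) = 1 = nrad² (1 + f'²)`, so `y (2
      -- + y) = 0`. This is impossible since `y ≠ 0` and `1 + y > 0`.
      generalize hy : e * (f (w 1) * Real.sin (w 0)) = y at *
      have h1 : nrad f (w 1) ^ 2 * (y * (2 + y)) = 0 := by linear_combination -hb2 - hαβ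
      have h2 : y ≠ 0 := hy ▸ mul_ne_zero he (mul_ne_zero hf0.ne' hs)
      have h3 : 2 + y ≠ 0 := by linarith
      exact mul_ne_zero (by positivity) (mul_ne_zero h2 h3) h1
    · refine ⟨_, rfl, _, ?_, hd 1 0⟩
      intro h0
      exact hα (by linarith)

/-! ### Symmetries -/

/-- An orientation reversing isometry `ρ`, combined with a reversal of the first parameter,
preserves the oriented normal and hence the sign of the curvature. -/
theorem hForm_neg_left {ρ : R3 → R3} (hd : ∀ u v, ρ u ⬝ᵥ ρ v = u ⬝ᵥ v)
    (ht : ∀ u v w, ρ u ⬝ᵥ crossProduct (ρ v) (ρ w) = -(u ⬝ᵥ crossProduct v w))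
    (v₁ v₂ v₁₁ v₁₂ v₂₂ : R3) :
    hForm (-ρ v₁) (ρ v₂) (ρ v₁₁) (-ρ v₁₂) (ρ v₂₂) = hForm v₁ v₂ v₁₁ v₁₂ v₂₂ := by
  unfold hForm
  simp only [cross_dot_cross, map_neg, LinearMap.neg_apply, neg_dotProduct, dotProduct_neg, hd, ht,
    neg_neg, neg_mul, mul_neg]

theorem hForm_neg_right {ρ : R3 → R3} (hd : ∀ u v, ρ u ⬝ᵥ ρ v = u ⬝ᵥ v)
    (ht : ∀ u v w, ρ u ⬝ᵥ crossProduct (ρ v) (ρ w) = -(u ⬝ᵥ crossProduct v w))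
    (v₁ v₂ v₁₁ v₁₂ v₂₂ : R3) :
    hForm (ρ v₁) (-ρ v₂) (ρ v₁₁) (-ρ v₁₂) (ρ v₂₂) = hForm v₁ v₂ v₁₁ v₁₂ v₂₂ := by
  unfold hForm
  simp only [cross_dot_cross, map_neg, neg_dotProduct, dotProduct_neg, hd, ht,
    neg_neg, neg_mul, mul_neg]

variable (e s c r r₁ r₂ r₁₁ r₁₂ r₂₂ z₁ z₂ z₁₁ z₁₂ z₂₂ : ℝ)

theorem cylCurv_reflect_angle :
    cylCurv e s (-c) r (-r₁) r₂ r₁₁ (-r₁₂) r₂₂ (-z₁) z₂ z₁₁ (-z₁₂) z₂₂ =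
      cylCurv e s c r r₁ r₂ r₁₁ r₁₂ r₂₂ z₁ z₂ z₁₁ z₁₂ z₂₂ := by
  unfold cylCurv
  rw [← hForm_neg_left (ρ := fun v => ![v 0, -v 1, v 2])
    (fun u v => by simp [Matrix.vec3_dotProduct]; ring)
    (fun u v w => by
      rw [Matrix.vec3_dotProduct, Matrix.vec3_dotProduct]
      simp [cross_apply]
      ring)]
  congr 1
  all_goals
    ext i
    fin_cases i <;> simp <;> ring

/-- The height `z` is itself odd under the reflection of the axis, so the signs of its derivatives
are opposite to those of `r`. -/
theorem cylCurv_reflect_axis :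
    cylCurv e s c r r₁ (-r₂) r₁₁ (-r₁₂) r₂₂ (-z₁) z₂ (-z₁₁) z₁₂ (-z₂₂) =
      cylCurv e s c r r₁ r₂ r₁₁ r₁₂ r₂₂ z₁ z₂ z₁₁ z₁₂ z₂₂ := by
  unfold cylCurv
  rw [← hForm_neg_right (ρ := fun v => ![v 0, v 1, -v 2])
    (fun u v => by simp [Matrix.vec3_dotProduct]; ring)
    (fun u v w => by
      rw [Matrix.vec3_dotProduct, Matrix.vec3_dotProduct]
      simp [cross_apply]
      ring)]
  congr 1
  all_goals
    ext i
    fin_cases i <;> simp <;> ring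

theorem cylCurv_zero (s' c' : ℝ) :
    cylCurv 0 s c r r₁ r₂ r₁₁ r₁₂ r₂₂ z₁ z₂ z₁₁ z₁₂ z₂₂ =
      cylCurv 0 s' c' r r₁ r₂ r₁₁ r₁₂ r₂₂ z₁ z₂ z₁₁ z₁₂ z₂₂ := by
  simp [cylCurv]

/-- The jet of a function after the reflections with signs `s₀`, `s₁` in the parameters. -/
def signJet (s₀ s₁ : ℝ) (p : Jet) : Jet :=
  (p.1, (s₀ * p.2.1.1, s₁ * p.2.1.2),
    (s₀ * s₀ * p.2.2.1, s₀ * s₁ * p.2.2.2.1, s₁ * s₁ * p.2.2.2.2))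

theorem jetCurv_reflect_angle (f : ℝ → ℝ) (e : ℝ) (w : Param) (p : Jet) :
    jetCurv f e ![Real.pi - w 0, w 1] (signJet (-1) 1 p) = jetCurv f e w p := by
  unfold jetCurv
  rw [← cylCurv_reflect_angle]
  simp only [signJet, Matrix.cons_val_zero, Matrix.cons_val_one, Real.sin_pi_sub, Real.cos_pi_sub]
  congr 1 <;> ring

/-- The angle enters `cylCurv` only multiplied by `e`, so for `e = 0` the reflection may be taken
about any meridian plane. This is the source of evenness in `y₂`. -/
theorem jetCurv_reflect_angle' (f : ℝ → ℝ) (w : Param) (p : Jet) :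
    jetCurv f 0 ![-w 0, w 1] (signJet (-1) 1 p) = jetCurv f 0 w p := by
  unfold jetCurv
  rw [← cylCurv_reflect_angle, cylCurv_zero (s' := Real.sin (w 0)) (c' := Real.cos (w 0))]
  simp only [signJet, Matrix.cons_val_zero, Matrix.cons_val_one]
  congr 1 <;> ring

theorem deriv_even {g : ℝ → ℝ} (hg : ∀ t, g (-t) = g t) (t : ℝ) : deriv g (-t) = -deriv g t := by
  have h : (fun x => g (-x)) = g := funext hg
  have h2 := deriv_comp_neg g t
  rw [h] at h2
  linarith

theorem deriv_odd {g : ℝ → ℝ} (hg : ∀ t, g (-t) = -g t) (t : ℝ) : deriv g (-t) = deriv g t := by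
  have h : (fun x => g (-x)) = fun x => -g x := funext hg
  have h2 := deriv_comp_neg g t
  rw [h, deriv.fun_neg] at h2
  linarith

theorem nrad_even (hf : ∀ t, f (-t) = f t) (t : ℝ) : nrad f (-t) = nrad f t := by
  rw [nrad, nrad, deriv_even hf, neg_sq]

theorem kap_even (hf : ∀ t, f (-t) = f t) (t : ℝ) : kap f (-t) = kap f t := by
  rw [kap, kap, deriv_odd (deriv_even hf), nrad_even hf]

theorem nax_odd (hf : ∀ t, f (-t) = f t) (t : ℝ) : nax f (-t) = -nax f t := by
  rw [nax, nax, deriv_even hf, nrad_even hf]; ring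

theorem jetCurv_reflect_axis (hf : ∀ t, f (-t) = f t) (e : ℝ) (w : Param) (p : Jet) :
    jetCurv f e ![w 0, -w 1] (signJet 1 (-1) p) = jetCurv f e w p := by
  unfold jetCurv
  rw [← cylCurv_reflect_axis]
  simp only [signJet, Matrix.cons_val_zero, Matrix.cons_val_one, hf, nrad_even hf, kap_even hf,
    nax_odd hf, deriv_even hf, deriv_odd (deriv_even hf), deriv_even (kap_even hf)]
  congr 1 <;> ring

theorem jacobiForm_reflect_angle (f : ℝ → ℝ) (w : Param) (θ : ℝ) (p : Jet) :
    jacobiForm f ![θ, w 1] (signJet (-1) 1 p) = jacobiForm f w p := by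
  simp [jacobiForm, signJet]

theorem jacobiForm_reflect_axis (hf : ∀ t, f (-t) = f t) (w : Param) (p : Jet) :
    jacobiForm f ![w 0, -w 1] (signJet 1 (-1) p) = jacobiForm f w p := by
  simp only [jacobiForm, signJet, Matrix.cons_val_one, Matrix.cons_val_fin_one, hf, nrad_even hf, kap_even hf,
    deriv_even hf]
  ring

theorem jetCurv_add_period {T : ℝ} (hf : Function.Periodic f T) (e : ℝ) (w : Param) (p : Jet)
    (k : ℤ) (m : ℤ) :
    jetCurv f e ![w 0 + k * (2 * Real.pi), w 1 + m * T] p = jetCurv f e w p ∧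
    jacobiForm f ![w 0 + k * (2 * Real.pi), w 1 + m * T] p = jacobiForm f w p := by
  have h : ∀ {g : ℝ → ℝ}, Function.Periodic g T → Function.Periodic (deriv g) T :=
      fun {g} hg t => by
    rw [← deriv_comp_add_const g T, funext hg]
  have h1 := h hf
  have h2 := h h1
  have h3 : Function.Periodic (nrad f) T := fun t => by rw [nrad, nrad, h1]
  have h4 : Function.Periodic (nax f) T := fun t => by rw [nax, nax, h1, h3]
  have h5 : Function.Periodic (kap f) T := fun t => by rw [kap, kap, h2, h3]
  have h6 := h h5
  unfold jetCurv jacobiForm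
  simp only [Matrix.cons_val_zero, Matrix.cons_val_one, Real.sin_add_int_mul_two_pi,
    Real.cos_add_int_mul_two_pi, hf.int_mul m _, h1.int_mul m _, h2.int_mul m _, h3.int_mul m _,
    h4.int_mul m _, h5.int_mul m _, h6.int_mul m _, and_self]

/-- The jet of a function which is invariant under an affine map of the parameters. -/
theorem jetAt_of_invariant {u : Param → ℝ} (hu : ContDiff ℝ 2 u) (a : Param) (s₀ s₁ : ℝ)
    (h : ∀ w, u ![a 0 + s₀ * w 0, a 1 + s₁ * w 1] = u w) (w : Param) :
    jetAt u w = signJet s₀ s₁ (jetAt u ![a 0 + s₀ * w 0, a 1 + s₁ * w 1]) := by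
  have key : ∀ {v : Param → ℝ}, Differentiable ℝ v → ∀ w,
      pd 0 (fun w => v ![a 0 + s₀ * w 0, a 1 + s₁ * w 1]) w =
        s₀ * pd 0 v ![a 0 + s₀ * w 0, a 1 + s₁ * w 1] ∧
      pd 1 (fun w => v ![a 0 + s₀ * w 0, a 1 + s₁ * w 1]) w =
        s₁ * pd 1 v ![a 0 + s₀ * w 0, a 1 + s₁ * w 1] := by
    intro v hv w
    have hσ : HasFDerivAt (fun w : Param => (![a 0 + s₀ * w 0, a 1 + s₁ * w 1] : Param))
        (ContinuousLinearMap.pi ![s₀ • (ContinuousLinearMap.proj 0 : Param →L[ℝ] ℝ),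
          s₁ • (ContinuousLinearMap.proj 1 : Param →L[ℝ] ℝ)]) w := by
      rw [hasFDerivAt_pi']
      intro i
      have hp : ∀ j : Fin 2, HasFDerivAt (fun w : Param => w j) (ContinuousLinearMap.proj j) w :=
        fun j => (ContinuousLinearMap.proj (R := ℝ) (φ := fun _ : Fin 2 => ℝ) j).hasFDerivAt
      fin_cases i
      · exact ((hp 0).const_mul s₀).const_add (a 0)
      · exact ((hp 1).const_mul s₁).const_add (a 1)
    have h1 := (hv ![a 0 + s₀ * w 0, a 1 + s₁ * w 1]).hasFDerivAt.comp w hσ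
    have h2 : HasFDerivAt (fun w => v ![a 0 + s₀ * w 0, a 1 + s₁ * w 1]) _ w := h1
    constructor
    · have hL : ContinuousLinearMap.pi ![s₀ • (ContinuousLinearMap.proj 0 : Param →L[ℝ] ℝ),
          s₁ • (ContinuousLinearMap.proj 1 : Param →L[ℝ] ℝ)] (Pi.single 0 1) =
          s₀ • (Pi.single 0 1 : Param) := by
        ext i
        fin_cases i <;> simp
      rw [pd, h2.fderiv, ContinuousLinearMap.comp_apply, hL, map_smul, smul_eq_mul]
      rfl
    · have hL : ContinuousLinearMap.pi ![s₀ • (ContinuousLinearMap.proj 0 : Param →L[ℝ] ℝ),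
          s₁ • (ContinuousLinearMap.proj 1 : Param →L[ℝ] ℝ)] (Pi.single 1 1) =
          s₁ • (Pi.single 1 1 : Param) := by
        ext i
        fin_cases i <;> simp
      rw [pd, h2.fderiv, ContinuousLinearMap.comp_apply, hL, map_smul, smul_eq_mul]
      rfl
  have du := hu.differentiable (by simp)
  have du' : ∀ j, Differentiable ℝ (pd j u) := fun j =>
    (ContDiff.pd (m := 1) hu (by norm_num) j).differentiable (by simp)
  have hfun : (fun w => u ![a 0 + s₀ * w 0, a 1 + s₁ * w 1]) = u := funext h
  have e0 : pd 0 u = fun w => s₀ * pd 0 u ![a 0 + s₀ * w 0, a 1 + s₁ * w 1] :=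
    funext fun w => by rw [← (key du w).1, hfun]
  have e1 : pd 1 u = fun w => s₁ * pd 1 u ![a 0 + s₀ * w 0, a 1 + s₁ * w 1] :=
    funext fun w => by rw [← (key du w).2, hfun]
  have hσ : Differentiable ℝ (fun w : Param => (![a 0 + s₀ * w 0, a 1 + s₁ * w 1] : Param)) := by
    rw [differentiable_pi]
    intro i
    fin_cases i <;> simp <;> fun_prop
  have hm : ∀ i j (c : ℝ), pd i (fun w => c * pd j u ![a 0 + s₀ * w 0, a 1 + s₁ * w 1]) w =
      c * pd i (fun w => pd j u ![a 0 + s₀ * w 0, a 1 + s₁ * w 1]) w := fun i j c => by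
    have h1 : DifferentiableAt ℝ (fun w => pd j u ![a 0 + s₀ * w 0, a 1 + s₁ * w 1]) w :=
      (du' j).comp hσ w
    rw [pd_mul (differentiableAt_const _) h1, pd_const, zero_mul, zero_add]
  have e00 : pd 0 (pd 0 u) w = s₀ * s₀ * pd 0 (pd 0 u) ![a 0 + s₀ * w 0, a 1 + s₁ * w 1] := by
    conv_lhs => rw [e0]
    rw [hm, (key (du' 0) w).1]; ring
  have e01 : pd 0 (pd 1 u) w = s₀ * s₁ * pd 0 (pd 1 u) ![a 0 + s₀ * w 0, a 1 + s₁ * w 1] := by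
    conv_lhs => rw [e1]
    rw [hm, (key (du' 1) w).1]; ring
  have e11 : pd 1 (pd 1 u) w = s₁ * s₁ * pd 1 (pd 1 u) ![a 0 + s₀ * w 0, a 1 + s₁ * w 1] := by
    conv_lhs => rw [e1]
    rw [hm, (key (du' 1) w).2]; ring
  simp only [jetAt, signJet, e00, e01, e11, h, Prod.mk.injEq, and_true, true_and]
  exact ⟨congrFun e0 w, congrFun e1 w⟩

/-! ### Smoothness -/

section smooth

variable {E : Type*} [NormedAddCommGroup E] [NormedSpace ℝ E] {m : WithTop ℕ∞}

theorem ContDiff.dotProduct₃ {u v : E → R3} (hu : ContDiff ℝ m u) (hv : ContDiff ℝ m v) :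
    ContDiff ℝ m fun x => u x ⬝ᵥ v x := by
  have hu' := contDiff_pi.1 hu
  have hv' := contDiff_pi.1 hv
  simp only [Matrix.vec3_dotProduct]
  exact (((hu' 0).mul (hv' 0)).add ((hu' 1).mul (hv' 1))).add ((hu' 2).mul (hv' 2))

theorem ContDiff.crossProduct {u v : E → R3} (hu : ContDiff ℝ m u) (hv : ContDiff ℝ m v) :
    ContDiff ℝ m fun x => crossProduct (u x) (v x) := by
  have hu' := contDiff_pi.1 hu
  have hv' := contDiff_pi.1 hv
  simp only [cross_apply]
  rw [contDiff_pi]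
  intro i
  fin_cases i <;> simp <;> exact ((hu' _).mul (hv' _)).sub ((hu' _).mul (hv' _))

theorem contDiff_vec₃ {P Q Z : E → ℝ} (hP : ContDiff ℝ m P)
    (hQ : ContDiff ℝ m Q) (hZ : ContDiff ℝ m Z) :
    ContDiff ℝ m (fun x => (![P x, Q x, Z x] : R3)) := by
  rw [contDiff_pi]
  intro i
  fin_cases i
  exacts [hP, hQ, hZ]

theorem contDiff_hForm {v₁ v₂ v₁₁ v₁₂ v₂₂ : E → R3} (h₁ : ContDiff ℝ m v₁) (h₂ : ContDiff ℝ m v₂)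
    (h₁₁ : ContDiff ℝ m v₁₁) (h₁₂ : ContDiff ℝ m v₁₂) (h₂₂ : ContDiff ℝ m v₂₂)
    (hpos : ∀ x, 0 < crossProduct (v₁ x) (v₂ x) ⬝ᵥ crossProduct (v₁ x) (v₂ x)) :
    ContDiff ℝ m fun x => hForm (v₁ x) (v₂ x) (v₁₁ x) (v₁₂ x) (v₂₂ x) := by
  have hc := ContDiff.crossProduct h₁ h₂
  refine ContDiff.div ?_ (((ContDiff.dotProduct₃ hc hc).sqrt fun x => (hpos x).ne').pow 3)
    fun x => pow_ne_zero 3 (Real.sqrt_pos.2 (hpos x)).ne'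
  exact ((((ContDiff.dotProduct₃ h₂ h₂).mul (ContDiff.dotProduct₃ h₁₁ hc)).sub
    ((contDiff_const.mul (ContDiff.dotProduct₃ h₁ h₂)).mul (ContDiff.dotProduct₃ h₁₂ hc))).add
    ((ContDiff.dotProduct₃ h₁ h₁).mul (ContDiff.dotProduct₃ h₂₂ hc))).neg

theorem contDiff_jetCurv (hf : ContDiff ℝ ∞ f) {e : E → ℝ} {w : E → Param} {p : E → Jet}
    (he : ContDiff ℝ ∞ e) (hw : ContDiff ℝ ∞ w) (hp : ContDiff ℝ ∞ p)
    (h : ∀ x, Admissible f (e x) (p x).1 (w x)) :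
    ContDiff ℝ ∞ fun x => jetCurv f (e x) (w x) (p x) := by
  have w0 : ContDiff ℝ ∞ fun x => w x 0 := contDiff_pi.1 hw 0
  have w1 : ContDiff ℝ ∞ fun x => w x 1 := contDiff_pi.1 hw 1
  have g0 : ContDiff ℝ ∞ fun x => f (w x 1) := hf.comp w1
  have g1 : ContDiff ℝ ∞ fun x => deriv f (w x 1) := (ContDiff.deriv_infty hf).comp w1
  have g2 : ContDiff ℝ ∞ fun x => deriv (deriv f) (w x 1) :=
    (ContDiff.deriv_infty (ContDiff.deriv_infty hf)).comp w1
  have g3 : ContDiff ℝ ∞ fun x => nrad f (w x 1) := (contDiff_nrad hf).comp w1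
  have g4 : ContDiff ℝ ∞ fun x => nax f (w x 1) := (contDiff_nax hf).comp w1
  have g5 : ContDiff ℝ ∞ fun x => kap f (w x 1) := (contDiff_kap hf).comp w1
  have g6 : ContDiff ℝ ∞ fun x => deriv (kap f) (w x 1) :=
    (ContDiff.deriv_infty (contDiff_kap hf)).comp w1
  have s0 : ContDiff ℝ ∞ fun x => Real.sin (w x 0) := w0.sin
  have c0 : ContDiff ℝ ∞ fun x => Real.cos (w x 0) := w0.cos
  have p0 : ContDiff ℝ ∞ fun x => (p x).1 := hp.fst
  have p1 : ContDiff ℝ ∞ fun x => (p x).2.1.1 := hp.snd.fst.fst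
  have p2 : ContDiff ℝ ∞ fun x => (p x).2.1.2 := hp.snd.fst.snd
  have p11 : ContDiff ℝ ∞ fun x => (p x).2.2.1 := hp.snd.snd.fst
  have p12 : ContDiff ℝ ∞ fun x => (p x).2.2.2.1 := hp.snd.snd.snd.fst
  have p22 : ContDiff ℝ ∞ fun x => (p x).2.2.2.2 := hp.snd.snd.snd.snd
  unfold jetCurv cylCurv
  refine contDiff_hForm (contDiff_vec₃ ?_ ?_ ?_) (contDiff_vec₃ ?_ ?_ ?_) (contDiff_vec₃ ?_ ?_ ?_)
    (contDiff_vec₃ ?_ ?_ ?_) (contDiff_vec₃ ?_ ?_ ?_) fun x => cross_ne_zero_of_pos (h x) _ _ _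
  all_goals fun_prop

theorem contDiff_jacobiForm (hf : ContDiff ℝ ∞ f) (hf0 : ∀ t, 0 < f t) {w : E → Param}
    {p : E → Jet} (hw : ContDiff ℝ ∞ w) (hp : ContDiff ℝ ∞ p) :
    ContDiff ℝ ∞ fun x => jacobiForm f (w x) (p x) := by
  have w1 : ContDiff ℝ ∞ fun x => w x 1 := contDiff_pi.1 hw 1
  have g0 : ContDiff ℝ ∞ fun x => f (w x 1) := hf.comp w1
  have g1 : ContDiff ℝ ∞ fun x => deriv f (w x 1) := (ContDiff.deriv_infty hf).comp w1
  have g3 : ContDiff ℝ ∞ fun x => nrad f (w x 1) := (contDiff_nrad hf).comp w1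
  have g5 : ContDiff ℝ ∞ fun x => kap f (w x 1) := (contDiff_kap hf).comp w1
  have p0 : ContDiff ℝ ∞ fun x => (p x).1 := hp.fst
  have p2 : ContDiff ℝ ∞ fun x => (p x).2.1.2 := hp.snd.fst.snd
  have p11 : ContDiff ℝ ∞ fun x => (p x).2.2.1 := hp.snd.snd.fst
  have p22 : ContDiff ℝ ∞ fun x => (p x).2.2.2.2 := hp.snd.snd.snd.snd
  have i0 : ContDiff ℝ ∞ fun x => (f (w x 1))⁻¹ := g0.inv fun x => (hf0 _).ne'
  unfold jacobiForm
  simp only [div_eq_mul_inv, ← inv_pow]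
  fun_prop

end smooth

/-! ### Cutoffs and uniform bounds -/

/-- The function `x` times a bump. Its range lies in `[-2δ, 2δ]`, so composing with it extends a
function smooth for `|x| ≤ 2δ` to the whole line, without change for `|x| ≤ δ`. -/
theorem exists_cutoff {δ : ℝ} (hδ : 0 < δ) :
    ∃ χ : ℝ → ℝ, ContDiff ℝ ∞ χ ∧ (∀ x, |χ x| ≤ 2 * δ) ∧ ∀ x, |x| ≤ δ → χ x = x := by
  let b : ContDiffBump (0 : ℝ) := ⟨δ, 2 * δ, hδ, by linarith⟩
  refine ⟨fun x => x * b x, contDiff_id.mul b.contDiff, fun x => ?_, fun x hx => ?_⟩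
  · rw [abs_mul, abs_of_nonneg b.nonneg]
    by_cases h : |x| ≤ 2 * δ
    · calc |x| * b x ≤ |x| * 1 := by gcongr; exact b.le_one
        _ ≤ 2 * δ := by linarith
    · have h0 : b x = 0 := b.zero_of_le_dist (by
        simp only [Real.dist_eq, sub_zero]
        exact (not_le.1 h).le)
      rw [h0, mul_zero]
      linarith
  · have h1 : b x = 1 := b.one_of_mem_closedBall (by simpa [Real.dist_eq] using hx)
    simp only [h1, mul_one]

theorem exists_mem_Icc_of_periodic {g : ℝ → ℝ} {T : ℝ} (hg : Function.Periodic g T) (hT : 0 < T)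
    (t : ℝ) : ∃ s ∈ Set.Icc 0 T, g t = g s := by
  obtain ⟨s, hs, h⟩ := hg.exists_mem_Ico₀ hT t
  exact ⟨s, ⟨hs.1, hs.2.le⟩, h⟩

theorem exists_abs_le_of_periodic {g : ℝ → ℝ} {T : ℝ} (hg : Function.Periodic g T) (hT : 0 < T)
    (hc : Continuous g) : ∃ B, 0 < B ∧ ∀ t, |g t| ≤ B := by
  obtain ⟨B, hB⟩ := (isCompact_Icc (a := (0 : ℝ)) (b := T)).exists_bound_of_continuousOn
    hc.continuousOn
  refine ⟨max B 1, by positivity, fun t => ?_⟩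
  obtain ⟨s, hs, h⟩ := exists_mem_Icc_of_periodic hg hT t
  rw [h]
  exact (hB s hs).trans (le_max_left _ _)

theorem Periodic.deriv {g : ℝ → ℝ} {T : ℝ} (hg : Function.Periodic g T) :
    Function.Periodic (deriv g) T := fun t => by
  rw [← deriv_comp_add_const g T, funext hg]

theorem periodic_kap {f : ℝ → ℝ} {T : ℝ} (hf : Function.Periodic f T) :
    Function.Periodic (kap f) T := fun t => by
  rw [kap, kap, nrad, nrad, Periodic.deriv hf, Periodic.deriv (Periodic.deriv hf)]

theorem periodic_firstCoeff {f : ℝ → ℝ} {T : ℝ} (hf : Function.Periodic f T) :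
    Function.Periodic (firstCoeff f) T := fun t => by
  rw [firstCoeff, firstCoeff, hf, Periodic.deriv hf, Periodic.deriv (Periodic.deriv hf)]

theorem firstCoeff_even {f : ℝ → ℝ} (hf : ∀ t, f (-t) = f t) (t : ℝ) :
    firstCoeff f (-t) = firstCoeff f t := by
  rw [firstCoeff, firstCoeff, hf, deriv_even hf, deriv_odd (deriv_even hf), neg_sq]

theorem IsProfile.exists_admissible {a T : ℝ} {f : ℝ → ℝ} (hf : IsProfile a T f) :
    ∃ δ ε : ℝ, 0 < δ ∧ 0 < ε ∧ ∀ e x w, |e| ≤ 2 * ε → |x| ≤ 2 * δ → Admissible f e x w := by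
  have hc := hf.smooth.continuous
  obtain ⟨t₀, -, ht₀⟩ := (isCompact_Icc (a := (0 : ℝ)) (b := T)).exists_isMinOn
    ⟨0, le_refl _, hf.period_pos.le⟩ hc.continuousOn
  have hm : ∀ t, f t₀ ≤ f t := fun t => by
    obtain ⟨s, hs, h⟩ := exists_mem_Icc_of_periodic hf.periodic hf.period_pos t
    rw [h]
    exact ht₀ hs
  have hm0 := hf.pos t₀
  obtain ⟨B, hB0, hB⟩ := exists_abs_le_of_periodic hf.periodic hf.period_pos hc
  obtain ⟨M, hM0, hM⟩ := exists_abs_le_of_periodic (periodic_kap hf.periodic) hf.period_pos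
    (contDiff_kap hf.smooth).continuous
  -- With `f t₀ = min f`, `f ≤ B` and `|kap| ≤ M`, these give `|x| ≤ f t₀ / 2`, `|x| M ≤ 1/2` and
  -- `|e| (B + f t₀) ≤ 1/2`, so each of the three positive quantities keeps at least half of its
  -- main term. The denominators are `4` because the cutoffs range up to twice their thresholds.
  refine ⟨min (f t₀ / 4) (1 / (4 * M)), 1 / (4 * (B + f t₀)), by positivity, by positivity,
    fun e x w he hx => ?_⟩
  have hx1 : |x| ≤ f t₀ / 2 := hx.trans (by linarith [min_le_left (f t₀ / 4) (1 / (4 * M))])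
  have hx2 : |x| * M ≤ 1 / 2 := by
    have h1 : |x| ≤ 2 * (1 / (4 * M)) :=
      hx.trans (by linarith [min_le_right (f t₀ / 4) (1 / (4 * M))])
    calc |x| * M ≤ 2 * (1 / (4 * M)) * M := by gcongr
      _ = 1 / 2 := by field_simp; norm_num
  have hb0 := nrad_pos f (w 1)
  have hb1 : |x * nrad f (w 1)| ≤ f t₀ / 2 := by
    rw [abs_mul, abs_of_pos hb0]
    calc |x| * nrad f (w 1) ≤ |x| * 1 := by gcongr; exact nrad_le_one f _
      _ ≤ f t₀ / 2 := by linarith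
  have hk : |x * kap f (w 1)| ≤ 1 / 2 := by
    rw [abs_mul]
    exact (mul_le_mul_of_nonneg_left (hM _) (abs_nonneg x)).trans hx2
  have hr : 0 < f (w 1) + x * nrad f (w 1) := by
    have := hm (w 1)
    linarith [(abs_le.1 hb1).1]
  refine ⟨hr, by linarith [(abs_le.1 hk).1], ?_⟩
  have hr' : f (w 1) + x * nrad f (w 1) ≤ B + f t₀ := by
    linarith [(abs_le.1 hb1).2, (abs_le.1 (hB (w 1))).2]
  have h3 : |e * ((f (w 1) + x * nrad f (w 1)) * Real.sin (w 0))| ≤ 1 / 2 := by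
    rw [abs_mul, abs_mul, abs_of_pos hr]
    calc |e| * ((f (w 1) + x * nrad f (w 1)) * |Real.sin (w 0)|)
        ≤ 2 * (1 / (4 * (B + f t₀))) * ((B + f t₀) * 1) := by
          gcongr
          exact Real.abs_sin_le_one _
      _ = 1 / 2 := by field_simp; norm_num
  linarith [(abs_le.1 h3).1]

/-- Translation by a period brings each point of `P` into the compact set `s` without changing
derivatives. Invariance is asked of the slice at `e` alone: Hadamard quotients inherit it from the
remainders, with which they are identified only for `c * e = κ`. -/
theorem exists_bound_of_invariant {E : Type} [NormedAddCommGroup E] [NormedSpace ℝ E]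
    (K : ℝ × E → ℝ) (hK : ContDiff ℝ ∞ K) (j : ℕ) {s P V : Set E} (hs : IsCompact s)
    (hP : ∀ x ∈ P, ∃ v ∈ V, x + v ∈ s) :
    ∃ C : ℝ, ∀ e ∈ Set.Icc (0 : ℝ) 1, (∀ v ∈ V, ∀ x, K (e, x + v) = K (e, x)) →
      ∀ x ∈ P, ‖iteratedFDeriv ℝ j (fun x => K (e, x)) x‖ ≤ C := by
  obtain ⟨C, hC⟩ := exists_bound_iteratedFDeriv_slice K hK j hs
  refine ⟨C, fun e he hV x hx => ?_⟩
  obtain ⟨v, hv, hxv⟩ := hP x hx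
  have h1 : (fun x => K (e, x)) = fun x => K (e, x + v) := funext fun x => (hV v hv x).symm
  rw [h1, iteratedFDeriv_comp_add_right (f := fun x => K (e, x))]
  exact hC e he _ hxv

/-- The lattice of periods of functions on the unduloid. -/
def periods (T : ℝ) : Set Param := {v | ∃ k m : ℤ, v = ![k * (2 * Real.pi), m * T]}

theorem exists_periods_add_mem {T : ℝ} (hT : 0 < T) (w : Param) :
    ∃ v ∈ periods T, w + v ∈ Set.Icc 0 (![2 * Real.pi, T] : Param) := by
  have key : ∀ {p : ℝ}, 0 < p → ∀ t : ℝ, ∃ k : ℤ, 0 ≤ t + k * p ∧ t + k * p ≤ p := by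
    intro p hp t
    obtain ⟨k, hk, -⟩ := existsUnique_add_zsmul_mem_Ico hp t 0
    refine ⟨k, ?_, ?_⟩
    · simpa using hk.1
    · simpa using hk.2.le
  obtain ⟨k, hk⟩ := key Real.two_pi_pos (w 0)
  obtain ⟨m, hm⟩ := key hT (w 1)
  refine ⟨_, ⟨k, m, rfl⟩, ?_, ?_⟩
  · intro i
    fin_cases i
    exacts [hk.1, hm.1]
  · intro i
    fin_cases i
    exacts [hk.2, hm.2]

/-! ### The unduloid and its parameters -/

section coord

variable {f : ℝ → ℝ}

theorem cos_sin_arg (hf : ∀ t, 0 < f t) (w : Param) :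
    Real.cos (coord (param f w) 0) = Real.cos (w 0) ∧
      Real.sin (coord (param f w) 0) = Real.sin (w 0) := by
  have h0 := hf (w 1)
  have hz : (⟨f (w 1) * Real.cos (w 0), f (w 1) * Real.sin (w 0)⟩ : ℂ) =
      (f (w 1) : ℂ) * (Complex.cos (w 0) + Complex.sin (w 0) * Complex.I) := by
    apply Complex.ext <;> simp [← Complex.ofReal_cos, ← Complex.ofReal_sin]
  have harg : ((coord (param f w) 0 : ℝ) : Real.Angle) = (w 0 : Real.Angle) := by
    have h1 : coord (param f w) 0 =
        Complex.arg ⟨f (w 1) * Real.cos (w 0), f (w 1) * Real.sin (w 0)⟩ := rfl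
    rw [h1, hz]
    simpa using Complex.arg_mul_cos_add_sin_mul_I_coe_angle h0 (w 0 : Real.Angle)
  rw [← Real.Angle.cos_coe, ← Real.Angle.sin_coe, harg]
  simp

theorem exists_coord_param (hf : ∀ t, 0 < f t) (w : Param) :
    ∃ k : ℤ, coord (param f w) = ![w 0 + k * (2 * Real.pi), w 1] := by
  obtain ⟨hc, hs⟩ := cos_sin_arg hf w
  have h := Real.Angle.cos_sin_inj hc hs
  rw [Real.Angle.angle_eq_iff_two_pi_dvd_sub] at h
  obtain ⟨k, hk⟩ := h
  refine ⟨k, ?_⟩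
  ext i
  fin_cases i
  · simp only [Fin.zero_eta, Matrix.cons_val_zero]
    linarith
  · simp [coord, param]

theorem param_coord (hf : ∀ t, 0 < f t) {y : R3} (hy : y ∈ surface f) : param f (coord y) = y := by
  obtain ⟨w, rfl⟩ := hy
  obtain ⟨hc, hs⟩ := cos_sin_arg hf w
  have h1 : coord (param f w) 1 = w 1 := rfl
  ext i
  fin_cases i <;> simp [param] at * <;> simp [hc, hs, h1]

/-- Functions `2π`-periodic in `θ` descend to the surface, so the branch cut of `Complex.arg` in
`coord` does no harm to smoothness. -/
theorem apply_coord_param (hf : ∀ t, 0 < f t) {α : Type*} (Φ : Param → α)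
    (hΦ : ∀ (k : ℤ) w, Φ ![w 0 + k * (2 * Real.pi), w 1] = Φ w) (w : Param) :
    Φ (coord (param f w)) = Φ w := by
  obtain ⟨k, hk⟩ := exists_coord_param hf w
  rw [hk, hΦ]

theorem param_add_two_pi (f : ℝ → ℝ) (k : ℤ) (w : Param) :
    param f ![w 0 + k * (2 * Real.pi), w 1] = param f w := by
  simp [param, Real.cos_add_int_mul_two_pi, Real.sin_add_int_mul_two_pi]

theorem param_reflect_one (f : ℝ → ℝ) (w : Param) :
    param f ![Real.pi - w 0, w 1] = ![-param f w 0, param f w 1, param f w 2] := by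
  ext i; fin_cases i <;> simp [param]

theorem param_reflect_two (f : ℝ → ℝ) (w : Param) :
    param f ![-w 0, w 1] = ![param f w 0, -param f w 1, param f w 2] := by
  ext i; fin_cases i <;> simp [param]

theorem param_reflect_three (hf : ∀ t, f (-t) = f t) (w : Param) :
    param f ![w 0, -w 1] = ![param f w 0, param f w 1, -param f w 2] := by
  ext i; fin_cases i <;> simp [param, hf]

theorem param_translate {T : ℝ} (hf : Function.Periodic f T) (w : Param) :
    param f ![w 0, w 1 + T] = ![param f w 0, param f w 1, param f w 2 + T] := by
  ext i; fin_cases i <;> simp [param, hf _]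

theorem symmetric_iff {T : ℝ} {u : R3 → ℝ} (hf : ∀ t, f (-t) = f t)
    (hT : Function.Periodic f T) :
    Symmetric T f u ↔ ∀ w, u (param f w) = u (param f ![Real.pi - w 0, w 1]) ∧
      u (param f w) = u (param f ![w 0, -w 1]) ∧ u (param f w) = u (param f ![w 0, w 1 + T]) := by
  simp only [Symmetric, surface, Set.forall_mem_range, param_reflect_one, param_reflect_three hf,
    param_translate hT]

theorem evenY2_iff {u : R3 → ℝ} :
    EvenY2 f u ↔ ∀ w, u (param f w) = u (param f ![-w 0, w 1]) := by
  simp only [EvenY2, surface, Set.forall_mem_range, param_reflect_two]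

theorem signJet_one (p : Jet) : signJet 1 1 p = p := by
  simp [signJet]

theorem vec_eta (w : Param) : ![w 0, w 1] = w := by
  ext i; fin_cases i <;> rfl

variable {h : R3 → ℝ}

theorem jet_param (hf : ∀ t, 0 < f t) (hh : ContDiff ℝ 2 fun w => h (param f w)) (w : Param) :
    jet f h (param f w) = jetAt (fun w => h (param f w)) w := by
  refine apply_coord_param hf (jetAt fun w => h (param f w)) (fun k w => ?_) w
  have := jetAt_of_invariant hh ![k * (2 * Real.pi), 0] 1 1 (fun w => by
    simp only [Matrix.cons_val_zero, Matrix.cons_val_one, one_mul, zero_add]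
    rw [add_comm, param_add_two_pi]) w
  rw [this, signJet_one]
  simp [add_comm]

theorem jetAt_symmetric {T : ℝ} (hf : ∀ t, f (-t) = f t) (hT : Function.Periodic f T)
    (hh : ContDiff ℝ 2 fun w => h (param f w)) (hs : Symmetric T f h) (w : Param) :
    let u := fun w => h (param f w)
    jetAt u ![Real.pi - w 0, w 1] = signJet (-1) 1 (jetAt u w) ∧
    jetAt u ![w 0, -w 1] = signJet 1 (-1) (jetAt u w) ∧
    jetAt u ![w 0, w 1 + T] = jetAt u w := by
  intro u
  have hs' := (symmetric_iff hf hT).1 hs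
  refine ⟨?_, ?_, ?_⟩
  · rw [jetAt_of_invariant hh ![Real.pi, 0] (-1) 1 (fun w => by
      rw [(hs' w).1]; simp [sub_eq_add_neg]) ![Real.pi - w 0, w 1]]
    simp [u, vec_eta]
  · rw [jetAt_of_invariant hh ![0, 0] 1 (-1) (fun w => by
      rw [(hs' w).2.1]; simp) ![w 0, -w 1]]
    simp [u, vec_eta]
  · rw [jetAt_of_invariant hh ![0, T] 1 1 (fun w => by
      rw [(hs' w).2.2]; simp [add_comm]) w, signJet_one]
    simp [u, add_comm]

theorem jetAt_even (hh : ContDiff ℝ 2 fun w => h (param f w)) (hs : EvenY2 f h) (w : Param) :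
    jetAt (fun w => h (param f w)) ![-w 0, w 1] =
      signJet (-1) 1 (jetAt (fun w => h (param f w)) w) := by
  rw [jetAt_of_invariant hh ![0, 0] (-1) 1 (fun w => by
      rw [evenY2_iff.1 hs w]; simp) ![-w 0, w 1]]
  simp [vec_eta]

end coord

/-! ### The terms of the expansion -/

/-- Smooth cutoffs of `1/R` and of the values of the perturbation. -/
structure IsCutoff (f : ℝ → ℝ) (ε δ : ℝ) (χ₁ χ₂ : ℝ → ℝ) : Prop where
  eps_pos : 0 < ε
  delta_pos : 0 < δ
  smooth₁ : ContDiff ℝ ∞ χ₁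
  smooth₂ : ContDiff ℝ ∞ χ₂
  eq₁ : ∀ e, |e| ≤ ε → χ₁ e = e
  eq₂ : ∀ x, |x| ≤ δ → χ₂ x = x
  admissible : ∀ e x w, Admissible f (χ₁ e) (χ₂ x) w

theorem IsProfile.exists_isCutoff {a T : ℝ} {f : ℝ → ℝ} (hf : IsProfile a T f) :
    ∃ ε δ χ₁ χ₂, IsCutoff f ε δ χ₁ χ₂ := by
  obtain ⟨δ, ε, hδ, hε, h⟩ := hf.exists_admissible
  obtain ⟨χ₁, h1, h2, h3⟩ := exists_cutoff hε
  obtain ⟨χ₂, h4, h5, h6⟩ := exists_cutoff hδ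
  exact ⟨ε, δ, χ₁, χ₂, hε, hδ, h1, h4, h3, h6, fun e x w => h _ _ _ (h2 e) (h5 x)⟩

/-- `jetCurv` with cutoffs. -/
def cutCurv (f χ₁ χ₂ : ℝ → ℝ) (e : ℝ) (w : Param) (p : Jet) : ℝ :=
  jetCurv f (χ₁ e) w (χ₂ p.1, p.2)

/-- The second order remainder in `1/R` of the mean curvature of the coiled unduloid. -/
def remainderZero (f χ₁ χ₂ : ℝ → ℝ) (c e : ℝ) (w : Param) : ℝ :=
  c ^ 2 * (cutCurv f χ₁ χ₂ e w 0 - cutCurv f χ₁ χ₂ 0 w 0 -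
    e * (Real.sin (w 0) * firstCoeff f (w 1)))

/-- The change, by coiling, of the effect of a perturbation on the mean curvature. -/
def remainderLin (f χ₁ χ₂ : ℝ → ℝ) (c e : ℝ) (w : Param) (p : Jet) : ℝ :=
  c * (cutCurv f χ₁ χ₂ e w p - cutCurv f χ₁ χ₂ e w 0
    - (cutCurv f χ₁ χ₂ 0 w p - cutCurv f χ₁ χ₂ 0 w 0))

/-- The nonlinear part of the effect of a perturbation on the mean curvature of the unduloid. -/
def remainderQuad (f χ₁ χ₂ : ℝ → ℝ) (w : Param) (p : Jet) : ℝ :=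
  cutCurv f χ₁ χ₂ 0 w p - cutCurv f χ₁ χ₂ 0 w 0 + jacobiForm f w p

section expansion

variable {f χ₁ χ₂ : ℝ → ℝ} {ε δ : ℝ}

theorem IsCutoff.map_zero₁ (hχ : IsCutoff f ε δ χ₁ χ₂) : χ₁ 0 = 0 :=
  hχ.eq₁ 0 (by simpa using hχ.eps_pos.le)

theorem IsCutoff.map_zero₂ (hχ : IsCutoff f ε δ χ₁ χ₂) : χ₂ 0 = 0 :=
  hχ.eq₂ 0 (by simpa using hχ.delta_pos.le)

theorem IsCutoff.cutCurv_eq (hχ : IsCutoff f ε δ χ₁ χ₂) {e : ℝ} (he : |e| ≤ ε) (w : Param)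
    {p : Jet} (hp : |p.1| ≤ δ) : cutCurv f χ₁ χ₂ e w p = jetCurv f e w p := by
  rw [cutCurv, hχ.eq₁ e he, hχ.eq₂ _ hp]

theorem IsCutoff.contDiff_cutCurv (hχ : IsCutoff f ε δ χ₁ χ₂) (hf : ContDiff ℝ ∞ f)
    {E : Type*} [NormedAddCommGroup E] [NormedSpace ℝ E] {e : E → ℝ} {w : E → Param} {p : E → Jet}
    (he : ContDiff ℝ ∞ e) (hw : ContDiff ℝ ∞ w) (hp : ContDiff ℝ ∞ p) :
    ContDiff ℝ ∞ fun x => cutCurv f χ₁ χ₂ (e x) (w x) (p x) :=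
  contDiff_jetCurv hf (hχ.smooth₁.comp he) hw ((hχ.smooth₂.comp hp.fst).prodMk hp.snd)
    fun _ => hχ.admissible _ _ _

theorem IsCutoff.contDiff_cutCurv_right (hχ : IsCutoff f ε δ χ₁ χ₂) (hf : ContDiff ℝ ∞ f) (e : ℝ)
    (w : Param) : ContDiff ℝ ∞ fun p : Jet => cutCurv f χ₁ χ₂ e w p :=
  hχ.contDiff_cutCurv hf (e := fun _ : Jet => e) (w := fun _ => w) (p := fun p => p)
    contDiff_const contDiff_const contDiff_id

theorem cutCurv_reflect_angle (e : ℝ) (w : Param) (p : Jet) :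
    cutCurv f χ₁ χ₂ e ![Real.pi - w 0, w 1] (signJet (-1) 1 p) = cutCurv f χ₁ χ₂ e w p :=
  jetCurv_reflect_angle f (χ₁ e) w (χ₂ p.1, p.2)

theorem IsCutoff.cutCurv_reflect_angle' (hχ : IsCutoff f ε δ χ₁ χ₂) (w : Param) (p : Jet) :
    cutCurv f χ₁ χ₂ 0 ![-w 0, w 1] (signJet (-1) 1 p) = cutCurv f χ₁ χ₂ 0 w p := by
  unfold cutCurv
  rw [hχ.map_zero₁]
  exact jetCurv_reflect_angle' f w (χ₂ p.1, p.2)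

theorem cutCurv_reflect_axis (hf : ∀ t, f (-t) = f t) (e : ℝ) (w : Param) (p : Jet) :
    cutCurv f χ₁ χ₂ e ![w 0, -w 1] (signJet 1 (-1) p) = cutCurv f χ₁ χ₂ e w p :=
  jetCurv_reflect_axis hf (χ₁ e) w (χ₂ p.1, p.2)

theorem signJet_zero (s₀ s₁ : ℝ) : signJet s₀ s₁ 0 = 0 := by
  simp [signJet]

theorem remainderLin_reflect_angle (c e : ℝ) (w : Param) (p : Jet) :
    remainderLin f χ₁ χ₂ c e ![Real.pi - w 0, w 1] (signJet (-1) 1 p) =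
      remainderLin f χ₁ χ₂ c e w p := by
  have h0 : ∀ e, cutCurv f χ₁ χ₂ e ![Real.pi - w 0, w 1] 0 = cutCurv f χ₁ χ₂ e w 0 := fun e => by
    rw [← cutCurv_reflect_angle e w, signJet_zero]
  simp only [remainderLin, cutCurv_reflect_angle, h0]

theorem remainderLin_reflect_axis (hf : ∀ t, f (-t) = f t) (c e : ℝ) (w : Param) (p : Jet) :
    remainderLin f χ₁ χ₂ c e ![w 0, -w 1] (signJet 1 (-1) p) =
      remainderLin f χ₁ χ₂ c e w p := by
  have h0 : ∀ e, cutCurv f χ₁ χ₂ e ![w 0, -w 1] 0 = cutCurv f χ₁ χ₂ e w 0 := fun e => by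
    rw [← cutCurv_reflect_axis hf e w, signJet_zero]
  simp only [remainderLin, cutCurv_reflect_axis hf, h0]

theorem remainderQuad_reflect_angle (w : Param) (p : Jet) :
    remainderQuad f χ₁ χ₂ ![Real.pi - w 0, w 1] (signJet (-1) 1 p) =
      remainderQuad f χ₁ χ₂ w p := by
  have h0 : cutCurv f χ₁ χ₂ 0 ![Real.pi - w 0, w 1] 0 = cutCurv f χ₁ χ₂ 0 w 0 := by
    rw [← cutCurv_reflect_angle 0 w, signJet_zero]
  simp only [remainderQuad, cutCurv_reflect_angle, h0, jacobiForm_reflect_angle]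

theorem IsCutoff.remainderQuad_reflect_angle' (hχ : IsCutoff f ε δ χ₁ χ₂) (w : Param) (p : Jet) :
    remainderQuad f χ₁ χ₂ ![-w 0, w 1] (signJet (-1) 1 p) = remainderQuad f χ₁ χ₂ w p := by
  have h0 : cutCurv f χ₁ χ₂ 0 ![-w 0, w 1] 0 = cutCurv f χ₁ χ₂ 0 w 0 := by
    rw [← hχ.cutCurv_reflect_angle' w, signJet_zero]
  simp only [remainderQuad, hχ.cutCurv_reflect_angle', h0, jacobiForm_reflect_angle]

theorem remainderQuad_reflect_axis (hf : ∀ t, f (-t) = f t) (w : Param) (p : Jet) :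
    remainderQuad f χ₁ χ₂ ![w 0, -w 1] (signJet 1 (-1) p) = remainderQuad f χ₁ χ₂ w p := by
  have h0 : cutCurv f χ₁ χ₂ 0 ![w 0, -w 1] 0 = cutCurv f χ₁ χ₂ 0 w 0 := by
    rw [← cutCurv_reflect_axis hf 0 w, signJet_zero]
  simp only [remainderQuad, cutCurv_reflect_axis hf, h0, jacobiForm_reflect_axis hf]

theorem remainderZero_reflect (hf : ∀ t, f (-t) = f t) (c e : ℝ) (w : Param) :
    remainderZero f χ₁ χ₂ c e ![Real.pi - w 0, w 1] = remainderZero f χ₁ χ₂ c e w ∧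
    remainderZero f χ₁ χ₂ c e ![w 0, -w 1] = remainderZero f χ₁ χ₂ c e w := by
  have h0 : ∀ e, cutCurv f χ₁ χ₂ e ![Real.pi - w 0, w 1] 0 = cutCurv f χ₁ χ₂ e w 0 := fun e => by
    rw [← cutCurv_reflect_angle e w, signJet_zero]
  have h1 : ∀ e, cutCurv f χ₁ χ₂ e ![w 0, -w 1] 0 = cutCurv f χ₁ χ₂ e w 0 := fun e => by
    rw [← cutCurv_reflect_axis hf e w, signJet_zero]
  simp only [remainderZero, h0, h1, Matrix.cons_val_zero, Matrix.cons_val_one,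
    Matrix.cons_val_fin_one, Real.sin_pi_sub, firstCoeff_even hf, and_self]

variable {T : ℝ}

theorem cutCurv_add_period (hT : Function.Periodic f T) (e : ℝ) (w : Param) (p : Jet) (k m : ℤ) :
    cutCurv f χ₁ χ₂ e ![w 0 + k * (2 * Real.pi), w 1 + m * T] p = cutCurv f χ₁ χ₂ e w p :=
  (jetCurv_add_period hT (χ₁ e) w (χ₂ p.1, p.2) k m).1

theorem remainderZero_add_period (hT : Function.Periodic f T) (c e : ℝ) (w : Param) (k m : ℤ) :
    remainderZero f χ₁ χ₂ c e ![w 0 + k * (2 * Real.pi), w 1 + m * T] =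
      remainderZero f χ₁ χ₂ c e w := by
  simp only [remainderZero, cutCurv_add_period hT, Matrix.cons_val_zero, Matrix.cons_val_one,
    Matrix.cons_val_fin_one, Real.sin_add_int_mul_two_pi, (periodic_firstCoeff hT).int_mul m _]

theorem remainderLin_add_period (hT : Function.Periodic f T) (c e : ℝ) (w : Param) (p : Jet)
    (k m : ℤ) : remainderLin f χ₁ χ₂ c e ![w 0 + k * (2 * Real.pi), w 1 + m * T] p =
      remainderLin f χ₁ χ₂ c e w p := by
  simp only [remainderLin, cutCurv_add_period hT]

theorem remainderQuad_add_period (hT : Function.Periodic f T) (w : Param) (p : Jet)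
    (k m : ℤ) : remainderQuad f χ₁ χ₂ ![w 0 + k * (2 * Real.pi), w 1 + m * T] p =
      remainderQuad f χ₁ χ₂ w p := by
  simp only [remainderQuad, cutCurv_add_period hT,
    (jetCurv_add_period hT 0 w p k m).2]

/-! ### Smooth dependence on `1/R` -/

/-- Hadamard's lemma divides the mixed difference by `e`, and `c * e = κ` absorbs the factor `c`. So
one function `K` serves all `n`, with `c = n`, `e = 1/R` and `κ = 2π/T`. -/
theorem IsCutoff.exists_remainderLin_eq (hχ : IsCutoff f ε δ χ₁ χ₂) (hf : ContDiff ℝ ∞ f) (κ : ℝ) :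
    ∃ K : ℝ × (Param × Jet) → ℝ, ContDiff ℝ ∞ K ∧ ∀ c e, c * e = κ →
      ∀ x : Param × Jet, remainderLin f χ₁ χ₂ c e x.1 x.2 = K (e, x) := by
  obtain ⟨K, hK, h⟩ := exists_contDiff_eq_add_mul
    (fun y : ℝ × (Param × Jet) => cutCurv f χ₁ χ₂ y.1 y.2.1 y.2.2)
    (hχ.contDiff_cutCurv hf contDiff_fst contDiff_snd.fst contDiff_snd.snd)
  refine ⟨fun y => κ * (K y - K (y.1, (y.2.1, 0))), contDiff_const.mul (hK.sub
    (hK.comp (contDiff_fst.prodMk (contDiff_snd.fst.prodMk contDiff_const)))),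
    fun c e hce x => ?_⟩
  have h1 := h e x
  have h2 := h e (x.1, 0)
  simp only at h1 h2
  rw [remainderLin, h1, h2, ← hce]
  ring

theorem IsCutoff.hasDerivAt_cutCurv (hχ : IsCutoff f ε δ χ₁ χ₂) (hf0 : ∀ t, 0 < f t) (w : Param) :
    HasDerivAt (fun e => cutCurv f χ₁ χ₂ e w 0) (Real.sin (w 0) * firstCoeff f (w 1)) 0 := by
  refine (hasDerivAt_jetCurv_eps (hf0 (w 1))).congr_of_eventuallyEq ?_
  filter_upwards [Metric.ball_mem_nhds (0 : ℝ) hχ.eps_pos] with e he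
  refine hχ.cutCurv_eq ?_ w (by simpa using hχ.delta_pos.le)
  simpa [Real.dist_eq] using (Metric.mem_ball.1 he).le

/-- Hadamard's lemma is used twice: after removal of the linear term a factor `e²` splits off, and
`c² e² = κ²`. -/
theorem IsCutoff.exists_remainderZero_eq (hχ : IsCutoff f ε δ χ₁ χ₂) (hf : ContDiff ℝ ∞ f)
    (hf0 : ∀ t, 0 < f t) (κ : ℝ) :
    ∃ K : ℝ × Param → ℝ, ContDiff ℝ ∞ K ∧ ∀ c e, c * e = κ →
      ∀ w, remainderZero f χ₁ χ₂ c e w = K (e, w) := by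
  obtain ⟨K, hK, h⟩ := exists_contDiff_eq_add_mul
    (fun y : ℝ × Param => cutCurv f χ₁ χ₂ y.1 y.2 0)
    (hχ.contDiff_cutCurv hf contDiff_fst contDiff_snd contDiff_const)
  obtain ⟨K₂, hK₂, h₂⟩ := exists_contDiff_eq_add_mul K hK
  refine ⟨fun y => κ ^ 2 * K₂ y, contDiff_const.mul hK₂, fun c e hce w => ?_⟩
  -- The quotient at `e = 0` is the `e`-derivative of the curvature there.
  have h0 : K (0, w) = Real.sin (w 0) * firstCoeff f (w 1) := by
    refine HasDerivAt.unique ?_ (hχ.hasDerivAt_cutCurv hf0 w)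
    have hd : DifferentiableAt ℝ (fun e => K (e, w)) 0 :=
      ((hK.comp (contDiff_id.prodMk contDiff_const)).differentiable (by simp)) 0
    have h3 := ((hasDerivAt_id' (0 : ℝ)).fun_mul hd.hasDerivAt).const_add
      (cutCurv f χ₁ χ₂ 0 w 0)
    simp only [one_mul, zero_mul, add_zero] at h3
    refine h3.congr_of_eventuallyEq (Filter.Eventually.of_forall fun e => ?_)
    exact h e w
  have h1 := h e w
  simp only at h1
  rw [remainderZero, h1, h₂, h0, ← hce]
  ring

theorem IsCutoff.contDiff_remainderQuad (hχ : IsCutoff f ε δ χ₁ χ₂) (hf : ContDiff ℝ ∞ f)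
    (hf0 : ∀ t, 0 < f t) :
    ContDiff ℝ ∞ fun x : Param × Jet => remainderQuad f χ₁ χ₂ x.1 x.2 :=
  ((hχ.contDiff_cutCurv hf contDiff_const contDiff_fst contDiff_snd).sub
    (hχ.contDiff_cutCurv hf contDiff_const contDiff_fst contDiff_const)).add
    (contDiff_jacobiForm hf hf0 contDiff_fst contDiff_snd)

/-! ### Vanishing properties -/

section lines

variable {E : Type*} [NormedAddCommGroup E] [NormedSpace ℝ E] {g : E → ℝ}

theorem hasDerivAt_add_smul {x : E} (hg : DifferentiableAt ℝ g x) (v : E) :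
    HasDerivAt (fun s : ℝ => g (x + s • v)) (fderiv ℝ g x v) 0 := by
  have h1 : HasDerivAt (fun s : ℝ => x + s • v) v 0 := by
    simpa using ((hasDerivAt_id (0 : ℝ)).smul_const v).const_add x
  have h2 : HasFDerivAt g (fderiv ℝ g x) (x + (0 : ℝ) • v) := by
    rw [zero_smul, add_zero]; exact hg.hasFDerivAt
  exact h2.comp_hasDerivAt 0 h1

theorem hasDerivAt_smul_zero (hg : DifferentiableAt ℝ g 0) (v : E) :
    HasDerivAt (fun s : ℝ => g (s • v)) (fderiv ℝ g 0 v) 0 := by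
  simpa using hasDerivAt_add_smul hg v

theorem hasDerivAt_fderiv_smul (hg : ContDiff ℝ 2 g) (u v : E) :
    HasDerivAt (fun s : ℝ => fderiv ℝ g (s • u) v) (iteratedFDeriv ℝ 2 g 0 ![u, v]) 0 := by
  have hfd : ContDiff ℝ 1 (fderiv ℝ g) := hg.fderiv_right (by norm_num)
  have hF : HasFDerivAt (fderiv ℝ g) (fderiv ℝ (fderiv ℝ g) 0) 0 :=
    (hfd.differentiable (by simp) 0).hasFDerivAt
  have hG : HasFDerivAt (fun x => fderiv ℝ g x v) ((fderiv ℝ (fderiv ℝ g) 0).flip v) 0 :=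
    ((ContinuousLinearMap.apply ℝ ℝ v).hasFDerivAt.comp (0 : E) hF)
  refine (hasDerivAt_smul_zero hG.differentiableAt u).congr_deriv ?_
  rw [hG.fderiv, iteratedFDeriv_two_apply]
  rfl

end lines

theorem IsCutoff.cutCurv_zero_zero {a : ℝ} (hχ : IsCutoff f ε δ χ₁ χ₂) (hf : IsProfile a T f)
    (w : Param) : cutCurv f χ₁ χ₂ 0 w 0 = 2 := by
  rw [hχ.cutCurv_eq (by simpa using hχ.eps_pos.le) w (by simpa using hχ.delta_pos.le),
    jetCurv_zero_zero (hf.pos _), hf.kap_add]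

theorem IsCutoff.contDiff_remainderLin_right (hχ : IsCutoff f ε δ χ₁ χ₂) (hf : ContDiff ℝ ∞ f)
    (c e : ℝ) (w : Param) : ContDiff ℝ ∞ fun p : Jet => remainderLin f χ₁ χ₂ c e w p := by
  unfold remainderLin
  have h1 := hχ.contDiff_cutCurv_right hf e w
  have h2 := hχ.contDiff_cutCurv_right hf 0 w
  exact contDiff_const.mul ((h1.sub contDiff_const).sub (h2.sub contDiff_const))

theorem IsCutoff.fderiv_remainderLin_ne_zero (hχ : IsCutoff f ε δ χ₁ χ₂) (hf : ContDiff ℝ ∞ f)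
    (hf0 : ∀ t, 0 < f t) {c e : ℝ} (hc : c ≠ 0) (he : e ≠ 0) (he' : |e| ≤ ε) (w : Param) :
    fderiv ℝ (remainderLin f χ₁ χ₂ c e w) 0 ≠ 0 := by
  intro h
  have hadm := (hχ.admissible e 0 w).2.2
  rw [hχ.eq₁ e he', hχ.map_zero₂, zero_mul, add_zero] at hadm
  obtain ⟨v, hv, d, hd, hderiv⟩ := exists_hasDerivAt_jetCurv_sub_ne_zero (hf0 (w 1)) he hadm
  have hsm := hχ.contDiff_remainderLin_right hf c e w
  have h1 := hasDerivAt_smul_zero (hsm.differentiable (by simp) 0) v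
  rw [h] at h1
  have hsv : ∀ s : ℝ, |(s • v).1| ≤ δ := fun s => by simpa [hv] using hχ.delta_pos.le
  have h2 : (fun s : ℝ => remainderLin f χ₁ χ₂ c e w (s • v)) = fun s : ℝ =>
      c * ((jetCurv f e w (s • v) - jetCurv f 0 w (s • v))
        - (cutCurv f χ₁ χ₂ e w 0 - cutCurv f χ₁ χ₂ 0 w 0)) := by
    ext s
    rw [remainderLin, hχ.cutCurv_eq he' w (hsv s),
      hχ.cutCurv_eq (by simpa using hχ.eps_pos.le) w (hsv s)]
    ring
  rw [h2] at h1
  have h3 := h1.unique ((hderiv.sub_const _).const_mul c)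
  simp only [zero_apply] at h3
  exact mul_ne_zero hc hd h3.symm

theorem IsCutoff.contDiff_remainderQuad_right (hχ : IsCutoff f ε δ χ₁ χ₂) (hf : ContDiff ℝ ∞ f)
    (hf0 : ∀ t, 0 < f t) (w : Param) : ContDiff ℝ ∞ fun p : Jet => remainderQuad f χ₁ χ₂ w p := by
  unfold remainderQuad
  have h1 := hχ.contDiff_cutCurv_right hf 0 w
  have h2 : ContDiff ℝ ∞ fun p : Jet => jacobiForm f w p :=
    contDiff_jacobiForm hf hf0 (w := fun _ : Jet => w) (p := fun p => p) contDiff_const contDiff_id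
  exact (h1.sub contDiff_const).add h2

theorem jacobiForm_smul (f : ℝ → ℝ) (w : Param) (s : ℝ) (p : Jet) :
    jacobiForm f w (s • p) = s * jacobiForm f w p := by
  simp only [jacobiForm, Prod.smul_fst, Prod.smul_snd, smul_eq_mul]
  ring

/-- The first variation of the curvature is `-jacobiForm`, which the added `jacobiForm` cancels;
near the zero jet the cutoff is inactive. -/
theorem IsCutoff.fderiv_remainderQuad (hχ : IsCutoff f ε δ χ₁ χ₂) (hf : ContDiff ℝ ∞ f)
    (hf0 : ∀ t, 0 < f t) (w : Param) : fderiv ℝ (remainderQuad f χ₁ χ₂ w) 0 = 0 := by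
  have hsm := hχ.contDiff_remainderQuad_right hf hf0 w
  refine ContinuousLinearMap.ext fun v => ?_
  refine (hasDerivAt_smul_zero (hsm.differentiable (by simp) 0) v).unique ?_
  have h1 := ((hasDerivAt_jetCurv_jet (hf0 (w 1)) v).sub_const
    (cutCurv f χ₁ χ₂ 0 w 0)).fun_add ((hasDerivAt_id' (0 : ℝ)).mul_const (jacobiForm f w v))
  rw [one_mul, neg_add_cancel] at h1
  refine h1.congr_of_eventuallyEq ?_
  have hcont : Continuous fun s : ℝ => |(s • v).1| := by fun_prop
  have hev : ∀ᶠ s in nhds (0 : ℝ), |(s • v).1| < δ :=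
    hcont.continuousAt.eventually_lt continuousAt_const (by simpa using hχ.delta_pos)
  filter_upwards [hev] with s hs
  rw [remainderQuad, hχ.cutCurv_eq (by simpa using hχ.eps_pos.le) w hs.le, jacobiForm_smul]

/-- The second derivative is evaluated on the directions of `h` and `h_θθ`. By `jetCurv_parallel`
the derivative in `h_θθ` at `h = s` is `f⁻² - (f + s·nrad)⁻²`, and its `s`-derivative at `0` is `2
nrad / f³ > 0`. -/
theorem IsCutoff.iteratedFDeriv_remainderQuad_ne_zero (hχ : IsCutoff f ε δ χ₁ χ₂)
    (hf : ContDiff ℝ ∞ f) (hf0 : ∀ t, 0 < f t) (w : Param) :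
    iteratedFDeriv ℝ 2 (remainderQuad f χ₁ χ₂ w) 0 ≠ 0 := by
  intro h
  have hsm := hχ.contDiff_remainderQuad_right hf hf0 w
  let u : Jet := (1, (0, 0), (0, 0, 0))
  let v : Jet := (0, (0, 0), (1, 0, 0))
  have h1 := hasDerivAt_fderiv_smul (by exact_mod_cast contDiff_infty.1 hsm 2) u v
  rw [h, zero_apply] at h1
  have h2 : ∀ s : ℝ, |s| ≤ δ → fderiv ℝ (remainderQuad f χ₁ χ₂ w) (s • u) v =
      1 / f (w 1) ^ 2 - 1 / (f (w 1) + s * nrad f (w 1)) ^ 2 := by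
    intro s hs
    have ha := hχ.admissible 0 s w
    rw [hχ.eq₂ s hs] at ha
    refine (hasDerivAt_add_smul (hsm.differentiable (by simp) (s • u)) v).unique ?_
    have hlin := ((hasDerivAt_id' (0 : ℝ)).mul_const
      (1 / f (w 1) ^ 2 - 1 / (f (w 1) + s * nrad f (w 1)) ^ 2)).const_add
      (remainderQuad f χ₁ χ₂ w (s • u))
    rw [one_mul] at hlin
    refine hlin.congr_of_eventuallyEq (Filter.Eventually.of_forall fun X => ?_)
    have e1 : ((s, (0, 0), (0, 0, 0)) : Jet) + X • v = (s, (0, 0), (X, 0, 0)) := by simp [v]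
    have e2 : s • u = (s, (0, 0), (0, 0, 0)) := by simp [u]
    have he0 : |(0 : ℝ)| ≤ ε := by simpa using hχ.eps_pos.le
    simp only [e2, e1]
    rw [remainderQuad, remainderQuad, hχ.cutCurv_eq he0 w (p := (s, (0, 0), (X, 0, 0))) hs,
      hχ.cutCurv_eq he0 w (p := (s, (0, 0), (0, 0, 0))) hs, jetCurv_parallel ha.1 ha.2.1]
    simp only [jacobiForm]
    ring
  have hF0 := hf0 (w 1)
  have h3 : HasDerivAt (fun s : ℝ => 1 / f (w 1) ^ 2 - 1 / (f (w 1) + s * nrad f (w 1)) ^ 2)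
      (2 * nrad f (w 1) / f (w 1) ^ 3) 0 := by
    have ha := (((hasDerivAt_id' (0 : ℝ)).mul_const (nrad f (w 1))).const_add (f (w 1))).fun_pow 2
    have hb := ((ha.fun_inv (by simp [hF0.ne'])).const_sub (1 / f (w 1) ^ 2))
    simp only [one_div] at hb ⊢
    refine hb.congr_deriv ?_
    simp
    field_simp
  have h4 : HasDerivAt (fun s : ℝ => fderiv ℝ (remainderQuad f χ₁ χ₂ w) (s • u) v)
      (2 * nrad f (w 1) / f (w 1) ^ 3) 0 := by
    refine h3.congr_of_eventuallyEq ?_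
    filter_upwards [Metric.ball_mem_nhds (0 : ℝ) hχ.delta_pos] with s hs
    exact h2 s (by simpa [Real.dist_eq] using (Metric.mem_ball.1 hs).le)
  have h5 := h1.unique h4
  have h6 : 0 < 2 * nrad f (w 1) / f (w 1) ^ 3 := by
    have := nrad_pos f (w 1)
    positivity
  linarith

end expansion

/-! ### Uniform bounds and the expansion -/

section final

variable {f χ₁ χ₂ : ℝ → ℝ} {ε δ a T : ℝ}

theorem add_of_mem_periods {v : Param} (hv : v ∈ periods T) :
    ∃ k m : ℤ, ∀ w : Param, w + v = ![w 0 + k * (2 * Real.pi), w 1 + m * T] := by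
  obtain ⟨k, m, rfl⟩ := hv
  refine ⟨k, m, fun w => ?_⟩
  ext i; fin_cases i <;> simp

theorem exists_bound_of_periodic (hT : 0 < T) (K : ℝ × Param → ℝ) (hK : ContDiff ℝ ∞ K) (j : ℕ) :
    ∃ C : ℝ, ∀ e ∈ Set.Icc (0 : ℝ) 1,
      (∀ w (k m : ℤ), K (e, ![w 0 + k * (2 * Real.pi), w 1 + m * T]) = K (e, w)) →
      ∀ w, ‖iteratedFDeriv ℝ j (fun w => K (e, w)) w‖ ≤ C := by
  obtain ⟨C, hC⟩ := exists_bound_of_invariant K hK j (P := Set.univ)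
    (isCompact_Icc (a := (0 : Param)) (b := ![2 * Real.pi, T]))
    fun w _ => exists_periods_add_mem hT w
  refine ⟨C, fun e he h w => hC e he (fun v hv w => ?_) w trivial⟩
  obtain ⟨k, m, hw⟩ := add_of_mem_periods hv
  rw [hw, h]

theorem exists_bound_of_periodic_jet (hT : 0 < T) (K : ℝ × (Param × Jet) → ℝ)
    (hK : ContDiff ℝ ∞ K) (j : ℕ) (M : ℝ) :
    ∃ C : ℝ, ∀ e ∈ Set.Icc (0 : ℝ) 1,
      (∀ w p (k m : ℤ), K (e, (![w 0 + k * (2 * Real.pi), w 1 + m * T], p)) = K (e, (w, p))) →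
      ∀ w p, ‖p‖ ≤ M → ‖iteratedFDeriv ℝ j (fun x => K (e, x)) (w, p)‖ ≤ C := by
  obtain ⟨C, hC⟩ := exists_bound_of_invariant K hK j (P := {x | ‖x.2‖ ≤ M})
    (V := {v | v.1 ∈ periods T ∧ v.2 = 0})
    ((isCompact_Icc (a := (0 : Param)) (b := ![2 * Real.pi, T])).prod
      (isCompact_closedBall (0 : Jet) M)) fun x hx => by
      obtain ⟨v, hv, hxv⟩ := exists_periods_add_mem hT x.1
      exact ⟨(v, 0), ⟨hv, rfl⟩, hxv, by simpa using hx⟩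
  refine ⟨C, fun e he h w p hp => hC e he (fun v hv x => ?_) (w, p) hp⟩
  obtain ⟨v, p'⟩ := v
  obtain ⟨x, p⟩ := x
  obtain ⟨hv, rfl⟩ : v ∈ periods T ∧ p' = 0 := hv
  obtain ⟨k, m, hw⟩ := add_of_mem_periods hv
  rw [Prod.mk_add_mk, hw, add_zero, h]

theorem IsCutoff.exists_bound_remainderZero (hχ : IsCutoff f ε δ χ₁ χ₂) (hf : IsProfile a T f)
    (κ : ℝ) (j : ℕ) : ∃ C : ℝ, ∀ c e, c * e = κ → e ∈ Set.Icc (0 : ℝ) 1 →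
      ∀ w, ‖iteratedFDeriv ℝ j (remainderZero f χ₁ χ₂ c e) w‖ ≤ C := by
  obtain ⟨K, hK, h⟩ := hχ.exists_remainderZero_eq hf.smooth hf.pos κ
  obtain ⟨C, hC⟩ := exists_bound_of_periodic hf.period_pos K hK j
  refine ⟨C, fun c e hce he w => ?_⟩
  rw [funext (h c e hce)]
  exact hC e he (fun w k m => by
    rw [← h c e hce, ← h c e hce, remainderZero_add_period hf.periodic]) w

theorem IsCutoff.exists_bound_remainderLin (hχ : IsCutoff f ε δ χ₁ χ₂) (hf : IsProfile a T f)
    (κ : ℝ) (j : ℕ) (M : ℝ) : ∃ C : ℝ, ∀ c e, c * e = κ → e ∈ Set.Icc (0 : ℝ) 1 →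
      ∀ w p, ‖p‖ ≤ M → ‖iteratedFDeriv ℝ j
        (fun x : Param × Jet => remainderLin f χ₁ χ₂ c e x.1 x.2) (w, p)‖ ≤ C := by
  obtain ⟨K, hK, h⟩ := hχ.exists_remainderLin_eq hf.smooth κ
  obtain ⟨C, hC⟩ := exists_bound_of_periodic_jet hf.period_pos K hK j M
  refine ⟨C, fun c e hce he w p hp => ?_⟩
  rw [funext (h c e hce)]
  exact hC e he (fun w p k m => by
    rw [← h c e hce, ← h c e hce, remainderLin_add_period hf.periodic]) w p hp

theorem IsCutoff.exists_bound_remainderQuad (hχ : IsCutoff f ε δ χ₁ χ₂) (hf : IsProfile a T f)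
    (j : ℕ) (M : ℝ) : ∃ C : ℝ, ∀ w p, ‖p‖ ≤ M → ‖iteratedFDeriv ℝ j
        (fun x : Param × Jet => remainderQuad f χ₁ χ₂ x.1 x.2) (w, p)‖ ≤ C := by
  obtain ⟨C, hC⟩ := exists_bound_of_periodic_jet hf.period_pos
    (fun y => remainderQuad f χ₁ χ₂ y.2.1 y.2.2)
    ((hχ.contDiff_remainderQuad hf.smooth hf.pos).comp contDiff_snd) j M
  exact ⟨C, hC 0 (by simp) fun w p k m => remainderQuad_add_period hf.periodic w p k m⟩

theorem jacobiForm_zero (f : ℝ → ℝ) (w : Param) : jacobiForm f w 0 = 0 := by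
  simpa using jacobiForm_smul f w 0 0

/-- For `|1/R| ≤ ε` and `|h| < δ` the cutoffs act as the identity. The remainders are defined by
differences, so that the expansion is a telescoping identity once `H(0,0) = 2` and `y₂ = f sin θ`
are inserted. -/
theorem IsCutoff.coiledCurvature_eq (hχ : IsCutoff f ε δ χ₁ χ₂) (hf : IsProfile a T f) {n : ℕ}
    (hn : n ≠ 0) (he : |(radius T n)⁻¹| ≤ ε) {h : R3 → ℝ}
    (hh : ContDiff ℝ 2 fun w => h (param f w)) (hδ : ∀ y ∈ surface f, |h y| < δ) :
    (∀ w, crossVec (coiledParam T f n h) w ≠ 0) ∧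
    ∀ y ∈ surface f, coiledCurvature T f n h y =
      2 + y 1 / (radius T n * f (y 2)) * firstCoeff f (y 2)
        + ((n : ℝ) ^ 2)⁻¹ * remainderZero f χ₁ χ₂ n (radius T n)⁻¹ (coord y)
        - jacobi f h y
        + (n : ℝ)⁻¹ * remainderLin f χ₁ χ₂ n (radius T n)⁻¹ (coord y) (jet f h y)
        + remainderQuad f χ₁ χ₂ (coord y) (jet f h y) := by
  have hn' : (n : ℝ) ≠ 0 := Nat.cast_ne_zero.2 hn
  have hR : radius T n ≠ 0 := by
    have := hf.period_pos.ne'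
    have := Real.pi_ne_zero
    unfold radius
    positivity
  have hsmall : ∀ w, |h (param f w)| ≤ δ := fun w => (hδ _ ⟨w, rfl⟩).le
  have key : ∀ w, _ := fun w => by
    have hadm := hχ.admissible (radius T n)⁻¹ (h (param f w)) w
    rw [hχ.eq₁ _ he, hχ.eq₂ _ (hsmall w)] at hadm
    exact coiled_immersion_and_curvature hf.smooth (fun t => (hf.pos t).ne') hR hh hadm
  refine ⟨fun w => (key w).1, fun y hy => ?_⟩
  have h1 : coiledCurvature T f n h y =
      cutCurv f χ₁ χ₂ (radius T n)⁻¹ (coord y) (jet f h y) := by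
    rw [hχ.cutCurv_eq he _ (hsmall _)]
    exact (key _).2
  have h2 : jacobi f h y = jacobiForm f (coord y) (jet f h y) :=
    jacobiOp_param hf.smooth hf.pos hh (coord y)
  have h3 : y 1 = f (y 2) * Real.sin (coord y 0) := (congrFun (param_coord hf.pos hy) 1).symm
  have h4 : coord y 1 = y 2 := rfl
  have hf0 := (hf.pos (y 2)).ne'
  rw [h1, h2, h3, remainderZero, remainderLin, remainderQuad, hχ.cutCurv_zero_zero hf, h4]
  field_simp
  ring

end final

end Unduloid

end

/-! ### The expansion theorem -/

open Unduloid

theorem proposition3p1 (a₀ T : ℝ) (f : ℝ → ℝ) (ha₀ : 0 < a₀) (ha₀' : a₀ < 1 / 2)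
    (hf : Unduloid.IsProfile a₀ T f) :
    ∃ (δ : ℝ) (N : ℕ) (a : ℕ → Unduloid.R3 → ℝ) (l : ℕ → Unduloid.R3 → Unduloid.Jet → ℝ)
      (q : Unduloid.R3 → Unduloid.Jet → ℝ),
      0 < δ ∧ 0 < N ∧
      -- `a`: smooth on the surface, bounded with all derivatives uniformly in `n`, symmetric
      (∀ n ≥ N, ContDiff ℝ ∞ (fun w => a n (Unduloid.param f w)) ∧
        Unduloid.Symmetric T f (a n)) ∧
      (∀ k : ℕ, ∃ C : ℝ, ∀ n ≥ N, ∀ w : Unduloid.Param,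
        ‖iteratedFDeriv ℝ k (fun v => a n (Unduloid.param f v)) w‖ ≤ C) ∧
      -- `l` and `q`: smooth functions of the point and of `(h, D h, D² h)`, where `|h| < δ`
      (∀ n ≥ N, ContDiffOn ℝ ∞
        (fun x : Unduloid.Param × Unduloid.Jet => l n (Unduloid.param f x.1) x.2)
        {x | |x.2.1| < δ}) ∧
      ContDiffOn ℝ ∞ (fun x : Unduloid.Param × Unduloid.Jet => q (Unduloid.param f x.1) x.2)
        {x | |x.2.1| < δ} ∧
      -- bounded with all derivatives on bounded sets of jets, uniformly in `n`
      (∀ (k : ℕ) (M : ℝ), ∃ C : ℝ, ∀ n ≥ N, ∀ (w : Unduloid.Param) (p : Unduloid.Jet),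
        |p.1| < δ → ‖p‖ ≤ M →
        ‖iteratedFDeriv ℝ k
          (fun x : Unduloid.Param × Unduloid.Jet => l n (Unduloid.param f x.1) x.2) (w, p)‖ ≤ C ∧
        ‖iteratedFDeriv ℝ k
          (fun x : Unduloid.Param × Unduloid.Jet => q (Unduloid.param f x.1) x.2) (w, p)‖ ≤ C) ∧
      -- vanishing properties at `(h, D h, D² h) = (0, 0, 0)`
      (∀ n ≥ N, ∀ y ∈ Unduloid.surface f, l n y 0 = 0 ∧ fderiv ℝ (l n y) 0 ≠ 0) ∧
      (∀ y ∈ Unduloid.surface f,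
        q y 0 = 0 ∧ fderiv ℝ (q y) 0 = 0 ∧ iteratedFDeriv ℝ 2 (q y) 0 ≠ 0) ∧
      -- the expansion and the symmetries, for all small `h`
      (∀ α : ℝ, 0 < α → α < 1 → ∀ h : Unduloid.R3 → ℝ,
        Unduloid.IsC2Holder α f h → Unduloid.Symmetric T f h →
        (∀ y ∈ Unduloid.surface f, |h y| < δ) →
        (∀ n ≥ N,
          (∀ w, Unduloid.crossVec (Unduloid.coiledParam T f n h) w ≠ 0) ∧
          (∀ y ∈ Unduloid.truncated T f n,
            Unduloid.coiledCurvature T f n h y =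
              2 + y 1 / (Unduloid.radius T n * f (y 2)) * Unduloid.firstCoeff f (y 2)
                + ((n : ℝ) ^ 2)⁻¹ * a n y
                - Unduloid.jacobi f h y
                + (n : ℝ)⁻¹ * l n y (Unduloid.jet f h y)
                + q y (Unduloid.jet f h y)) ∧
          Unduloid.Symmetric T f (fun y => l n y (Unduloid.jet f h y))) ∧
        Unduloid.Symmetric T f (fun y => q y (Unduloid.jet f h y)) ∧
        (Unduloid.EvenY2 f h →
          Unduloid.EvenY2 f (fun y => q y (Unduloid.jet f h y)))) := by
  obtain ⟨ε, δ, χ₁, χ₂, hχ⟩ := hf.exists_isCutoff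
  have hT := hf.period_pos
  have hε := hχ.eps_pos
  -- For `n ≥ N` this makes `1/R = 2π/(nT)` at most `ε`, where its cutoff is inactive, and at most
  -- `1`, the range on which the uniform bounds hold.
  obtain ⟨N, hN⟩ := exists_nat_gt (2 * Real.pi / T / min ε 1)
  have hmin : 0 < min ε 1 := lt_min hε one_pos
  have hκ : 0 < 2 * Real.pi / T := by positivity
  have hN0 : 0 < N := by
    have : (0 : ℝ) < N := (by positivity : 0 < 2 * Real.pi / T / min ε 1).trans hN
    exact_mod_cast this
  have hnpos : ∀ n ≥ N, (0 : ℝ) < n := fun n hn => Nat.cast_pos.2 (hN0.trans_le hn)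
  have hR : ∀ n : ℕ, (radius T n)⁻¹ = 2 * Real.pi / T / n := fun n => by
    rw [radius, inv_div, div_div, mul_comm T]
  have he0 : ∀ n ≥ N, 0 < (radius T n)⁻¹ := fun n hn => by
    have := hnpos n hn
    rw [hR]
    positivity
  have hmul : ∀ n ≥ N, (n : ℝ) * (radius T n)⁻¹ = 2 * Real.pi / T := fun n hn => by
    rw [hR, mul_div_cancel₀ _ (hnpos n hn).ne']
  have he : ∀ n ≥ N, (radius T n)⁻¹ ≤ min ε 1 := fun n hn => by
    have h1 : (N : ℝ) ≤ n := Nat.cast_le.2 hn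
    rw [hR, div_le_iff₀ (hnpos n hn)]
    exact (div_le_iff₀' hmin).1 (hN.le.trans h1)
  have heε : ∀ n ≥ N, |(radius T n)⁻¹| ≤ ε := fun n hn => by
    rw [abs_of_pos (he0 n hn)]
    exact (he n hn).trans (min_le_left _ _)
  have hemem : ∀ n ≥ N, (radius T n)⁻¹ ∈ Set.Icc (0 : ℝ) 1 := fun n hn =>
    ⟨(he0 n hn).le, (he n hn).trans (min_le_right _ _)⟩
  -- The factors `n²` and `n` built into the remainders compensate `n⁻²` and `n⁻¹` in the expansion.
  let a : ℕ → R3 → ℝ := fun n y => remainderZero f χ₁ χ₂ n (radius T n)⁻¹ (coord y)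
  let l : ℕ → R3 → Jet → ℝ := fun n y => remainderLin f χ₁ χ₂ n (radius T n)⁻¹ (coord y)
  let q : R3 → Jet → ℝ := fun y => remainderQuad f χ₁ χ₂ (coord y)
  have ha : ∀ n w, a n (param f w) = remainderZero f χ₁ χ₂ n (radius T n)⁻¹ w := fun n =>
    apply_coord_param hf.pos (remainderZero f χ₁ χ₂ n (radius T n)⁻¹) fun k w => by
      simpa using remainderZero_add_period hf.periodic n (radius T n)⁻¹ w k 0
  have hl : ∀ n w, l n (param f w) = remainderLin f χ₁ χ₂ n (radius T n)⁻¹ w := fun n =>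
    apply_coord_param hf.pos (remainderLin f χ₁ χ₂ n (radius T n)⁻¹) fun k w => funext fun p => by
      simpa using remainderLin_add_period hf.periodic n (radius T n)⁻¹ w p k 0
  have hq : ∀ w, q (param f w) = remainderQuad f χ₁ χ₂ w :=
    apply_coord_param hf.pos (remainderQuad f χ₁ χ₂) fun k w => funext fun p => by
      simpa using remainderQuad_add_period hf.periodic w p k 0
  refine ⟨δ, N, a, l, q, hχ.delta_pos, hN0, fun n hn => ⟨?_, ?_⟩, fun k => ?_, fun n hn => ?_, ?_,
    fun k M => ?_, fun n hn y hy => ?_, fun y hy => ?_, fun α _ _ h hh hs hδ => ?_⟩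
  · simp only [ha]
    obtain ⟨K, hK, hKe⟩ := hχ.exists_remainderZero_eq hf.smooth hf.pos (2 * Real.pi / T)
    rw [funext (hKe n _ (hmul n hn))]
    exact hK.comp (contDiff_const.prodMk contDiff_id)
  · rw [symmetric_iff hf.even hf.periodic]
    intro w
    simp only [ha, remainderZero_reflect hf.even, true_and]
    simpa using (remainderZero_add_period hf.periodic n (radius T n)⁻¹ w 0 1).symm
  · obtain ⟨C, hC⟩ := hχ.exists_bound_remainderZero hf (2 * Real.pi / T) k
    refine ⟨C, fun n hn w => ?_⟩
    simp only [ha]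
    exact hC n _ (hmul n hn) (hemem n hn) w
  · simp only [hl]
    obtain ⟨K, hK, hKe⟩ := hχ.exists_remainderLin_eq hf.smooth (2 * Real.pi / T)
    rw [funext (hKe n _ (hmul n hn))]
    exact (hK.comp (contDiff_const.prodMk contDiff_id)).contDiffOn
  · simp only [hq]
    exact (hχ.contDiff_remainderQuad hf.smooth hf.pos).contDiffOn
  · obtain ⟨C₁, hC₁⟩ := hχ.exists_bound_remainderLin hf (2 * Real.pi / T) k M
    obtain ⟨C₂, hC₂⟩ := hχ.exists_bound_remainderQuad hf k M
    refine ⟨max C₁ C₂, fun n hn w p _ hp => ?_⟩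
    simp only [hl, hq]
    exact ⟨(hC₁ n _ (hmul n hn) (hemem n hn) w p hp).trans (le_max_left _ _),
      (hC₂ w p hp).trans (le_max_right _ _)⟩
  · refine ⟨by simp [l, remainderLin], ?_⟩
    exact hχ.fderiv_remainderLin_ne_zero hf.smooth hf.pos (hnpos n hn).ne' (he0 n hn).ne'
      (heε n hn) _
  · exact ⟨by simp [q, remainderQuad, jacobiForm_zero], hχ.fderiv_remainderQuad hf.smooth hf.pos _,
      hχ.iteratedFDeriv_remainderQuad_ne_zero hf.smooth hf.pos _⟩
  · have hj := jet_param hf.pos hh.1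
    have hsym := jetAt_symmetric hf.even hf.periodic hh.1 hs
    refine ⟨fun n hn => ⟨?_, ?_, ?_⟩, ?_, fun hev => ?_⟩
    · exact (hχ.coiledCurvature_eq hf (hN0.trans_le hn).ne' (heε n hn) hh.1 hδ).1
    · intro y hy
      obtain ⟨k, -, hy⟩ := Set.mem_iUnion₂.1 hy
      exact (hχ.coiledCurvature_eq hf (hN0.trans_le hn).ne' (heε n hn) hh.1 hδ).2 y hy.1
    · rw [symmetric_iff hf.even hf.periodic]
      intro w
      simp only [hl, hj, hsym w, remainderLin_reflect_angle, remainderLin_reflect_axis hf.even,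
        true_and]
      simpa using (remainderLin_add_period hf.periodic n (radius T n)⁻¹ w
        (jetAt (fun w => h (param f w)) w) 0 1).symm
    · rw [symmetric_iff hf.even hf.periodic]
      intro w
      simp only [hq, hj, hsym w, remainderQuad_reflect_angle, remainderQuad_reflect_axis hf.even,
        true_and]
      simpa using (remainderQuad_add_period hf.periodic w
        (jetAt (fun w => h (param f w)) w) 0 1).symm
    · rw [evenY2_iff]
      intro w
      simp only [hq, hj, jetAt_even hh.1 hev, hχ.remainderQuad_reflect_angle']
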